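/- Let $\sigma>0$, $\rho>0$, and consider for $S>0$ the equation $$u_t+\frac{\sigma^2S^2}{2}\,\frac{u_{SS}}{(1-\rho S\lambda(S)u_{SS})^2}=0. \qquad (*)$$ A *solution* on a set $U$ of pairs $(S,t)$ is a $C^\infty$ function $u$ on $U$ with nonvanishing denominator satisfying $(*)$ on $U$. A *point symmetry* over an open interval $J$ is a $C^\infty$ vector field $V=\xi\partial_S+\tau\partial_t+\phi\,\partial_u$ on $\{S>0,\ t\in J,\ u\in\mathbb R\}$ whose second prolongation annihilates the left-hand side of $(*)$ at all points of the jet space (with nonvanishing denominator) where the left-hand side is zero. A solution is *invariant under* $V$ if $\xi u_S+\tau u_t=\phi$ along its graph. A symmetry is called *reducing* if $\xi\not\equiv0$, $\tau\not\equiv0$ and $\phi(S,t,0)\equiv0$. For $a\neq0$ put $z=\log S+at$. A set $U\subset\{S>0\}$ is *admissible* for $a$ if it is open, connected, and meets every curve $z=\mathrm{const}$ in a connected (possibly empty) set; then $I=z(U)$ is an open interval. 1. Let $\lambda$ be differentiable on $(0,\infty)$. If $(*)$ has, for some open interval $J\ne\emptyset$, a solution on a nonempty open set $U\subset(0,\infty)\times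 J$ that is invariant under a point symmetry over $J$ with $\xi\not\equiv0$, then $\lambda(S)=\omega S^k$ on $(0,\infty)$ for some $\omega,k\in\mathbb R$. Conversely, if $\lambda(S)=\omega S^k$, then over every such $J$ there is a solution invariant under a reducing symmetry. 2. Let $\lambda(S)=\omega S^k$, $\omega\ne0$, $b=\rho\omega$. * The reducing symmetries are exactly $V=\kappa\left(\partial_t-a\,(S\partial_S+(1-k)u\,\partial_u)\right)$ with $\kappa\neq0$, $a\ne0$; their invariants are $z=\log S+at$ and $uS^{k-1}$. * Let $a\ne0$ and let $U$ be admissible for $a$. Then $u$ is a solution on $U$ invariant under $\partial_t-a(S\partial_S+(1-k)u\partial_u)$ if and only if $u=S^{1-k}v(\log S+at)$ on $U$ for some $v\in C^\infty(I)$, $I=z(U)$, that solves on $I$ (with nonvanishing denominator) $$a v_z+\frac{\sigma^2}{2}\,\frac{m}{(1-bm)^2}=0,\qquad m=v_{zz}+(1-2k)v_z-k(1-k)v .\qquad(**)$$ * Let $v$ be $C^\infty$ on a nonempty open interval $I$. If $v_z\equiv0$ on $I$, then $v$ solves $(**)$ if and only if $k(1-k)v=0$ on $I$. If $v_z$ has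 no zero in $I$, then $v_z=x(v)$ for a $C^\infty$ function $x$ on $v(I)$, and $v$ solves $(**)$ on $I$ if and only if at every point of $v(I)$ one has $\sigma^2-8abx\ge0$ and, for one of the two signs, $$x_v=-1+2k-\frac{\sigma^2}{4ab^2x^2}+\frac1{bx}+\frac{k(1-k)v}{x}\pm\frac{\sqrt{\sigma^2(\sigma^2-8abx)}}{4ab^2x^2}.$$ * For each of the two signs the right-hand side (for $x\ne0$, $\sigma^2-8abx\ge0$) is independent of $v$, i.e. the equation is autonomous, if and only if $k\in\{0,1\}$. 3. Let $\lambda(S)=\omega S$, $\omega\ne0$, $b=\rho\omega$. (a) Let $a\ne0$, $q=\sigma^2/(2a)$ (so $q=4$ if and only if $a=\sigma^2/8$), and let $U$ be admissible for $a$, $I=z(U)$. Then $u$ is a solution on $U$ invariant under $\partial_t-aS\partial_S$ if and only if $u=v(\log S+at)$ on $U$ with $v\in C^\infty(I)$ such that on $I$ one of the following holds: $v_z\equiv0$; or $q>0$ and $v_z\equiv(-1+\sqrt q)/b$; or $q>0$ and $v_z\equiv(-1-\sqrt q)/b$; or $1-\frac{4b}{q}v_z\ge0$ on $I$ and, with $p=\sqrt{1-\frac{4b}{q}v_z}$,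 there is a constant $c$ such that either $(-)$ holds on all of $I$, or $(+)$ holds on all of $I$, or $q=4$ and at each point of $I$ at least one of $(-)$, $(+)$ holds. Here, with $\log$ meaning $\log|\cdot|$ and all arguments of logarithms and all denominators being nonzero (terms with coefficient $0$, which occur for $q=4$, being omitted), $(-)$ is $2q\log(p-1)+(q-\sqrt q-2)\log((p+1)\sqrt q-2)+(q+\sqrt q-2)\log((p+1)\sqrt q+2)=2(q-1)z+c$ if $q>0$, $q\neq1$; $\frac1{1-p}+\frac14\log\left((p+3)^3(p-1)^5\right)=z+c$ if $q=1$; $2\sqrt{-q}\arctan\frac{(p+1)\sqrt{-q}}2-2q\log(p-1)+(2-q)\log(4-q(p+1)^2)=2(1-q)z+c$ if $q<0$; and $(+)$ is $2q\log(p+1)+(q+\sqrt q-2)\log((p-1)\sqrt q-2)+(q-\sqrt q-2)\log((p-1)\sqrt q+2)=2(q-1)z+c$ if $q>0$, $q\ne1$; $\frac1{p+1}+\frac14\log\left((p-3)^3(p+1)^5\right)=z+c$ if $q=1$; $-2\sqrt{-q}\arctan\frac{(p-1)\sqrt{-q}}2-2q\log(1+p)+(2-q)\log(4-q(p-1)^2)=2(1-q)z+c$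 if $q<0$. (b) Let $a=\sigma^2/8$, $z=\log S+\frac{\sigma^2}8t$, $E=S^{3/2}e^{3\sigma^2t/16}$, and let $U$ be admissible for $a$. Then $u$ is a solution on $U$ invariant under $\partial_t-\frac{\sigma^2}{8}S\partial_S$ if and only if on all of $U$ it is one of the following functions, with constants $c,d\in\mathbb R$: * $c>0$, with $X=1+cE+\sqrt{2cE+c^2E^2}$: $\ u=-\frac1bX^{-2/3}-\frac1bX^{2/3}-\frac2b\log\left(X^{-1/3}+X^{1/3}-2\right)+d$; * $c<0$, $|c|E<4$ on $U$, with $\theta=\arccos(1-\frac{|c|}2E)$: $\ u=\frac zb-\frac2b\cos\frac{2\theta}3-\frac4{3b}\log\left(1+2\cos\frac\theta3\right)-\frac{16}{3b}\log\sin\frac\theta6+d$; * $c<0$, $|c|E<4$ on $U$, with $\theta=\arccos(-1+\frac{|c|}2E)$: $\ u=\frac zb-\frac2b\cos\frac{2\pi+2\theta}3-\frac4{3b}\log\left(1+2\cos\frac{\pi+\theta}3\right)-\frac{16}{3b}\log\sin\frac{\pi+\theta}6+d$; * $c<0$: where $|c|E\le4$, with $\theta=\arccos(-1+\frac{|c|}2E)$,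 $\ u=\frac zb-\frac2b\cos\frac{2\theta}3-\frac4{3b}\log\left(-1+2\cos\frac\theta3\right)-\frac{16}{3b}\log\cos\frac\theta6+d$; and where $|c|E>4$, with $\theta=\operatorname{arccosh}(-1+\frac{|c|}2E)$, $\ u=\frac zb-\frac2b\cosh\frac{2\theta}3-\frac{16}{3b}\log\cosh\frac\theta6-\frac4{3b}\log\left(-1+2\cosh\frac\theta3\right)+d$ (same $c,d$); * $u=d$, $\quad u=-\frac3b\left(\log S+\frac{\sigma^2t}8\right)+d$, $\quad u=\frac1b\left(\log S+\frac{\sigma^2t}8\right)+d$. (c) This set is unique up to the symmetry group $G$ of $(*)$, which consists of the time-one maps of the flows on $\{S>0\}\times\mathbb R\times\mathbb R$ of the point symmetries over $J=\mathbb R$: let $U$ be admissible for $a=\sigma^2/8$; then $u$ is, for some $e\in\mathbb R$, a solution on $U$ invariant under $\partial_t-\frac{\sigma^2}8S\partial_S+eS\partial_u$ if and only if its graph over $U$ is the image under some $g\in G$ of the graph, over some set $W\subset\{S>0\}$, of one of the functions listed in (b) with $d=0$ and $c\in\{1,-1\}$ ($c$ being absent in the last three). -/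

import Mathlib

open Set
open scoped ContDiff

noncomputable section

namespace IlliquidHedge

/-! ### The equation `u_t + (σ² S² / 2) u_SS / (1 - ρ S λ(S) u_SS)² = 0` -/

/-- The left-hand side of the equation as a function of the jet coordinates on which it depends. -/
def Delta (σ ρ : ℝ) (lam : ℝ → ℝ) (S ut uSS : ℝ) : ℝ :=
  ut + σ ^ 2 * S ^ 2 / 2 * (uSS / (1 - ρ * S * lam S * uSS) ^ 2)

/-- `u_S` -/
def uS (u : ℝ → ℝ → ℝ) (S t : ℝ) : ℝ := deriv (fun s => u s t) S

/-- `u_t` -/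
def uT (u : ℝ → ℝ → ℝ) (S t : ℝ) : ℝ := deriv (fun r => u S r) t

/-- `u_SS` -/
def uSS (u : ℝ → ℝ → ℝ) (S t : ℝ) : ℝ := deriv (fun s => uS u s t) S

/-- `u` is a smooth solution on the set `U` of pairs `(S, t)`, with nonvanishing denominator. -/
def IsSolution (σ ρ : ℝ) (lam : ℝ → ℝ) (U : Set (ℝ × ℝ)) (u : ℝ → ℝ → ℝ) : Prop :=
  ContDiffOn ℝ ∞ (Function.uncurry u) U ∧
  ∀ S t : ℝ, (S, t) ∈ U →
    1 - ρ * S * lam S * uSS u S t ≠ 0 ∧ Delta σ ρ lam S (uT u S t) (uSS u S t) = 0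

/-- The function `S ↦ om S ^ k`. -/
def powerLaw (om k : ℝ) : ℝ → ℝ := fun S => om * S ^ k

/-! ### Point symmetries -/

/-- The vector field `ξ ∂_S + τ ∂_t + φ ∂_u` on the space of triples `(S, t, u)`. -/
structure VField where
  ξ : ℝ → ℝ → ℝ → ℝ
  τ : ℝ → ℝ → ℝ → ℝ
  φ : ℝ → ℝ → ℝ → ℝ

/-- The base space `S > 0`, `t ∈ J`, `u ∈ ℝ`. -/
def baseSpace (J : Set ℝ) : Set (ℝ × ℝ × ℝ) := {x | 0 < x.1 ∧ x.2.1 ∈ J}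

/-- The three coefficients are smooth on the base space. -/
def VField.IsSmooth (V : VField) (J : Set ℝ) : Prop :=
  ContDiffOn ℝ ∞ (fun x : ℝ × ℝ × ℝ => V.ξ x.1 x.2.1 x.2.2) (baseSpace J) ∧
  ContDiffOn ℝ ∞ (fun x : ℝ × ℝ × ℝ => V.τ x.1 x.2.1 x.2.2) (baseSpace J) ∧
  ContDiffOn ℝ ∞ (fun x : ℝ × ℝ × ℝ => V.φ x.1 x.2.1 x.2.2) (baseSpace J)

/-- Partial derivatives of a function of `(S, t, u)`. -/
def dS (f : ℝ → ℝ → ℝ → ℝ) : ℝ → ℝ → ℝ → ℝ := fun S t u => deriv (fun s => f s t u) S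

/-- Partial derivative in `t`. -/
def dT (f : ℝ → ℝ → ℝ → ℝ) : ℝ → ℝ → ℝ → ℝ := fun S t u => deriv (fun r => f S r u) t

/-- Partial derivative in `u`. -/
def dU (f : ℝ → ℝ → ℝ → ℝ) : ℝ → ℝ → ℝ → ℝ := fun S t u => deriv (fun w => f S t w) u

/-- The `∂/∂u_t` coefficient of the second prolongation; `p = u_S`, `r = u_t`. -/
def VField.prolT (V : VField) (S t u p r : ℝ) : ℝ :=
  dT V.φ S t u + r * dU V.φ S t u - p * dT V.ξ S t u - p * r * dU V.ξ S t u
    - r * dT V.τ S t u - r ^ 2 * dU V.τ S t u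

/-- The `∂/∂u_SS` coefficient of the second prolongation;
`p = u_S`, `r = u_t`, `m = u_SS`, `n = u_St`. -/
def VField.prolSS (V : VField) (S t u p r m n : ℝ) : ℝ :=
  dS (dS V.φ) S t u + 2 * p * dS (dU V.φ) S t u + m * dU V.φ S t u
    + p ^ 2 * dU (dU V.φ) S t u - 2 * m * dS V.ξ S t u - p * dS (dS V.ξ) S t u
    - 2 * p ^ 2 * dS (dU V.ξ) S t u - 3 * p * m * dU V.ξ S t u
    - p ^ 3 * dU (dU V.ξ) S t u - 2 * n * dS V.τ S t u - r * dS (dS V.τ) S t u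
    - 2 * p * r * dS (dU V.τ) S t u - (r * m + 2 * p * n) * dU V.τ S t u
    - p ^ 2 * r * dU (dU V.τ) S t u

/-- The second prolongation of `V` applied to `Delta`. The function `Delta` depends on
`S`, `u_t`, `u_SS` only, so the other components of the prolongation do not contribute. -/
def VField.prolDelta (V : VField) (σ ρ : ℝ) (lam : ℝ → ℝ) (S t u p r m n : ℝ) : ℝ :=
  V.ξ S t u * deriv (fun s => Delta σ ρ lam s r m) S
    + V.prolT S t u p r * deriv (fun r' => Delta σ ρ lam S r' m) r
    + V.prolSS S t u p r m n * deriv (fun m' => Delta σ ρ lam S r m') m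

/-- `V` is an infinitesimal point symmetry: its second prolongation annihilates `Delta` on the
solution manifold `Delta = 0` of the jet space over the base space. -/
def IsPointSymmetry (σ ρ : ℝ) (lam : ℝ → ℝ) (J : Set ℝ) (V : VField) : Prop :=
  V.IsSmooth J ∧
  ∀ S t u p r m n : ℝ, 0 < S → t ∈ J → 1 - ρ * S * lam S * m ≠ 0 →
    Delta σ ρ lam S r m = 0 → V.prolDelta σ ρ lam S t u p r m n = 0

/-- `V` moves `S`: its `∂_S` component does not vanish identically. -/
def VField.MovesS (V : VField) (J : Set ℝ) : Prop := ∃ S t u : ℝ, 0 < S ∧ t ∈ J ∧ V.ξ S t u ≠ 0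

/-- `V` moves `t`: its `∂_t` component does not vanish identically. -/
def VField.MovesT (V : VField) (J : Set ℝ) : Prop := ∃ S t u : ℝ, 0 < S ∧ t ∈ J ∧ V.τ S t u ≠ 0

/-- A point symmetry that moves `S` and `t` and is tangent to `u = 0` (it has no inhomogeneous
part): this is the kind of symmetry used for the reduction. -/
def IsReducingSymmetry (σ ρ : ℝ) (lam : ℝ → ℝ) (J : Set ℝ) (V : VField) : Prop :=
  IsPointSymmetry σ ρ lam J V ∧ V.MovesS J ∧ V.MovesT J ∧
  ∀ S t : ℝ, 0 < S → t ∈ J → V.φ S t 0 = 0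

/-- `u` is a solution on `U` that is invariant under `V`: the vector field `V` is tangent to the
graph of `u`. -/
def IsInvariantSolution (σ ρ : ℝ) (lam : ℝ → ℝ) (V : VField) (U : Set (ℝ × ℝ))
    (u : ℝ → ℝ → ℝ) : Prop :=
  IsSolution σ ρ lam U u ∧
  ∀ S t : ℝ, (S, t) ∈ U →
    V.ξ S t (u S t) * uS u S t + V.τ S t (u S t) * uT u S t = V.φ S t (u S t)

/-- The generator `∂_t - a (S ∂_S + (1 - k) u ∂_u)`, whose invariants are
`log S + a t` and `u S ^ (k - 1)`. -/
def scalingGen (a k : ℝ) : VField where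
  ξ := fun S _ _ => -(a * S)
  τ := fun _ _ _ => 1
  φ := fun _ _ u => -(a * (1 - k) * u)

/-- The generator `∂_t - a S ∂_S + e S ∂_u`; for `k = 1` these are the conjugates of
`scalingGen a 1` under the symmetry group. -/
def shiftedGen (a e : ℝ) : VField where
  ξ := fun S _ _ => -(a * S)
  τ := fun _ _ _ => 1
  φ := fun S _ _ => e * S

/-- The symmetry group: the time-one maps of the flows of the infinitesimal point symmetries on
the base space `S > 0`, `t ∈ ℝ`, `u ∈ ℝ`. -/
def symmetryGroup (σ ρ : ℝ) (lam : ℝ → ℝ) : Set (ℝ × ℝ × ℝ → ℝ × ℝ × ℝ) :=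
  {g | ∃ V : VField, IsPointSymmetry σ ρ lam univ V ∧
    ∀ x : ℝ × ℝ × ℝ, 0 < x.1 → ∃ γ : ℝ → ℝ × ℝ × ℝ, γ 0 = x ∧ γ 1 = g x ∧
      ∀ ε : ℝ, 0 < (γ ε).1 ∧
        HasDerivAt γ
          (V.ξ (γ ε).1 (γ ε).2.1 (γ ε).2.2, V.τ (γ ε).1 (γ ε).2.1 (γ ε).2.2,
            V.φ (γ ε).1 (γ ε).2.1 (γ ε).2.2) ε}

/-- The graph of `u` over `U`. -/
def graphOver (u : ℝ → ℝ → ℝ) (U : Set (ℝ × ℝ)) : Set (ℝ × ℝ × ℝ) :=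
  {x | (x.1, x.2.1) ∈ U ∧ x.2.2 = u x.1 x.2.1}

/-! ### Reduction to ordinary differential equations -/

/-- The invariant variable `z = log S + a t`. -/
def zVar (a S t : ℝ) : ℝ := Real.log S + a * t

/-- The set of values of `z` on `U`. -/
def zImage (a : ℝ) (U : Set (ℝ × ℝ)) : Set ℝ := (fun x : ℝ × ℝ => zVar a x.1 x.2) '' U

/-- Domains of invariant solutions: connected open sets of pairs `(S, t)`, `S > 0`, that meet every
curve `log S + a t = z` in a connected set (for instance the half plane, boxes, and sets
`z₀ < log S + a t < z₁`). -/
def IsAdmissible (a : ℝ) (U : Set (ℝ × ℝ)) : Prop :=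
  IsOpen U ∧ IsConnected U ∧ (∀ x ∈ U, 0 < x.1) ∧
  ∀ z : ℝ, IsPreconnected {t : ℝ | (Real.exp (z - a * t), t) ∈ U}

/-- `v_zz + (1 - 2k) v_z - k (1 - k) v` -/
def secondOrderPart (k : ℝ) (v : ℝ → ℝ) (z : ℝ) : ℝ :=
  deriv (deriv v) z + (1 - 2 * k) * deriv v z - k * (1 - k) * v z

/-- `v` solves on `I` the reduced second order equation
`a v_z + (σ²/2) m / (1 - b m)² = 0`, `m = v_zz + (1 - 2k) v_z - k (1 - k) v`. -/
def SolvesReduced (σ a b k : ℝ) (I : Set ℝ) (v : ℝ → ℝ) : Prop :=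
  ∀ z ∈ I, 1 - b * secondOrderPart k v z ≠ 0 ∧
    a * deriv v z + σ ^ 2 / 2 *
      (secondOrderPart k v z / (1 - b * secondOrderPart k v z) ^ 2) = 0

/-- The right-hand sides (`s = -1` and `s = 1`) of the two first order equations
`x_v = ...` satisfied by `x(v) = v_z`. -/
def firstOrderRhs (σ a b k s v x : ℝ) : ℝ :=
  -1 + 2 * k - σ ^ 2 / (4 * a * b ^ 2 * x ^ 2) + 1 / (b * x) + k * (1 - k) * v / x
    + s * (√(σ ^ 2 * (σ ^ 2 - 8 * a * b * x)) / (4 * a * b ^ 2 * x ^ 2))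

/-- The equation `x_v = firstOrderRhs ..` is autonomous: where the right-hand side is defined,
it does not depend on the independent variable `v`. -/
def RhsIsAutonomous (σ a b k s : ℝ) : Prop :=
  ∀ x v w : ℝ, x ≠ 0 → 0 ≤ σ ^ 2 - 8 * a * b * x →
    firstOrderRhs σ a b k s v x = firstOrderRhs σ a b k s w x

/-! ### The case `k = 1`: implicit first order equations -/

/-- The relation between `p` and `z` with constant `c` on the first sheet. Note that `Real.log x`
is `log |x|`; all arguments of logarithms are required to be nonzero, except that for `q = 4` the
term with coefficient `q - √q - 2 = 0` is absent. -/
def SheetMinus (q c p z : ℝ) : Prop :=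
  p ≠ 1 ∧
  ((0 < q ∧ q ≠ 1 ∧ (q ≠ 4 → (p + 1) * √q - 2 ≠ 0) ∧ (p + 1) * √q + 2 ≠ 0 ∧
      2 * q * Real.log (p - 1) + (q - √q - 2) * Real.log ((p + 1) * √q - 2)
        + (q + √q - 2) * Real.log ((p + 1) * √q + 2) = 2 * (q - 1) * z + c) ∨
   (q = 1 ∧ p + 3 ≠ 0 ∧
      1 / (1 - p) + 1 / 4 * Real.log ((p + 3) ^ 3 * (p - 1) ^ 5) = z + c) ∨
   (q < 0 ∧
      2 * √(-q) * Real.arctan ((p + 1) * √(-q) / 2) - 2 * q * Real.log (p - 1)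
        + (2 - q) * Real.log (4 - q * (p + 1) ^ 2) = 2 * (1 - q) * z + c))

/-- The relation between `p` and `z` with constant `c` on the second sheet; same conventions. -/
def SheetPlus (q c p z : ℝ) : Prop :=
  p ≠ -1 ∧
  ((0 < q ∧ q ≠ 1 ∧ (p - 1) * √q - 2 ≠ 0 ∧ (q ≠ 4 → (p - 1) * √q + 2 ≠ 0) ∧
      2 * q * Real.log (p + 1) + (q + √q - 2) * Real.log ((p - 1) * √q - 2)
        + (q - √q - 2) * Real.log ((p - 1) * √q + 2) = 2 * (q - 1) * z + c) ∨
   (q = 1 ∧ p - 3 ≠ 0 ∧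
      1 / (p + 1) + 1 / 4 * Real.log ((p - 3) ^ 3 * (p + 1) ^ 5) = z + c) ∨
   (q < 0 ∧
      -(2 * √(-q) * Real.arctan ((p - 1) * √(-q) / 2)) - 2 * q * Real.log (1 + p)
        + (2 - q) * Real.log (4 - q * (p - 1) ^ 2) = 2 * (1 - q) * z + c))

/-- `p = √(1 - (4 b / q) v_z)` -/
def pVar (q b : ℝ) (v : ℝ → ℝ) (z : ℝ) : ℝ := √(1 - 4 * b / q * deriv v z)

/-- `v` solves one of the first order equations: `v_z = 0`, `v_z = (-1 ± √q) / b`, or one of the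
implicit equations, with some constant `c`. For `q = 4` a solution may pass from one sheet to the
other (through `p = 0`), and then satisfies one of the two equations at each point, with the same
constant. -/
def SolvesFirstOrder (q b : ℝ) (I : Set ℝ) (v : ℝ → ℝ) : Prop :=
  (∀ z ∈ I, deriv v z = 0) ∨
  (0 < q ∧ ∀ z ∈ I, deriv v z = (-1 + √q) / b) ∨
  (0 < q ∧ ∀ z ∈ I, deriv v z = (-1 - √q) / b) ∨
  ((∀ z ∈ I, 0 ≤ 1 - 4 * b / q * deriv v z) ∧
    ∃ c : ℝ, (∀ z ∈ I, SheetMinus q c (pVar q b v z) z) ∨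
      (∀ z ∈ I, SheetPlus q c (pVar q b v z) z) ∨
      (q = 4 ∧ ∀ z ∈ I, SheetMinus q c (pVar q b v z) z ∨ SheetPlus q c (pVar q b v z) z))

/-! ### The case `k = 1`, `a = σ² / 8`: explicit solutions -/

/-- `S ^ (3/2) exp (3 σ² t / 16)` -/
def eVar (σ S t : ℝ) : ℝ := S ^ (3 / 2 : ℝ) * Real.exp (3 * σ ^ 2 / 16 * t)

/-- `1 + c E + √(2 c E + c² E²)` -/
def xVar (σ c S t : ℝ) : ℝ :=
  1 + c * eVar σ S t + √(2 * c * eVar σ S t + c ^ 2 * eVar σ S t ^ 2)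

/-- The solution for `c > 0`. -/
def solPos (σ b c d S t : ℝ) : ℝ :=
  -(1 / b) * xVar σ c S t ^ (-(2 / 3) : ℝ) - 1 / b * xVar σ c S t ^ (2 / 3 : ℝ)
    - 2 / b * Real.log (xVar σ c S t ^ (-(1 / 3) : ℝ) + xVar σ c S t ^ (1 / 3 : ℝ) - 2) + d

/-- The first solution for `c < 0`. -/
def solOne (σ b c d S t : ℝ) : ℝ :=
  let θ := Real.arccos (1 - |c| / 2 * eVar σ S t)
  1 / b * (Real.log S + σ ^ 2 / 8 * t) - 2 / b * Real.cos (2 / 3 * θ)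
    - 4 / (3 * b) * Real.log (1 + 2 * Real.cos (1 / 3 * θ))
    - 16 / (3 * b) * Real.log (Real.sin (1 / 6 * θ)) + d

/-- The second solution for `c < 0`. -/
def solTwo (σ b c d S t : ℝ) : ℝ :=
  let θ := Real.arccos (-1 + |c| / 2 * eVar σ S t)
  1 / b * (Real.log S + σ ^ 2 / 8 * t) - 2 / b * Real.cos (2 / 3 * Real.pi + 2 / 3 * θ)
    - 4 / (3 * b) * Real.log (1 + 2 * Real.cos (1 / 3 * Real.pi + 1 / 3 * θ))
    - 16 / (3 * b) * Real.log (Real.sin (1 / 6 * Real.pi + 1 / 6 * θ)) + d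

/-- The third solution for `c < 0`, where `|c| E ≤ 4`. -/
def solThreeOne (σ b c d S t : ℝ) : ℝ :=
  let θ := Real.arccos (-1 + |c| / 2 * eVar σ S t)
  1 / b * (Real.log S + σ ^ 2 / 8 * t) - 2 / b * Real.cos (2 / 3 * θ)
    - 4 / (3 * b) * Real.log (-1 + 2 * Real.cos (1 / 3 * θ))
    - 16 / (3 * b) * Real.log (Real.cos (1 / 6 * θ)) + d

/-- The third solution for `c < 0`, where `|c| E > 4`. -/
def solThreeTwo (σ b c d S t : ℝ) : ℝ :=
  let θ := Real.arcosh (-1 + |c| / 2 * eVar σ S t)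
  1 / b * (Real.log S + σ ^ 2 / 8 * t) - 2 / b * Real.cosh (2 / 3 * θ)
    - 16 / (3 * b) * Real.log (Real.cosh (1 / 6 * θ))
    - 4 / (3 * b) * Real.log (-1 + 2 * Real.cosh (1 / 3 * θ)) + d

/-- `u` is, on `U`, one of the listed solutions, with parameters `c` and `d`. In the elementary
solutions the parameter `c` does not occur. -/
def IsListed (σ b c d : ℝ) (U : Set (ℝ × ℝ)) (u : ℝ → ℝ → ℝ) : Prop :=
  (0 < c ∧ ∀ S t : ℝ, (S, t) ∈ U → u S t = solPos σ b c d S t) ∨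
  (c < 0 ∧ ∀ S t : ℝ, (S, t) ∈ U → |c| * eVar σ S t < 4 ∧ u S t = solOne σ b c d S t) ∨
  (c < 0 ∧ ∀ S t : ℝ, (S, t) ∈ U → |c| * eVar σ S t < 4 ∧ u S t = solTwo σ b c d S t) ∨
  (c < 0 ∧ ∀ S t : ℝ, (S, t) ∈ U →
    (|c| * eVar σ S t ≤ 4 → u S t = solThreeOne σ b c d S t) ∧
    (4 < |c| * eVar σ S t → u S t = solThreeTwo σ b c d S t)) ∨
  (∀ S t : ℝ, (S, t) ∈ U → u S t = d) ∨
  (∀ S t : ℝ, (S, t) ∈ U → u S t = -(3 / b) * (Real.log S + σ ^ 2 * t / 8) + d) ∨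
  (∀ S t : ℝ, (S, t) ∈ U → u S t = 1 / b * (Real.log S + σ ^ 2 * t / 8) + d)

end IlliquidHedge

end

open IlliquidHedge

/-!
Symmetries. The symmetry condition is polynomial in the jet coordinates `u_St`, `u_S`, `u_SS`, and
its coefficients are the determining equations (`IsPointSymmetry.determining`). With
`h = ρ S λ(S)` they yield `ξ = ξ(S, t)`, `τ = τ(t)`, `2 ξ / S + τ_t = 2 ξ_S` and
`h' ξ = h (2 ξ_S - φ_u)`. Wherever `λ ≠ 0` they also force `τ_t = 0`, hence `ξ = β S`, and since
`2 ξ / S + τ_t = 2 ξ_S` holds for all `S`, this form extends to the whole half line. The last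
equation is then the Euler equation `S λ' = k λ`, so `λ` is a power law, and for a nonzero power law
the symmetries are `β S ∂_S + κ ∂_t + ((1 - k) β u + e S + d) ∂_u`
(`isPointSymmetry_powerLaw_iff`).

Reduction. An invariant solution is constant along the connected orbits `log S + a t = z`, up to the
factor `S ^ (1 - k)`, so it is `S ^ (1 - k) v(z)`; the equation for `u` becomes the one for `v`. It is
quadratic in `m`, and `v_zz = x x_v` if `v_z = x(v)`.

The case `k = 1`. Put `M = b (v_zz - v_z)` and `P = (1 + M) / (1 - M)`, a smooth function. The
reduced equation becomes `b v_z = q (1 - P²) / 4` together with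
`2 q P (P + 1) P' = (P - 1) (q (P + 1)² - 4)`, so `p = |P|`, and the two implicit equations are one
primitive of the separated equation, evaluated at `P = p` and at `P = -p`. The factors of the
right-hand side satisfy linear homogeneous equations along a solution and hence vanish identically or
nowhere; the former gives the solutions with constant `v_z`. For `q ≠ 4` the function `P` has no
zeros, so one sheet suffices. For `q = 4` the factor `P` cancels and `P` may change its sign.
Conversely, an implicit equation can be differentiated where `p ≠ 0`; for `q ≠ 4` it excludes
zeros of `p`, and for `q = 4` the reduced equation holds at a zero of `p` because `p²` has a minimum
there.

The case `q = 4`. The integral is the cubic equation `(P - 1)² (P + 2) = c' E`, `E = e^(3 z / 2)`, and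
`b v = -(P² + 2 log |P + 2|) + const`. As `P ≠ ±1, -2`, the values of `P` stay in one of four intervals
on which the cubic is injective with nonvanishing derivative. Its inverses there are the
trigonometric and hyperbolic expressions of the list, and the inverse function theorem makes them
smooth, also across `|c| E = 4`. The symmetry group acts by `(S, t, u) ↦ (μ S, t + κ, u + d + e S)`,
which rescales `E` and adds the solutions `e S + d`.
-/

noncomputable section

namespace IlliquidHedge

/-! ### The determining equations of the point symmetries -/

/-- A cubic polynomial in `m` that vanishes wherever `1 - h m ≠ 0` has vanishing coefficients. -/
lemma cubic_coeff_zero {h a0 a1 a2 a3 : ℝ}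
    (H : ∀ m : ℝ, 1 - h * m ≠ 0 → a0 + a1 * m + a2 * m ^ 2 + a3 * m ^ 3 = 0) :
    a0 = 0 ∧ a1 = 0 ∧ a2 = 0 ∧ a3 = 0 := by
  have hpos : 0 < |h| + 1 := by positivity
  -- so small that `1 - h m ≠ 0` at the four sample points `0, e, -e, 2 e`
  obtain ⟨e, he⟩ : ∃ e : ℝ, e = 1 / (3 * (|h| + 1)) := ⟨_, rfl⟩
  have he0 : 0 < e := by rw [he]; positivity
  have hhe : |h| * e < 1 / 3 := by
    rw [he, mul_one_div, div_lt_div_iff₀ (by positivity) (by norm_num)]; linarith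
  have hb := abs_le.1 (le_refl |h * e|)
  rw [abs_mul, abs_of_pos he0] at hb
  have h0 := H 0 (by norm_num)
  have h1 := H e (by linarith [hb.2])
  have h2 := H (-e) (by linarith [hb.1])
  have h3 := H (2 * e) (by linarith [hb.2])
  have e0 : a0 = 0 := by linarith
  have e2 : a2 = 0 := by
    have : a2 * (e * e) = 0 := by linarith
    exact (mul_eq_zero.1 this).resolve_right (by positivity)
  subst e0 e2
  have e3 : a3 = 0 := by
    have : a3 * (6 * (e * e * e)) = 0 := by linarith
    exact (mul_eq_zero.1 this).resolve_right (by positivity)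
  subst e3
  refine ⟨rfl, ?_, rfl, rfl⟩
  have : a1 * e = 0 := by linarith
  exact (mul_eq_zero.1 this).resolve_right he0.ne'

/-- The determining equations of the symmetries: the coefficients of the monomials in the jet
coordinates `p = u_S` and `m = u_SS`, after the elimination of `u_t = -c m / (1 - h m)²`. -/
lemma determining_algebra {c h h' S ξ φt φu ξt ξu τt φSS φSu φuu ξS ξSS ξSu ξuu : ℝ} (hc : c ≠ 0)
    (H : ∀ p m : ℝ, 1 - h * m ≠ 0 →
      ξ * (2 * c / S * (m / (1 - h * m) ^ 2) + 2 * c * h' * (m ^ 2 / (1 - h * m) ^ 3))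
      + (φt + -(c * (m / (1 - h * m) ^ 2)) * φu - p * ξt - p * -(c * (m / (1 - h * m) ^ 2)) * ξu
          - -(c * (m / (1 - h * m) ^ 2)) * τt)
      + (φSS + 2 * p * φSu + m * φu + p ^ 2 * φuu - 2 * m * ξS - p * ξSS - 2 * p ^ 2 * ξSu
          - 3 * p * m * ξu - p ^ 3 * ξuu) * (c * ((1 + h * m) / (1 - h * m) ^ 3)) = 0) :
    ξu = 0 ∧ φuu = 2 * ξSu ∧ h * ξt = 0 ∧ ξt = c * (2 * φSu - ξSS) ∧ h * φt = 0 ∧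
      φt + c * φSS = 0 ∧ 2 * ξ / S + τt = 2 * ξS ∧ h' * ξ = h * (2 * ξS - φu) := by
  have H1 : ∀ p m : ℝ, 1 - h * m ≠ 0 →
      (ξ * (2 * c / S * (m * (1 - h * m)) + 2 * c * h' * m ^ 2)
        + φt * (1 - h * m) ^ 3 + c * m * (1 - h * m) * (τt - φu)
        + (φSS + m * φu - 2 * m * ξS) * (c * (1 + h * m)))
      + (-ξt * (1 - h * m) ^ 3 + c * m * (1 - h * m) * ξu
        + (2 * φSu - ξSS - 3 * m * ξu) * (c * (1 + h * m))) * p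
      + ((φuu - 2 * ξSu) * (c * (1 + h * m))) * p ^ 2
      + (-ξuu * (c * (1 + h * m))) * p ^ 3 = 0 := by
    intro p m hm
    have := H p m hm
    obtain ⟨D, hD⟩ : ∃ D, D = 1 - h * m := ⟨_, rfl⟩
    rw [← hD] at this hm ⊢
    have e2 : D ^ 3 * (1 / D ^ 2) = D := by field_simp
    have e3 : D ^ 3 * (1 / D ^ 3) = 1 := by field_simp
    rw [div_eq_mul_one_div m (D ^ 2), div_eq_mul_one_div (m ^ 2) (D ^ 3),
      div_eq_mul_one_div (1 + h * m) (D ^ 3)] at this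
    generalize 1 / D ^ 2 = i2 at *
    generalize 1 / D ^ 3 = i3 at *
    linear_combination D ^ 3 * this
      - (ξ * (2 * c / S * m) - c * m * φu + p * c * m * ξu + c * m * τt) * e2
      - (ξ * (2 * c * h' * m ^ 2) + (φSS + 2 * p * φSu + m * φu + p ^ 2 * φuu - 2 * m * ξS - p * ξSS
          - 2 * p ^ 2 * ξSu - 3 * p * m * ξu - p ^ 3 * ξuu) * (c * (1 + h * m))) * e3
  have H2 := fun m hm => cubic_coeff_zero (h := 0) (fun p _ => H1 p m hm)
  have A0 := cubic_coeff_zero (h := h) (a0 := φt + c * φSS)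
    (a1 := c * (2 * ξ / S + τt - 2 * ξS) - 3 * h * φt + c * h * φSS)
    (a2 := c * (-(2 * h * ξ / S) + 2 * h' * ξ - h * τt + 2 * h * φu - 2 * h * ξS)
      + 3 * h ^ 2 * φt) (a3 := -(h ^ 3 * φt)) (fun m hm => by
      linear_combination (H2 m hm).1)
  have A1 := cubic_coeff_zero (h := h) (a0 := -ξt + c * (2 * φSu - ξSS))
    (a1 := 3 * h * ξt + c * ξu + c * h * (2 * φSu - ξSS) - 3 * c * ξu)
    (a2 := -3 * h ^ 2 * ξt - c * h * ξu - 3 * c * h * ξu) (a3 := h ^ 3 * ξt) (fun m hm => by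
      linear_combination (H2 m hm).2.1)
  have A2 : (φuu - 2 * ξSu) * c = 0 := by
    simpa using (H2 0 (by norm_num)).2.2.1
  obtain ⟨a0, a1, a2, a3⟩ := A0
  obtain ⟨b0, b1, b2, b3⟩ := A1
  have hφ : h * φt = 0 := by
    by_cases hh : h = 0
    · simp [hh]
    · have : φt = 0 := by simpa [hh] using a3
      simp [this]
  have hξ : h * ξt = 0 := by
    by_cases hh : h = 0
    · simp [hh]
    · have : ξt = 0 := by simpa [hh] using b3
      simp [this]
  have hξS : 2 * ξ / S + τt = 2 * ξS :=
    mul_left_cancel₀ hc (by linear_combination a1 - h * a0 + 4 * hφ)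
  refine ⟨?_, ?_, hξ, by linarith, hφ, a0, hξS, ?_⟩
  · exact mul_left_cancel₀ hc (by linear_combination -1 / 2 * (b1 - h * b0 - 4 * hξ))
  · have := (mul_eq_zero.1 A2).resolve_right hc; linarith
  · exact mul_left_cancel₀ hc (by linear_combination 1 / 2 * a2 - 3 / 2 * h * hφ + c * h / 2 * hξS)

lemma hasDerivAt_Delta_uSS (σ ρ : ℝ) (lam : ℝ → ℝ) (S r m : ℝ) (hm : 1 - ρ * S * lam S * m ≠ 0) :
    HasDerivAt (fun m' => Delta σ ρ lam S r m')
      (σ ^ 2 * S ^ 2 / 2 * ((1 + ρ * S * lam S * m) / (1 - ρ * S * lam S * m) ^ 3)) m := by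
  unfold Delta
  have h1 : HasDerivAt (fun m' : ℝ => (1 - ρ * S * lam S * m') ^ 2)
      (2 * (1 - ρ * S * lam S * m) * (-(ρ * S * lam S))) m := by
    have := (((hasDerivAt_id m).const_mul (ρ * S * lam S)).const_sub 1).pow 2
    refine HasDerivAt.congr_deriv this ?_
    simp
  refine HasDerivAt.congr_deriv ((((hasDerivAt_id m).div h1 (pow_ne_zero 2 hm)).const_mul (σ ^ 2 * S ^ 2 / 2)).const_add r) ?_
  simp only [id]
  field_simp
  ring

lemma hasDerivAt_Delta_S (σ ρ : ℝ) {lam : ℝ → ℝ} {S L : ℝ} (hS : S ≠ 0) (r m : ℝ)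
    (hL : HasDerivAt lam L S) (hm : 1 - ρ * S * lam S * m ≠ 0) :
    HasDerivAt (fun s => Delta σ ρ lam s r m)
      (2 * (σ ^ 2 * S ^ 2 / 2) / S * (m / (1 - ρ * S * lam S * m) ^ 2)
        + 2 * (σ ^ 2 * S ^ 2 / 2) * (ρ * (lam S + S * L))
          * (m ^ 2 / (1 - ρ * S * lam S * m) ^ 3)) S := by
  unfold Delta
  have h0 : HasDerivAt (fun s : ℝ => ρ * s * lam s) (ρ * (lam S + S * L)) S := by
    refine HasDerivAt.congr_deriv (((hasDerivAt_id S).const_mul ρ).mul hL) ?_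
    simp; try ring
  have h1 : HasDerivAt (fun s : ℝ => (1 - ρ * s * lam s * m) ^ 2)
      (2 * (1 - ρ * S * lam S * m) * (-(ρ * (lam S + S * L) * m))) S := by
    refine HasDerivAt.congr_deriv (((h0.mul_const m).const_sub 1).pow 2) ?_
    simp
  have h2 : HasDerivAt (fun s : ℝ => σ ^ 2 * s ^ 2 / 2) (σ ^ 2 * S) S := by
    refine HasDerivAt.congr_deriv ((((hasDerivAt_id S).pow 2).const_mul (σ ^ 2)).div_const 2) ?_
    simp; try ring
  refine HasDerivAt.congr_deriv ((h2.mul ((hasDerivAt_const S m).div h1 (pow_ne_zero 2 hm))).const_add r) ?_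
  simp only [Pi.div_apply]
  generalize hD : 1 - ρ * S * lam S * m = D at *
  field_simp
  ring

lemma prolDelta_eq (V : VField) (σ ρ : ℝ) {lam : ℝ → ℝ} {S L : ℝ} (hS : S ≠ 0)
    (hL : HasDerivAt lam L S) (t u p r m n : ℝ) (hm : 1 - ρ * S * lam S * m ≠ 0) :
    V.prolDelta σ ρ lam S t u p r m n =
      V.ξ S t u * (2 * (σ ^ 2 * S ^ 2 / 2) / S * (m / (1 - ρ * S * lam S * m) ^ 2)
        + 2 * (σ ^ 2 * S ^ 2 / 2) * (ρ * (lam S + S * L))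
          * (m ^ 2 / (1 - ρ * S * lam S * m) ^ 3))
      + V.prolT S t u p r
      + V.prolSS S t u p r m n *
        (σ ^ 2 * S ^ 2 / 2 * ((1 + ρ * S * lam S * m) / (1 - ρ * S * lam S * m) ^ 3)) := by
  have hr : HasDerivAt (fun r' => Delta σ ρ lam S r' m) 1 r := by
    unfold Delta
    exact (hasDerivAt_id r).add_const _
  rw [VField.prolDelta, (hasDerivAt_Delta_S σ ρ hS r m hL hm).deriv, hr.deriv,
    (hasDerivAt_Delta_uSS σ ρ lam S r m hm).deriv, mul_one]

/-! ### Partial derivatives on the base space -/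

/-- Smoothness on the base space of a function of `(S, t, u)`. -/
def SmoothOnBase (J : Set ℝ) (f : ℝ → ℝ → ℝ → ℝ) : Prop :=
  ContDiffOn ℝ ∞ (fun x : ℝ × ℝ × ℝ => f x.1 x.2.1 x.2.2) (baseSpace J)

lemma isOpen_baseSpace {J : Set ℝ} (hJ : IsOpen J) : IsOpen (baseSpace J) :=
  (isOpen_Ioi.preimage continuous_fst).inter (hJ.preimage (continuous_fst.comp continuous_snd))

namespace SmoothOnBase

variable {J : Set ℝ} {f : ℝ → ℝ → ℝ → ℝ}

lemma differentiableAt (hf : SmoothOnBase J f) (hJ : IsOpen J) {S t u : ℝ} (hS : 0 < S)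
    (ht : t ∈ J) :
    DifferentiableAt ℝ (fun x : ℝ × ℝ × ℝ => f x.1 x.2.1 x.2.2) (S, t, u) :=
  (hf.contDiffAt ((isOpen_baseSpace hJ).mem_nhds ⟨hS, ht⟩)).differentiableAt (by simp)

lemma hasDerivAt_S (hf : SmoothOnBase J f) (hJ : IsOpen J) {S t : ℝ} (u : ℝ) (hS : 0 < S)
    (ht : t ∈ J) :
    HasDerivAt (fun s => f s t u) (dS f S t u) S := by
  have : DifferentiableAt ℝ (fun s => f s t u) S :=
    (hf.differentiableAt hJ hS ht).comp (f := fun s : ℝ => (s, t, u)) S (by fun_prop)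
  exact this.hasDerivAt

lemma hasDerivAt_T (hf : SmoothOnBase J f) (hJ : IsOpen J) {S t : ℝ} (u : ℝ) (hS : 0 < S)
    (ht : t ∈ J) :
    HasDerivAt (fun r => f S r u) (dT f S t u) t := by
  have : DifferentiableAt ℝ (fun r => f S r u) t :=
    (hf.differentiableAt hJ hS ht).comp (f := fun r : ℝ => (S, r, u)) t (by fun_prop)
  exact this.hasDerivAt

lemma hasDerivAt_U (hf : SmoothOnBase J f) (hJ : IsOpen J) {S t : ℝ} (u : ℝ) (hS : 0 < S)
    (ht : t ∈ J) :
    HasDerivAt (fun w => f S t w) (dU f S t u) u := by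
  have : DifferentiableAt ℝ (fun w => f S t w) u :=
    (hf.differentiableAt hJ hS ht).comp (f := fun w : ℝ => (S, t, w)) u (by fun_prop)
  exact this.hasDerivAt

lemma dS (hf : SmoothOnBase J f) (hJ : IsOpen J) : SmoothOnBase J (dS f) := by
  have h := (hf.fderiv_of_isOpen (isOpen_baseSpace hJ) (m := ∞) (by simp)).clm_apply
    (contDiffOn_const (c := ((1 : ℝ), (0 : ℝ), (0 : ℝ))))
  refine h.congr fun x hx => ?_
  exact (((hf.differentiableAt hJ hx.1 hx.2).hasFDerivAt).comp_hasDerivAt x.1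
    (f := fun s : ℝ => (s, x.2.1, x.2.2))
    ((hasDerivAt_id x.1).prodMk (hasDerivAt_const _ _))).deriv

lemma dU (hf : SmoothOnBase J f) (hJ : IsOpen J) : SmoothOnBase J (dU f) := by
  have h := (hf.fderiv_of_isOpen (isOpen_baseSpace hJ) (m := ∞) (by simp)).clm_apply
    (contDiffOn_const (c := ((0 : ℝ), (0 : ℝ), (1 : ℝ))))
  refine h.congr fun x hx => ?_
  exact (((hf.differentiableAt hJ hx.1 hx.2).hasFDerivAt).comp_hasDerivAt x.2.2
    (f := fun w : ℝ => (x.1, x.2.1, w))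
    ((hasDerivAt_const _ _).prodMk ((hasDerivAt_const _ _).prodMk (hasDerivAt_id x.2.2)))).deriv

end SmoothOnBase

lemma dS_congr {f g : ℝ → ℝ → ℝ → ℝ} {J : Set ℝ} (h : ∀ S t u, 0 < S → t ∈ J → f S t u = g S t u)
    {S t u : ℝ} (hS : 0 < S) (ht : t ∈ J) : dS f S t u = dS g S t u :=
  Filter.EventuallyEq.deriv_eq
    (Filter.eventually_of_mem (Ioi_mem_nhds hS) fun s hs => h s t u hs ht)

lemma dT_congr {f g : ℝ → ℝ → ℝ → ℝ} {J : Set ℝ} (hJ : IsOpen J)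
    (h : ∀ S t u, 0 < S → t ∈ J → f S t u = g S t u)
    {S t u : ℝ} (hS : 0 < S) (ht : t ∈ J) : dT f S t u = dT g S t u :=
  Filter.EventuallyEq.deriv_eq
    (Filter.eventually_of_mem (hJ.mem_nhds ht) fun s hs => h S s u hS hs)

lemma dU_congr {f g : ℝ → ℝ → ℝ → ℝ} {J : Set ℝ} (h : ∀ S t u, 0 < S → t ∈ J → f S t u = g S t u)
    {S t u : ℝ} (hS : 0 < S) (ht : t ∈ J) : dU f S t u = dU g S t u := by
  have : (fun w => f S t w) = fun w => g S t w := funext fun w => h S t w hS ht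
  simp only [dU, this]

lemma dS_zero (S t u : ℝ) : dS (fun _ _ _ => 0) S t u = 0 := deriv_const _ _
lemma dU_zero (S t u : ℝ) : dU (fun _ _ _ => 0) S t u = 0 := deriv_const _ _

section Determining

variable {σ ρ : ℝ} {lam : ℝ → ℝ} {J : Set ℝ} {V : VField}

/-- The coefficient of `u_St` in the symmetry condition, at the points `u_t = u_SS = 0` of the
solution manifold, is a nonzero multiple of `τ_S + u_S τ_u`. -/
lemma IsPointSymmetry.dS_dU_tau (hV : IsPointSymmetry σ ρ lam J V) (hσ : σ ≠ 0)
    (hlam : DifferentiableOn ℝ lam (Ioi 0)) (S t u : ℝ) (hS : 0 < S) (ht : t ∈ J) :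
    dS V.τ S t u = 0 ∧ dU V.τ S t u = 0 := by
  have hL := ((hlam S hS).differentiableAt (Ioi_mem_nhds hS)).hasDerivAt
  have key : ∀ p n : ℝ, V.prolDelta σ ρ lam S t u p 0 0 n = 0 := fun p n =>
    hV.2 S t u p 0 0 n hS ht (by simp) (by simp [Delta])
  have hc : σ ^ 2 * S ^ 2 / 2 ≠ 0 := by positivity
  have h1 : ∀ p : ℝ, dS V.τ S t u + p * dU V.τ S t u = 0 := by
    intro p
    have a := key p 0
    have b := key p 1
    rw [prolDelta_eq V σ ρ hS.ne' hL _ _ _ _ _ _ (by simp)] at a b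
    simp only [VField.prolSS] at a b
    apply mul_left_cancel₀ hc
    have e : (1 + ρ * S * lam S * 0) / (1 - ρ * S * lam S * 0) ^ 3 = 1 := by simp
    rw [e] at a b
    linear_combination (a - b) / 2
  have h0 := h1 0
  have h2 := h1 1
  constructor <;> linarith

/-- The determining equations of the point symmetries, with `c = σ² S² / 2`, `h = ρ S λ(S)` and
`h' = ρ (λ + S λ')`. -/
lemma IsPointSymmetry.determining (hV : IsPointSymmetry σ ρ lam J V) (hσ : σ ≠ 0)
    (hlam : DifferentiableOn ℝ lam (Ioi 0)) (S t u : ℝ) (hS : 0 < S) (ht : t ∈ J) :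
    dU V.ξ S t u = 0 ∧ dU (dU V.φ) S t u = 2 * dS (dU V.ξ) S t u ∧
    ρ * S * lam S * dT V.ξ S t u = 0 ∧
    dT V.ξ S t u = σ ^ 2 * S ^ 2 / 2 * (2 * dS (dU V.φ) S t u - dS (dS V.ξ) S t u) ∧
    ρ * S * lam S * dT V.φ S t u = 0 ∧
    dT V.φ S t u + σ ^ 2 * S ^ 2 / 2 * dS (dS V.φ) S t u = 0 ∧
    2 * V.ξ S t u / S + dT V.τ S t u = 2 * dS V.ξ S t u ∧
    ρ * (lam S + S * deriv lam S) * V.ξ S t u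
      = ρ * S * lam S * (2 * dS V.ξ S t u - dU V.φ S t u) := by
  have hL := ((hlam S hS).differentiableAt (Ioi_mem_nhds hS)).hasDerivAt
  have hτ := hV.dS_dU_tau hσ hlam
  have t1 : dS V.τ S t u = 0 := (hτ S t u hS ht).1
  have t2 : dU V.τ S t u = 0 := (hτ S t u hS ht).2
  have t3 : dS (dS V.τ) S t u = 0 :=
    (dS_congr (g := fun _ _ _ => 0) (fun S t u hS ht => (hτ S t u hS ht).1) hS ht).trans
      (dS_zero _ _ _)
  have t4 : dS (dU V.τ) S t u = 0 :=
    (dS_congr (g := fun _ _ _ => 0) (fun S t u hS ht => (hτ S t u hS ht).2) hS ht).trans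
      (dS_zero _ _ _)
  have t5 : dU (dU V.τ) S t u = 0 :=
    (dU_congr (g := fun _ _ _ => 0) (fun S t u hS ht => (hτ S t u hS ht).2) hS ht).trans
      (dU_zero _ _ _)
  have hc : σ ^ 2 * S ^ 2 / 2 ≠ 0 := by positivity
  refine determining_algebra (ξuu := dU (dU V.ξ) S t u) hc fun p m hm => ?_
  have := hV.2 S t u p (-(σ ^ 2 * S ^ 2 / 2 * (m / (1 - ρ * S * lam S * m) ^ 2))) m 0 hS ht hm
    (by simp [Delta])
  rw [prolDelta_eq V σ ρ hS.ne' hL _ _ _ _ _ _ hm] at this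
  simp only [VField.prolSS, VField.prolT, t1, t2, t3, t4, t5] at this
  rw [← this]
  ring

end Determining

/-! ### Integration of the determining equations -/

lemma eq_of_hasDerivAt_zero {f : ℝ → ℝ} {I : Set ℝ} (hI : I.OrdConnected)
    (hf : ∀ x ∈ I, HasDerivAt f 0 x) {x y : ℝ} (hx : x ∈ I) (hy : y ∈ I) : f x = f y := by
  have := hI.convex.norm_image_sub_le_of_norm_hasDerivWithin_le (f := f) (f' := fun _ => 0) (C := 0)
    (fun z hz => (hf z hz).hasDerivWithinAt) (by simp) hy hx
  rw [zero_mul, norm_le_zero_iff, sub_eq_zero] at this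
  exact this

section Determining

variable {σ ρ : ℝ} {lam : ℝ → ℝ} {J : Set ℝ} {V : VField}

lemma IsPointSymmetry.tau_eq (hV : IsPointSymmetry σ ρ lam J V) (hσ : σ ≠ 0)
    (hlam : DifferentiableOn ℝ lam (Ioi 0)) (hJ : IsOpen J) {S S' t u u' : ℝ} (hS : 0 < S)
    (hS' : 0 < S') (ht : t ∈ J) : V.τ S t u = V.τ S' t u' := by
  have h1 : V.τ S t u = V.τ S t u' :=
    eq_of_hasDerivAt_zero (f := fun w => V.τ S t w) ordConnected_univ
      (fun w _ =>
        (SmoothOnBase.hasDerivAt_U (f := V.τ) hV.1.2.1 hJ w hS ht).congr_deriv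
          (hV.dS_dU_tau hσ hlam S t w hS ht).2) (mem_univ _) (mem_univ _)
  have h2 : V.τ S t u' = V.τ S' t u' :=
    eq_of_hasDerivAt_zero (f := fun s => V.τ s t u') ordConnected_Ioi
      (fun s hs =>
        (SmoothOnBase.hasDerivAt_S (f := V.τ) hV.1.2.1 hJ u' hs ht).congr_deriv
          (hV.dS_dU_tau hσ hlam s t u' hs ht).1) (mem_Ioi.2 hS) (mem_Ioi.2 hS')
  exact h1.trans h2

lemma IsPointSymmetry.xi_eq (hV : IsPointSymmetry σ ρ lam J V) (hσ : σ ≠ 0)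
    (hlam : DifferentiableOn ℝ lam (Ioi 0)) (hJ : IsOpen J) {S t u u' : ℝ} (hS : 0 < S)
    (ht : t ∈ J) : V.ξ S t u = V.ξ S t u' :=
  eq_of_hasDerivAt_zero (f := fun w => V.ξ S t w) ordConnected_univ
    (fun w _ =>
      (SmoothOnBase.hasDerivAt_U (f := V.ξ) hV.1.1 hJ w hS ht).congr_deriv
        (hV.determining hσ hlam S t w hS ht).1) (mem_univ _) (mem_univ _)

lemma IsPointSymmetry.dU_phi_eq (hV : IsPointSymmetry σ ρ lam J V) (hσ : σ ≠ 0)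
    (hlam : DifferentiableOn ℝ lam (Ioi 0)) (hJ : IsOpen J) {S t u u' : ℝ} (hS : 0 < S)
    (ht : t ∈ J) : dU V.φ S t u = dU V.φ S t u' := by
  refine eq_of_hasDerivAt_zero (f := fun w => dU V.φ S t w) ordConnected_univ
    (fun w _ => ?_) (mem_univ _) (mem_univ _)
  have h0 : dU (dU V.φ) S t w = 0 := by
    rw [(hV.determining hσ hlam S t w hS ht).2.1,
      dS_congr (g := fun _ _ _ => 0) (fun S t u hS ht => (hV.determining hσ hlam S t u hS ht).1)
        hS ht, dS_zero, mul_zero]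
  exact ((SmoothOnBase.dU (f := V.φ) hV.1.2.2 hJ).hasDerivAt_U hJ w hS ht).congr_deriv h0

/-- The coefficient `φ` is affine in `u`. -/
lemma IsPointSymmetry.phi_eq (hV : IsPointSymmetry σ ρ lam J V) (hσ : σ ≠ 0)
    (hlam : DifferentiableOn ℝ lam (Ioi 0)) (hJ : IsOpen J) {S t : ℝ} (u : ℝ) (hS : 0 < S)
    (ht : t ∈ J) : V.φ S t u = V.φ S t 0 + u * dU V.φ S t 0 := by
  have := eq_of_hasDerivAt_zero (f := fun w => V.φ S t w - w * dU V.φ S t 0) ordConnected_univ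
    (fun w _ => by
      refine ((SmoothOnBase.hasDerivAt_U (f := V.φ) hV.1.2.2 hJ w hS ht).sub
        ((hasDerivAt_id w).mul_const (dU V.φ S t 0))).congr_deriv ?_
      rw [hV.dU_phi_eq hσ hlam hJ (u' := 0) hS ht, one_mul, sub_self]) (mem_univ u) (mem_univ 0)
  simp only [zero_mul, sub_zero] at this
  linarith

/-- Unless the equation is linear, time is only translated by the symmetries, not rescaled. With
`α = τ_t / 2`, near a point where `λ ≠ 0` the determining equations give `φ_uS = α / (2 S)`
and `φ_uSS = 0`. -/
lemma IsPointSymmetry.dT_tau (hV : IsPointSymmetry σ ρ lam J V) (hσ : σ ≠ 0) (hρ : ρ ≠ 0)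
    (hlam : DifferentiableOn ℝ lam (Ioi 0)) (hJ : IsOpen J) {S₀ : ℝ} (hS₀ : 0 < S₀)
    (h0 : lam S₀ ≠ 0) {S t u : ℝ} (hS : 0 < S) (ht : t ∈ J) : dT V.τ S t u = 0 := by
  obtain ⟨α, hα⟩ : ∃ α, dT V.τ S₀ t 0 = 2 * α := ⟨dT V.τ S₀ t 0 / 2, by ring⟩
  have hτ : ∀ S u, 0 < S → dT V.τ S t u = 2 * α := by
    intro S u hS
    rw [← hα]
    exact Filter.EventuallyEq.deriv_eq (Filter.eventually_of_mem (hJ.mem_nhds ht)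
      fun r hr => hV.tau_eq hσ hlam hJ hS hS₀ hr)
  have hξS : ∀ S u, 0 < S → dS V.ξ S t u = V.ξ S t u / S + α := by
    intro S u hS
    have := (hV.determining hσ hlam S t u hS ht).2.2.2.2.2.2.1
    rw [hτ S u hS] at this
    linear_combination -1 / 2 * this
  have hξSS : ∀ S, 0 < S → dS (dS V.ξ) S t 0 = α / S := by
    intro S hS
    have h1 : HasDerivAt (fun s => V.ξ s t 0 / s + α)
        ((dS V.ξ S t 0 * S - V.ξ S t 0 * 1) / S ^ 2) S :=
      ((SmoothOnBase.hasDerivAt_S (f := V.ξ) hV.1.1 hJ 0 hS ht).div (hasDerivAt_id S)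
        hS.ne').add_const α
    have h2 := Filter.EventuallyEq.deriv_eq (Filter.eventually_of_mem (Ioi_mem_nhds hS)
      fun s hs => hξS s 0 hs)
    rw [h1.deriv, hξS S 0 hS] at h2
    refine h2.trans ?_
    field_simp
    ring
  have hcont : ContinuousAt lam S₀ := 
    ((hlam S₀ hS₀).differentiableAt (Ioi_mem_nhds hS₀)).continuousAt
  have hev : ∀ᶠ s in nhds S₀, 0 < s ∧ lam s ≠ 0 := (lt_mem_nhds hS₀).and (hcont.eventually_ne h0)
  have hψ : ∀ s, 0 < s → dU V.φ s t 0 = V.φ s t 1 - V.φ s t 0 := by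
    intro s hs
    rw [hV.phi_eq hσ hlam hJ 1 hs ht]
    ring
  have hφS : ∀ s, 0 < s → lam s ≠ 0 → dS V.φ s t 1 - dS V.φ s t 0 = α / (2 * s) := by
    intro s hs hl
    have h1 : dS (dU V.φ) s t 0 = dS V.φ s t 1 - dS V.φ s t 0 := by
      have := ((SmoothOnBase.hasDerivAt_S (f := V.φ) hV.1.2.2 hJ 1 hs ht).sub
        (SmoothOnBase.hasDerivAt_S (f := V.φ) hV.1.2.2 hJ 0 hs ht)).deriv
      rw [← this]
      exact Filter.EventuallyEq.deriv_eq (Filter.eventually_of_mem (Ioi_mem_nhds hs)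
        fun s hs => hψ s hs)
    obtain ⟨-, -, h3, h4, -⟩ := hV.determining hσ hlam s t 0 hs ht
    have h5 : dT V.ξ s t 0 = 0 := by simpa [hρ, hs.ne', hl] using h3
    rw [h5, hξSS s hs] at h4
    have h6 := (mul_eq_zero.1 h4.symm).resolve_left (by positivity)
    rw [← h1]
    field_simp at h6 ⊢
    linarith
  have hφSS : ∀ u, dS (dS V.φ) S₀ t u = 0 := by
    intro u
    obtain ⟨-, -, -, -, h5, h6, -⟩ := hV.determining hσ hlam S₀ t u hS₀ ht
    have h7 : dT V.φ S₀ t u = 0 := by simpa [hρ, hS₀.ne', h0] using h5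
    rw [h7, zero_add] at h6
    exact (mul_eq_zero.1 h6).resolve_left (by positivity)
  have hd1 := (((SmoothOnBase.dS (f := V.φ) hV.1.2.2 hJ).hasDerivAt_S hJ 1 hS₀ ht).sub
    ((SmoothOnBase.dS (f := V.φ) hV.1.2.2 hJ).hasDerivAt_S hJ 0 hS₀ ht))
  rw [hφSS, hφSS, sub_zero] at hd1
  have hd2 : HasDerivAt (fun s : ℝ => α / 2 * s⁻¹) (α / 2 * (-(S₀ ^ 2)⁻¹)) S₀ :=
    (hasDerivAt_inv hS₀.ne').const_mul _
  have hd3 := hd1.unique (hd2.congr_of_eventuallyEq (hev.mono fun s hs => by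
    have := hφS s hs.1 hs.2
    simp only [Pi.sub_apply]
    rw [this]
    have := hs.1.ne'
    field_simp))
  have hα0 : α = 0 := by
    have := hS₀.ne'
    field_simp at hd3
    linarith
  rw [hτ S u hS, hα0, mul_zero]

/-- Unless the equation is linear, the coefficient `ξ` is proportional to `S`. -/
lemma IsPointSymmetry.xi_linear (hV : IsPointSymmetry σ ρ lam J V) (hσ : σ ≠ 0) (hρ : ρ ≠ 0)
    (hlam : DifferentiableOn ℝ lam (Ioi 0)) (hJ : IsOpen J) {S₀ : ℝ} (hS₀ : 0 < S₀)
    (h0 : lam S₀ ≠ 0) {S t u : ℝ} (hS : 0 < S) (ht : t ∈ J) :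
    V.ξ S t u = V.ξ 1 t 0 * S := by
  have := eq_of_hasDerivAt_zero (f := fun s => V.ξ s t u / s) ordConnected_Ioi
    (fun s hs => by
      have hs : 0 < s := hs
      have h := (SmoothOnBase.hasDerivAt_S (f := V.ξ) hV.1.1 hJ u hs ht).div (hasDerivAt_id s) hs.ne'
      have h2 := (hV.determining hσ hlam s t u hs ht).2.2.2.2.2.2.1
      rw [hV.dT_tau hσ hρ hlam hJ hS₀ h0 hs ht] at h2
      refine h.congr_deriv ?_
      have h3 : dS V.ξ s t u = V.ξ s t u / s := by linear_combination -1 / 2 * h2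
      rw [h3]
      simp [hs.ne'])
    (mem_Ioi.2 hS) (mem_Ioi.2 one_pos)
  simp only [div_one] at this
  rw [← hV.xi_eq hσ hlam hJ (u := u) one_pos ht, ← this]
  field_simp

/-- A symmetry that moves `S` forces a power law: the last determining equation becomes the
Euler equation `S h' = κ h` for `h = ρ S λ(S)`. -/
lemma IsPointSymmetry.exists_powerLaw (hV : IsPointSymmetry σ ρ lam J V) (hσ : σ ≠ 0) (hρ : ρ ≠ 0)
    (hlam : DifferentiableOn ℝ lam (Ioi 0)) (hJ : IsOpen J) (hm : V.MovesS J) :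
    ∃ om k : ℝ, ∀ S : ℝ, 0 < S → lam S = powerLaw om k S := by
  by_cases hl : ∃ S₀, 0 < S₀ ∧ lam S₀ ≠ 0
  swap
  · push Not at hl
    exact ⟨0, 0, fun S hS => by simp [powerLaw, hl S hS]⟩
  obtain ⟨S₀, hS₀, h0⟩ := hl
  obtain ⟨S₁, t, u₁, hS₁, ht, hξ⟩ := hm
  have hξlin : ∀ {S t u}, 0 < S → t ∈ J → V.ξ S t u = V.ξ 1 t 0 * S := fun hS ht =>
    hV.xi_linear hσ hρ hlam hJ hS₀ h0 hS ht
  rw [hξlin hS₁ ht] at hξ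
  set β := V.ξ 1 t 0 with hβ
  have hβ0 : β ≠ 0 := left_ne_zero_of_mul hξ
  have hξS : ∀ S, 0 < S → dS V.ξ S t 0 = β := by
    intro S hS
    have h1 : HasDerivAt (fun s => β * s) β S := by
      simpa using (hasDerivAt_id S).const_mul β
    rw [← h1.deriv]
    exact Filter.EventuallyEq.deriv_eq (Filter.eventually_of_mem (Ioi_mem_nhds hS)
      fun s hs => hξlin hs ht)
  have hξSS : ∀ S, 0 < S → dS (dS V.ξ) S t 0 = 0 := by
    intro S hS
    refine Eq.trans ?_ (deriv_const S β)
    exact Filter.EventuallyEq.deriv_eq (Filter.eventually_of_mem (Ioi_mem_nhds hS)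
      fun s hs => hξS s hs)
  have hβt : dT V.ξ 1 t 0 = 0 := by
    have h1 := (hV.determining hσ hlam S₀ t 0 hS₀ ht).2.2.1
    have h2 : dT V.ξ S₀ t 0 = 0 := by simpa [hρ, hS₀.ne', h0] using h1
    have h3 : dT V.ξ S₀ t 0 = dT V.ξ 1 t 0 * S₀ := by
      have := (SmoothOnBase.hasDerivAt_T (f := V.ξ) hV.1.1 hJ 0 one_pos ht).mul_const S₀
      rw [← this.deriv]
      exact Filter.EventuallyEq.deriv_eq (Filter.eventually_of_mem (hJ.mem_nhds ht)
        fun r hr => hξlin hS₀ hr)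
    rw [h3] at h2
    exact (mul_eq_zero.1 h2).resolve_right hS₀.ne'
  have hξt : ∀ S, 0 < S → dT V.ξ S t 0 = 0 := by
    intro S hS
    have := (SmoothOnBase.hasDerivAt_T (f := V.ξ) hV.1.1 hJ 0 one_pos ht).mul_const S
    rw [hβt, zero_mul] at this
    rw [← this.deriv]
    exact Filter.EventuallyEq.deriv_eq (Filter.eventually_of_mem (hJ.mem_nhds ht)
      fun r hr => hξlin hS hr)
  have hφu : ∀ S, 0 < S → dU V.φ S t 0 = dU V.φ 1 t 0 := fun S hS =>
    eq_of_hasDerivAt_zero (f := fun s => dU V.φ s t 0) ordConnected_Ioi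
      (fun s hs => by
        have h := (hV.determining hσ hlam s t 0 hs ht).2.2.2.1
        have hs' : 0 < s := hs
        rw [hξt s hs, hξSS s hs, sub_zero] at h
        have h2 := (mul_eq_zero.1 h.symm).resolve_left (by positivity)
        have h3 : dS (dU V.φ) s t 0 = 0 := by linarith
        exact ((SmoothOnBase.dU (f := V.φ) hV.1.2.2 hJ).hasDerivAt_S hJ 0 hs ht).congr_deriv h3)
      (mem_Ioi.2 hS) (mem_Ioi.2 one_pos)
  -- `φ_u = (1 - k) β`, and then `S λ' = k λ`
  obtain ⟨k, hk⟩ : ∃ k, k = 1 - dU V.φ 1 t 0 / β := ⟨_, rfl⟩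
  have hode : ∀ S, 0 < S → S * deriv lam S = k * lam S := by
    intro S hS
    have h := (hV.determining hσ hlam S t 0 hS ht).2.2.2.2.2.2.2
    rw [hξlin hS ht, ← hβ, hξS S hS, hφu S hS] at h
    have h2 : dU V.φ 1 t 0 = (1 - k) * β := by rw [hk]; field_simp; ring
    rw [h2] at h
    have : (ρ * β * S) * (S * deriv lam S) = (ρ * β * S) * (k * lam S) := by
      linear_combination h
    exact mul_left_cancel₀ (by positivity) this
  refine ⟨lam 1, k, fun S hS => ?_⟩
  have := eq_of_hasDerivAt_zero (f := fun s => lam s * s ^ (-k)) ordConnected_Ioi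
    (fun s hs => by
      have hs' : 0 < s := hs
      have h1 := (((hlam s hs).differentiableAt (Ioi_mem_nhds hs)).hasDerivAt).mul
        (Real.hasDerivAt_rpow_const (p := -k) (Or.inl hs'.ne'))
      refine h1.congr_deriv ?_
      rw [Real.rpow_sub_one hs'.ne']
      have h2 := hode s hs
      have h3 : lam s * (-k * (s ^ (-k) / s)) = -(s ^ (-k) / s) * (k * lam s) := by ring
      rw [h3, ← h2]
      field_simp
      ring)
    (mem_Ioi.2 hS) (mem_Ioi.2 one_pos)
  simp only [Real.one_rpow, mul_one, Real.rpow_neg hS.le] at this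
  rw [powerLaw, ← this]
  have := (Real.rpow_pos_of_pos hS k).ne'
  field_simp

end Determining

/-! ### Symmetries for power laws -/

lemma hasDerivAt_powerLaw (om k : ℝ) {S : ℝ} (hS : 0 < S) :
    HasDerivAt (powerLaw om k) (k * powerLaw om k S / S) S := by
  have := (Real.hasDerivAt_rpow_const (p := k) (Or.inl hS.ne')).const_mul om
  refine this.congr_deriv ?_
  rw [powerLaw, Real.rpow_sub_one hS.ne']
  ring

lemma differentiableOn_powerLaw (om k : ℝ) : DifferentiableOn ℝ (powerLaw om k) (Ioi 0) :=
  fun _ hS => (hasDerivAt_powerLaw om k hS).differentiableAt.differentiableWithinAt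

/-- `V` is, over `J`, the vector field
`β S ∂_S + κ ∂_t + ((1 - k) β u + e S + d) ∂_u`. -/
def VField.IsAffine (V : VField) (J : Set ℝ) (k β κ e d : ℝ) : Prop :=
  ∀ S t u : ℝ, 0 < S → t ∈ J →
    V.ξ S t u = β * S ∧ V.τ S t u = κ ∧ V.φ S t u = (1 - k) * β * u + e * S + d

lemma VField.IsAffine.isPointSymmetry {V : VField} {J : Set ℝ} {k β κ e d : ℝ}
    (hV : V.IsAffine J k β κ e d) (hJ : IsOpen J) {σ ρ om : ℝ} {lam : ℝ → ℝ}
    (hlam : ∀ S : ℝ, 0 < S → lam S = powerLaw om k S) : IsPointSymmetry σ ρ lam J V := by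
  have eξ : ∀ S t u, 0 < S → t ∈ J → V.ξ S t u = (fun S _ _ => β * S : ℝ → ℝ → ℝ → ℝ) S t u :=
    fun S t u hS ht => (hV S t u hS ht).1
  have eτ : ∀ S t u, 0 < S → t ∈ J → V.τ S t u = (fun _ _ _ => κ : ℝ → ℝ → ℝ → ℝ) S t u :=
    fun S t u hS ht => (hV S t u hS ht).2.1
  have eφ : ∀ S t u, 0 < S → t ∈ J → V.φ S t u =
      (fun S _ u => (1 - k) * β * u + e * S + d : ℝ → ℝ → ℝ → ℝ) S t u :=
    fun S t u hS ht => (hV S t u hS ht).2.2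
  refine ⟨⟨?_, ?_, ?_⟩, ?_⟩
  · refine ContDiffOn.congr (f := fun x : ℝ × ℝ × ℝ => β * x.1) (by fun_prop) fun x hx => ?_
    exact eξ _ _ _ hx.1 hx.2
  · refine ContDiffOn.congr (f := fun x : ℝ × ℝ × ℝ => κ) (by fun_prop) fun x hx => ?_
    exact eτ _ _ _ hx.1 hx.2
  · refine ContDiffOn.congr (f := fun x : ℝ × ℝ × ℝ => (1 - k) * β * x.2.2 + e * x.1 + d)
      (by fun_prop) fun x hx => ?_
    exact eφ _ _ _ hx.1 hx.2
  have mulc : ∀ c x : ℝ, deriv (fun y => c * y) x = c := fun c x => by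
    simp
  have ξS : ∀ S t u, 0 < S → t ∈ J → dS V.ξ S t u = (fun _ _ _ => β : ℝ → ℝ → ℝ → ℝ) S t u :=
    fun S t u hS ht => (dS_congr eξ hS ht).trans (mulc β S)
  have ξU : ∀ S t u, 0 < S → t ∈ J → dU V.ξ S t u = (fun _ _ _ => 0 : ℝ → ℝ → ℝ → ℝ) S t u :=
    fun S t u hS ht => (dU_congr eξ hS ht).trans (deriv_const _ _)
  have ξT : ∀ S t u, 0 < S → t ∈ J → dT V.ξ S t u = (fun _ _ _ => 0 : ℝ → ℝ → ℝ → ℝ) S t u :=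
    fun S t u hS ht => (dT_congr hJ eξ hS ht).trans (deriv_const _ _)
  have τS : ∀ S t u, 0 < S → t ∈ J → dS V.τ S t u = (fun _ _ _ => 0 : ℝ → ℝ → ℝ → ℝ) S t u :=
    fun S t u hS ht => (dS_congr eτ hS ht).trans (deriv_const _ _)
  have τU : ∀ S t u, 0 < S → t ∈ J → dU V.τ S t u = (fun _ _ _ => 0 : ℝ → ℝ → ℝ → ℝ) S t u :=
    fun S t u hS ht => (dU_congr eτ hS ht).trans (deriv_const _ _)
  have τT : ∀ S t u, 0 < S → t ∈ J → dT V.τ S t u = (fun _ _ _ => 0 : ℝ → ℝ → ℝ → ℝ) S t u :=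
    fun S t u hS ht => (dT_congr hJ eτ hS ht).trans (deriv_const _ _)
  have φS : ∀ S t u, 0 < S → t ∈ J → dS V.φ S t u = (fun _ _ _ => e : ℝ → ℝ → ℝ → ℝ) S t u :=
    fun S t u hS ht => (dS_congr eφ hS ht).trans (by
      refine (((((hasDerivAt_id S).const_mul e).const_add ((1 - k) * β * u)).add_const d).deriv).trans
        (mul_one e))
  have φU : ∀ S t u, 0 < S → t ∈ J →
      dU V.φ S t u = (fun _ _ _ => (1 - k) * β : ℝ → ℝ → ℝ → ℝ) S t u :=
    fun S t u hS ht => (dU_congr eφ hS ht).trans (by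
      refine (((((hasDerivAt_id u).const_mul ((1 - k) * β)).add_const (e * S)).add_const d).deriv).trans
        (mul_one _))
  have φT : ∀ S t u, 0 < S → t ∈ J → dT V.φ S t u = (fun _ _ _ => 0 : ℝ → ℝ → ℝ → ℝ) S t u :=
    fun S t u hS ht => (dT_congr hJ eφ hS ht).trans (deriv_const _ _)
  intro S t u p r m n hS ht hm hΔ
  have ξSS := (dS_congr ξS (u := u) hS ht).trans (deriv_const _ _)
  have ξUU := (dU_congr ξU (u := u) hS ht).trans (deriv_const _ _)
  have ξSU := (dS_congr ξU (u := u) hS ht).trans (deriv_const _ _)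
  have τSS := (dS_congr τS (u := u) hS ht).trans (deriv_const _ _)
  have τUU := (dU_congr τU (u := u) hS ht).trans (deriv_const _ _)
  have τSU := (dS_congr τU (u := u) hS ht).trans (deriv_const _ _)
  have φSS := (dS_congr φS (u := u) hS ht).trans (deriv_const _ _)
  have φUU := (dU_congr φU (u := u) hS ht).trans (deriv_const _ _)
  have φSU := (dS_congr φU (u := u) hS ht).trans (deriv_const _ _)
  have hL : HasDerivAt lam (k * lam S / S) S := by
    rw [hlam S hS]
    exact (hasDerivAt_powerLaw om k hS).congr_of_eventuallyEq
      (Filter.eventually_of_mem (Ioi_mem_nhds hS) hlam)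
  rw [prolDelta_eq V σ ρ hS.ne' hL t u p r m n hm]
  simp only [VField.prolSS, VField.prolT, ξSS, ξUU, ξSU, τSS, τUU, τSU, φSS, φUU, φSU,
    ξS S t u hS ht, ξT S t u hS ht, ξU S t u hS ht, τS S t u hS ht, τT S t u hS ht, τU S t u hS ht,
    φT S t u hS ht, φU S t u hS ht, eξ S t u hS ht]
  have hr : r = -(σ ^ 2 * S ^ 2 / 2 * (m / (1 - ρ * S * lam S * m) ^ 2)) := by
    rw [Delta] at hΔ; linarith
  rw [hr]
  have h2 : S * (k * lam S / S) = k * lam S := by field_simp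
  rw [h2]
  generalize hh : ρ * S * lam S = h at *
  have e2 : m / (1 - h * m) ^ 2 = m * (1 - h * m) * (1 / (1 - h * m) ^ 3) := by field_simp
  rw [e2, div_eq_mul_one_div (m ^ 2), div_eq_mul_one_div (1 + h * m)]
  generalize 1 / (1 - h * m) ^ 3 = i3
  have hSS : 2 * (σ ^ 2 * S ^ 2 / 2) / S = σ ^ 2 * S := by field_simp
  rw [hSS]
  linear_combination (β * σ ^ 2 * S ^ 2 * (k + 1) * m ^ 2 * i3) * hh

/-- The point symmetries of the equation with a nonzero power law. -/
lemma isPointSymmetry_powerLaw_iff {σ ρ om k : ℝ} (hσ : σ ≠ 0) (hρ : ρ ≠ 0) (hom : om ≠ 0)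
    {J : Set ℝ} (hJ : IsOpen J) (hJc : J.OrdConnected) (hJn : J.Nonempty) (V : VField) :
    IsPointSymmetry σ ρ (powerLaw om k) J V ↔ ∃ β κ e d : ℝ, V.IsAffine J k β κ e d := by
  refine ⟨fun hV => ?_, fun ⟨β, κ, e, d, h⟩ => h.isPointSymmetry hJ fun _ _ => rfl⟩
  have hlam := differentiableOn_powerLaw om k
  have hne : ∀ S, 0 < S → powerLaw om k S ≠ 0 := fun S hS =>
    mul_ne_zero hom (Real.rpow_pos_of_pos hS k).ne'
  obtain ⟨t₀, ht₀⟩ := hJn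
  have hξt : ∀ S t u, 0 < S → t ∈ J → dT V.ξ S t u = 0 := fun S t u hS ht => by
    simpa [hρ, hS.ne', hne S hS] using (hV.determining hσ hlam S t u hS ht).2.2.1
  have hφt : ∀ S t u, 0 < S → t ∈ J → dT V.φ S t u = 0 := fun S t u hS ht => by
    simpa [hρ, hS.ne', hne S hS] using (hV.determining hσ hlam S t u hS ht).2.2.2.2.1
  have hφSS : ∀ S t u, 0 < S → t ∈ J → dS (dS V.φ) S t u = 0 := fun S t u hS ht => by
    have := (hV.determining hσ hlam S t u hS ht).2.2.2.2.2.1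
    rw [hφt S t u hS ht, zero_add] at this
    exact (mul_eq_zero.1 this).resolve_left (by positivity)
  have hτt : ∀ S t u, 0 < S → t ∈ J → dT V.τ S t u = 0 := fun S t u hS ht =>
    hV.dT_tau hσ hρ hlam hJ one_pos (hne 1 one_pos) hS ht
  obtain ⟨β, hβ⟩ : ∃ β, β = V.ξ 1 t₀ 0 := ⟨_, rfl⟩
  have hξ : ∀ S t u, 0 < S → t ∈ J → V.ξ S t u = β * S := fun S t u hS ht => by
    rw [hV.xi_linear hσ hρ hlam hJ one_pos (hne 1 one_pos) hS ht, hβ]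
    congr 1
    exact eq_of_hasDerivAt_zero (f := fun r => V.ξ 1 r 0) hJc
      (fun r hr => (SmoothOnBase.hasDerivAt_T (f := V.ξ) hV.1.1 hJ 0 one_pos hr).congr_deriv
        (hξt 1 r 0 one_pos hr)) ht ht₀
  have hφu : ∀ S t u, 0 < S → t ∈ J → dU V.φ S t u = (1 - k) * β := fun S t u hS ht => by
    have h := (hV.determining hσ hlam S t u hS ht).2.2.2.2.2.2.2
    have h1 : dS V.ξ S t u = β := by
      have := (dS_congr hξ (u := u) hS ht)
      rw [this]
      exact ((hasDerivAt_id S).const_mul β).deriv.trans (mul_one β)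
    rw [(hasDerivAt_powerLaw om k hS).deriv, h1, hξ S t u hS ht] at h
    have h2 : S * (k * powerLaw om k S / S) = k * powerLaw om k S := by field_simp
    rw [h2] at h
    have h3 : ρ * S * powerLaw om k S ≠ 0 := mul_ne_zero (mul_ne_zero hρ hS.ne') (hne S hS)
    exact mul_left_cancel₀ h3 (by linear_combination h)
  have hφS : ∀ S, 0 < S → dS V.φ S t₀ 0 = dS V.φ 1 t₀ 0 := fun S hS =>
    eq_of_hasDerivAt_zero (f := fun s => dS V.φ s t₀ 0) ordConnected_Ioi
      (fun s hs => ((SmoothOnBase.dS (f := V.φ) hV.1.2.2 hJ).hasDerivAt_S hJ 0 hs ht₀).congr_deriv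
        (hφSS s t₀ 0 hs ht₀))
      (mem_Ioi.2 hS) (mem_Ioi.2 one_pos)
  refine ⟨β, V.τ 1 t₀ 0, dS V.φ 1 t₀ 0, V.φ 1 t₀ 0 - dS V.φ 1 t₀ 0, fun S t u hS ht =>
    ⟨hξ S t u hS ht, ?_, ?_⟩⟩
  · rw [hV.tau_eq hσ hlam hJ (u' := 0) hS one_pos ht]
    exact eq_of_hasDerivAt_zero (f := fun r => V.τ 1 r 0) hJc
      (fun r hr => (SmoothOnBase.hasDerivAt_T (f := V.τ) hV.1.2.1 hJ 0 one_pos hr).congr_deriv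
        (hτt 1 r 0 one_pos hr)) ht ht₀
  · rw [hV.phi_eq hσ hlam hJ u hS ht, hφu S t 0 hS ht]
    have h1 : V.φ S t 0 = V.φ S t₀ 0 :=
      eq_of_hasDerivAt_zero (f := fun r => V.φ S r 0) hJc
        (fun r hr => (SmoothOnBase.hasDerivAt_T (f := V.φ) hV.1.2.2 hJ 0 hS hr).congr_deriv
          (hφt S r 0 hS hr)) ht ht₀
    have h2 := eq_of_hasDerivAt_zero (f := fun s => V.φ s t₀ 0 - dS V.φ 1 t₀ 0 * s) ordConnected_Ioi
      (fun s hs => by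
        refine ((SmoothOnBase.hasDerivAt_S (f := V.φ) hV.1.2.2 hJ 0 hs ht₀).sub
          ((hasDerivAt_id s).const_mul (dS V.φ 1 t₀ 0))).congr_deriv ?_
        rw [hφS s hs, mul_one, sub_self]) (mem_Ioi.2 hS) (mem_Ioi.2 one_pos)
    simp only [mul_one] at h2
    linear_combination h1 + h2

lemma scalingGen_isAffine (a k : ℝ) (J : Set ℝ) : (scalingGen a k).IsAffine J k (-a) 1 0 0 :=
  fun S t u _ _ => ⟨by simp only [scalingGen]; ring, rfl, by simp only [scalingGen]; ring⟩

/-- Tangency to `u = 0` kills the inhomogeneous part `e S + d`. -/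
lemma isReducingSymmetry_powerLaw_iff {σ ρ om k : ℝ} (hσ : σ ≠ 0) (hρ : ρ ≠ 0) (hom : om ≠ 0)
    {J : Set ℝ} (hJ : IsOpen J) (hJc : J.OrdConnected) (hJn : J.Nonempty) (V : VField) :
    IsReducingSymmetry σ ρ (powerLaw om k) J V ↔
      ∃ κ a : ℝ, κ ≠ 0 ∧ a ≠ 0 ∧ ∀ S t u : ℝ, 0 < S → t ∈ J →
        V.ξ S t u = κ * (scalingGen a k).ξ S t u ∧
        V.τ S t u = κ * (scalingGen a k).τ S t u ∧
        V.φ S t u = κ * (scalingGen a k).φ S t u := by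
  rw [IsReducingSymmetry, isPointSymmetry_powerLaw_iff hσ hρ hom hJ hJc hJn]
  obtain ⟨t₀, ht₀⟩ := hJn
  constructor
  · rintro ⟨⟨β, κ, e, d, hV⟩, ⟨S₁, t₁, u₁, hS₁, ht₁, h₁⟩, ⟨S₂, t₂, u₂, hS₂, ht₂, h₂⟩, h0⟩
    rw [(hV _ _ _ hS₁ ht₁).1] at h₁
    rw [(hV _ _ _ hS₂ ht₂).2.1] at h₂
    have hβ : β ≠ 0 := left_ne_zero_of_mul h₁
    have a1 := h0 1 t₀ one_pos ht₀
    have a2 := h0 2 t₀ two_pos ht₀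
    rw [(hV _ _ _ one_pos ht₀).2.2] at a1
    rw [(hV _ _ _ two_pos ht₀).2.2] at a2
    have he : e = 0 := by linarith
    have hd : d = 0 := by linarith
    refine ⟨κ, -β / κ, h₂, div_ne_zero (neg_ne_zero.2 hβ) h₂, fun S t u hS ht => ?_⟩
    obtain ⟨b1, b2, b3⟩ := hV S t u hS ht
    simp only [scalingGen, b1, b2, b3, he, hd]
    refine ⟨?_, ?_, ?_⟩ <;> (field_simp; try ring)
  · rintro ⟨κ, a, hκ, ha, hV⟩
    have hA : V.IsAffine J k (-(κ * a)) κ 0 0 := fun S t u hS ht => by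
      obtain ⟨b1, b2, b3⟩ := hV S t u hS ht
      simp only [b1, b2, b3, scalingGen]
      refine ⟨?_, ?_, ?_⟩ <;> ring
    refine ⟨⟨_, _, _, _, hA⟩, ⟨1, t₀, 0, one_pos, ht₀, ?_⟩, ⟨1, t₀, 0, one_pos, ht₀, ?_⟩, ?_⟩
    · rw [(hA _ _ _ one_pos ht₀).1]
      simp [hκ, ha]
    · rwa [(hA _ _ _ one_pos ht₀).2.1]
    · intro S t hS ht
      rw [(hA _ _ _ hS ht).2.2]
      simp

/-- The zero function is an invariant solution for every power law. -/
lemma exists_reducing_invariantSolution (σ ρ om k : ℝ) {lam : ℝ → ℝ}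
    (hlam : ∀ S : ℝ, 0 < S → lam S = powerLaw om k S) {J : Set ℝ} (hJ : IsOpen J)
    (hJn : J.Nonempty) :
    ∃ (V : VField) (U : Set (ℝ × ℝ)) (u : ℝ → ℝ → ℝ), IsReducingSymmetry σ ρ lam J V ∧
      IsOpen U ∧ U.Nonempty ∧ U ⊆ Ioi 0 ×ˢ J ∧ IsInvariantSolution σ ρ lam V U u := by
  obtain ⟨t₀, ht₀⟩ := hJn
  refine ⟨scalingGen 1 k, Ioi 0 ×ˢ J, fun _ _ => 0,
    ⟨(scalingGen_isAffine 1 k J).isPointSymmetry hJ hlam, ⟨1, t₀, 0, one_pos, ht₀, ?_⟩,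
      ⟨1, t₀, 0, one_pos, ht₀, ?_⟩, ?_⟩, isOpen_Ioi.prod hJ, ⟨(1, t₀), one_pos, ht₀⟩, subset_rfl,
    ⟨⟨?_, ?_⟩, ?_⟩⟩
  · simp [scalingGen]
  · simp [scalingGen]
  · simp [scalingGen]
  · exact contDiffOn_const (c := (0 : ℝ))
  · intro S t _
    simp [uSS, uS, uT, Delta]
  · intro S t _
    simp [uS, uT, scalingGen]

/-! ### Invariant solutions as functions of one variable -/

lemma IsAdmissible.isOpen_zImage {a : ℝ} {U : Set (ℝ × ℝ)} (hU : IsAdmissible a U) :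
    IsOpen (zImage a U) := by
  rw [isOpen_iff_mem_nhds]
  rintro _ ⟨⟨S, t⟩, hx, rfl⟩
  have hS : 0 < S := hU.2.2.1 _ hx
  have hc : ContinuousAt (fun z : ℝ => (Real.exp (z - a * t), t)) (zVar a S t) := by fun_prop
  have h0 : (Real.exp (zVar a S t - a * t), t) = (S, t) := by
    simp [zVar, Real.exp_log hS]
  have := hc.preimage_mem_nhds (by rw [h0]; exact hU.1.mem_nhds hx)
  refine Filter.mem_of_superset this fun z hz => ⟨_, hz, ?_⟩
  simp [zVar]

lemma IsAdmissible.ordConnected_zImage {a : ℝ} {U : Set (ℝ × ℝ)} (hU : IsAdmissible a U) :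
    (zImage a U).OrdConnected := by
  refine (hU.2.1.isPreconnected.image _ fun x hx => ?_).ordConnected
  have := (hU.2.2.1 x hx).ne'
  unfold zVar
  exact ((Real.continuousAt_log this).comp continuousAt_fst |>.add (by fun_prop)).continuousWithinAt

lemma IsAdmissible.nonempty_zImage {a : ℝ} {U : Set (ℝ × ℝ)} (hU : IsAdmissible a U) :
    (zImage a U).Nonempty := hU.2.1.nonempty.image _

section Slices

variable {U : Set (ℝ × ℝ)} {S t : ℝ}

lemma eventually_slice_S (hU : IsOpen U) (h : (S, t) ∈ U) : ∀ᶠ s in nhds S, (s, t) ∈ U :=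
  (Continuous.continuousAt (f := fun s : ℝ => (s, t)) (by fun_prop)).preimage_mem_nhds
    (hU.mem_nhds h)

lemma eventually_slice_T (hU : IsOpen U) (h : (S, t) ∈ U) : ∀ᶠ r in nhds t, (S, r) ∈ U :=
  (Continuous.continuousAt (f := fun r : ℝ => (S, r)) (by fun_prop)).preimage_mem_nhds
    (hU.mem_nhds h)

end Slices

lemma uS_congr {U : Set (ℝ × ℝ)} (hU : IsOpen U) {u w : ℝ → ℝ → ℝ}
    (h : ∀ S t, (S, t) ∈ U → u S t = w S t) {S t : ℝ} (hx : (S, t) ∈ U) : uS u S t = uS w S t :=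
  Filter.EventuallyEq.deriv_eq ((eventually_slice_S hU hx).mono fun s hs => h s t hs)

lemma uT_congr {U : Set (ℝ × ℝ)} (hU : IsOpen U) {u w : ℝ → ℝ → ℝ}
    (h : ∀ S t, (S, t) ∈ U → u S t = w S t) {S t : ℝ} (hx : (S, t) ∈ U) : uT u S t = uT w S t :=
  Filter.EventuallyEq.deriv_eq ((eventually_slice_T hU hx).mono fun s hs => h S s hs)

/-- The derivative along a plane curve, in terms of the partial derivatives. -/
lemma hasDerivAt_comp_curve {u : ℝ → ℝ → ℝ} {f g : ℝ → ℝ} {f' g' r : ℝ}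
    (hu : DifferentiableAt ℝ (Function.uncurry u) (f r, g r)) (hf : HasDerivAt f f' r)
    (hg : HasDerivAt g g' r) :
    HasDerivAt (fun r => u (f r) (g r)) (f' * uS u (f r) (g r) + g' * uT u (f r) (g r)) r := by
  have h1 : uS u (f r) (g r) = fderiv ℝ (Function.uncurry u) (f r, g r) (1, 0) :=
    (hu.hasFDerivAt.comp_hasDerivAt (f r) (f := fun s : ℝ => (s, g r))
      ((hasDerivAt_id _).prodMk (hasDerivAt_const _ _))).deriv
  have h2 : uT u (f r) (g r) = fderiv ℝ (Function.uncurry u) (f r, g r) (0, 1) :=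
    (hu.hasFDerivAt.comp_hasDerivAt (g r) (f := fun s : ℝ => (f r, s))
      ((hasDerivAt_const _ _).prodMk (hasDerivAt_id _))).deriv
  have h3 := hu.hasFDerivAt.comp_hasDerivAt r (hf.prodMk hg)
  refine h3.congr_deriv ?_
  have : ((f', g') : ℝ × ℝ) = f' • (1, 0) + g' • (0, 1) := by simp
  rw [this, map_add, map_smul, map_smul, h1, h2, smul_eq_mul, smul_eq_mul]

section Reduction

variable {a k : ℝ} {I : Set ℝ} {v : ℝ → ℝ} {U : Set (ℝ × ℝ)} {u : ℝ → ℝ → ℝ}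

lemma hasDerivAt_of_contDiffOn (hI : IsOpen I) (hv : ContDiffOn ℝ ∞ v I) {z : ℝ} (hz : z ∈ I) :
    HasDerivAt v (deriv v z) z :=
  ((hv.contDiffAt (hI.mem_nhds hz)).differentiableAt (by simp)).hasDerivAt

lemma contDiffOn_deriv (hI : IsOpen I) (hv : ContDiffOn ℝ ∞ v I) : ContDiffOn ℝ ∞ (deriv v) I :=
  hv.deriv_of_isOpen hI (by simp)

/-- The derivatives of `u = S ^ (1 - k) v (log S + a t)`. -/
lemma derivs_of_eq_rpow_mul (hI : IsOpen I) (hv : ContDiffOn ℝ ∞ v I) (hU : IsOpen U)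
    (hpos : ∀ x ∈ U, 0 < x.1) (hz : ∀ S t, (S, t) ∈ U → zVar a S t ∈ I)
    (hu : ∀ S t : ℝ, (S, t) ∈ U → u S t = S ^ (1 - k) * v (zVar a S t))
    {S t : ℝ} (hx : (S, t) ∈ U) :
    uS u S t = S ^ (-k) * ((1 - k) * v (zVar a S t) + deriv v (zVar a S t)) ∧
    uT u S t = S ^ (1 - k) * (a * deriv v (zVar a S t)) ∧
    uSS u S t = S ^ (-k) / S * secondOrderPart k v (zVar a S t) := by
  have hS : ∀ {S t}, (S, t) ∈ U → 0 < S := fun h => hpos _ h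
  have hzS : ∀ {S t}, (S, t) ∈ U → HasDerivAt (fun s => zVar a s t) S⁻¹ S := fun h =>
    (Real.hasDerivAt_log (hS h).ne').add_const _
  have hzT : ∀ {S t}, HasDerivAt (fun r => zVar a S r) a t := fun {S t} => by
    refine (((hasDerivAt_id t).const_mul a).const_add (Real.log S)).congr_deriv (mul_one a)
  have hvd : ∀ {S t}, (S, t) ∈ U → HasDerivAt v (deriv v (zVar a S t)) (zVar a S t) := fun h =>
    hasDerivAt_of_contDiffOn hI hv (hz _ _ h)
  have hvdd : ∀ {S t}, (S, t) ∈ U →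
      HasDerivAt (deriv v) (deriv (deriv v) (zVar a S t)) (zVar a S t) := fun h =>
    hasDerivAt_of_contDiffOn hI (contDiffOn_deriv hI hv) (hz _ _ h)
  have h1 : ∀ {S t}, (S, t) ∈ U →
      uS u S t = S ^ (-k) * ((1 - k) * v (zVar a S t) + deriv v (zVar a S t)) := by
    intro S t h
    rw [uS_congr hU hu h]
    have hd := (Real.hasDerivAt_rpow_const (p := 1 - k) (Or.inl (hS h).ne')).mul
      ((hvd h).comp S (hzS h))
    refine hd.deriv.trans ?_
    have e1 : (1 - k - 1 : ℝ) = -k := by ring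
    have e2 : S ^ (1 - k) = S * S ^ (-k) := by
      rw [sub_eq_add_neg, Real.rpow_add (hS h), Real.rpow_one]
    rw [e1, e2]
    have := (hS h).ne'
    simp only [Function.comp]
    field_simp
  refine ⟨h1 hx, ?_, ?_⟩
  · rw [uT_congr hU hu hx]
    refine (((hvd hx).comp t hzT).const_mul (S ^ (1 - k))).deriv.trans ?_
    ring
  · have e := Filter.EventuallyEq.deriv_eq ((eventually_slice_S hU hx).mono fun s hs => h1 hs)
    rw [uSS, e]
    have hd := (Real.hasDerivAt_rpow_const (p := -k) (Or.inl (hS hx).ne')).mul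
      ((((hvd hx).comp S (hzS hx)).const_mul (1 - k)).add ((hvdd hx).comp S (hzS hx)))
    refine hd.deriv.trans ?_
    rw [Real.rpow_sub_one (hS hx).ne', secondOrderPart]
    have := (hS hx).ne'
    simp only [Function.comp, Pi.add_apply]
    field_simp
    ring

lemma isInvariantSolution_iff_solvesReduced {σ ρ om : ℝ} (hI : IsOpen I)
    (hv : ContDiffOn ℝ ∞ v I) (hU : IsOpen U) (hpos : ∀ x ∈ U, 0 < x.1) (hz : zImage a U = I)
    (hu : ∀ S t : ℝ, (S, t) ∈ U → u S t = S ^ (1 - k) * v (zVar a S t)) :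
    IsInvariantSolution σ ρ (powerLaw om k) (scalingGen a k) U u ↔
      SolvesReduced σ a (ρ * om) k I v := by
  have hz' : ∀ S t, (S, t) ∈ U → zVar a S t ∈ I := fun S t h => hz ▸ ⟨_, h, rfl⟩
  have key : ∀ S t, (S, t) ∈ U →
      1 - ρ * S * powerLaw om k S * uSS u S t
        = 1 - ρ * om * secondOrderPart k v (zVar a S t) ∧
      Delta σ ρ (powerLaw om k) S (uT u S t) (uSS u S t) = S ^ (1 - k) *
        (a * deriv v (zVar a S t) + σ ^ 2 / 2 * (secondOrderPart k v (zVar a S t)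
          / (1 - ρ * om * secondOrderPart k v (zVar a S t)) ^ 2)) := by
    intro S t h
    have hS : 0 < S := hpos _ h
    obtain ⟨-, h2, h3⟩ := derivs_of_eq_rpow_mul hI hv hU hpos hz' hu h
    have e2 : S ^ (1 - k) = S * S ^ (-k) := by
      rw [sub_eq_add_neg, Real.rpow_add hS, Real.rpow_one]
    have e3 : S ^ k * S ^ (-k) = 1 := by rw [← Real.rpow_add hS]; simp
    have e4 : 1 - ρ * S * powerLaw om k S * uSS u S t
        = 1 - ρ * om * secondOrderPart k v (zVar a S t) := by
      rw [h3, powerLaw]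
      have : ρ * S * (om * S ^ k) * (S ^ (-k) / S * secondOrderPart k v (zVar a S t))
        = (S ^ k * S ^ (-k)) * (ρ * om * secondOrderPart k v (zVar a S t)) := by field_simp
      rw [this, e3, one_mul]
    refine ⟨e4, ?_⟩
    rw [Delta, e4, h2, h3, e2]
    field_simp
  constructor
  · rintro ⟨⟨-, h⟩, -⟩ z hzI
    rw [← hz] at hzI
    obtain ⟨⟨S, t⟩, hx, rfl⟩ := hzI
    obtain ⟨k1, k2⟩ := key S t hx
    obtain ⟨h1, h2⟩ := h S t hx
    rw [k1] at h1
    rw [k2] at h2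
    exact ⟨h1, (mul_eq_zero.1 h2).resolve_left (Real.rpow_pos_of_pos (hpos _ hx) _).ne'⟩
  · intro h
    refine ⟨⟨?_, fun S t hx => ?_⟩, fun S t hx => ?_⟩
    · refine ContDiffOn.congr (f := fun x : ℝ × ℝ => x.1 ^ (1 - k) * v (zVar a x.1 x.2)) ?_
        fun x hx => hu x.1 x.2 hx
      intro x hx
      have hS : x.1 ≠ 0 := (hpos x hx).ne'
      have h1 : ContDiffAt ℝ ∞ (fun x : ℝ × ℝ => x.1 ^ (1 - k)) x :=
        contDiffAt_fst.rpow_const_of_ne hS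
      have h2 : ContDiffAt ℝ ∞ (fun x : ℝ × ℝ => zVar a x.1 x.2) x :=
        ((Real.contDiffAt_log.2 hS).comp x contDiffAt_fst).add (contDiffAt_const.mul contDiffAt_snd)
      have h3 : ContDiffAt ℝ ∞ v (zVar a x.1 x.2) :=
        hv.contDiffAt (hI.mem_nhds (hz' x.1 x.2 hx))
      exact (h1.mul (h3.comp x h2)).contDiffWithinAt
    · obtain ⟨k1, k2⟩ := key S t hx
      obtain ⟨h1, h2⟩ := h _ (hz' S t hx)
      rw [k1, k2, h2, mul_zero]
      exact ⟨h1, rfl⟩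
    · obtain ⟨h1, h2, -⟩ := derivs_of_eq_rpow_mul hI hv hU hpos hz' hu hx
      have hS : 0 < S := hpos _ hx
      have e2 : S ^ (1 - k) = S * S ^ (-k) := by
        rw [sub_eq_add_neg, Real.rpow_add hS, Real.rpow_one]
      simp only [scalingGen]
      rw [h1, h2, hu S t hx, e2]
      ring

/-- An invariant solution is constant along the orbits `log S + a t = z` of the symmetry, up to the
factor `S ^ (1 - k)`. -/
lemma exists_profile (hU : IsAdmissible a U) (hu : ContDiffOn ℝ ∞ (Function.uncurry u) U)
    (hinv : ∀ S t : ℝ, (S, t) ∈ U → (scalingGen a k).ξ S t (u S t) * uS u S t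
      + (scalingGen a k).τ S t (u S t) * uT u S t = (scalingGen a k).φ S t (u S t)) :
    ∃ v : ℝ → ℝ, ContDiffOn ℝ ∞ v (zImage a U) ∧
      ∀ S t : ℝ, (S, t) ∈ U → u S t = S ^ (1 - k) * v (zVar a S t) := by
  obtain ⟨w, hw⟩ : ∃ w : ℝ → ℝ → ℝ, w = fun z t =>
    u (Real.exp (z - a * t)) t * Real.exp (-(1 - k) * (z - a * t)) := ⟨_, rfl⟩
  have hwc : ∀ z t t', (Real.exp (z - a * t), t) ∈ U → (Real.exp (z - a * t'), t') ∈ U →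
      w z t = w z t' := by
    intro z t t' h h'
    refine eq_of_hasDerivAt_zero (f := w z) (hU.2.2.2 z).ordConnected (fun r hr => ?_) h h'
    have hr : (Real.exp (z - a * r), r) ∈ U := hr
    have hl : HasDerivAt (fun r => z - a * r) (-a) r := by
      refine (((hasDerivAt_id r).const_mul a).const_sub z).congr_deriv (by simp)
    have h1 := hasDerivAt_comp_curve (u := u) (f := fun r => Real.exp (z - a * r)) (g := id)
      ((hu.contDiffAt (hU.1.mem_nhds hr)).differentiableAt (by simp)) hl.exp (hasDerivAt_id r)
    have h2 := h1.mul (hl.const_mul (-(1 - k))).exp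
    rw [hw]
    refine h2.congr_deriv ?_
    have h3 := hinv _ _ hr
    simp only [scalingGen, id] at h3 ⊢
    linear_combination Real.exp (-(1 - k) * (z - a * r)) * h3
  have hch : ∀ z, ∃ t, z ∈ zImage a U → (Real.exp (z - a * t), t) ∈ U := by
    intro z
    by_cases hz : z ∈ zImage a U
    · obtain ⟨⟨S, t⟩, hx, rfl⟩ := hz
      refine ⟨t, fun _ => ?_⟩
      have hS : 0 < S := hU.2.2.1 _ hx
      simpa [zVar, Real.exp_log hS] using hx
    · exact ⟨0, fun h => absurd h hz⟩
  -- `T z` is an arbitrary point of the orbit of `z`; near `z` it may be replaced by a fixed time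
  choose T hT using hch
  refine ⟨fun z => w z (T z), fun z hz => ?_, fun S t hx => ?_⟩
  · have hc : ContinuousAt (fun y : ℝ => (Real.exp (y - a * T z), T z)) z := by fun_prop
    have hnear := hc.preimage_mem_nhds (hU.1.mem_nhds (hT z hz))
    have hsm : ContDiffAt ℝ ∞ (fun y => w y (T z)) z := by
      rw [hw]
      have h1 : ContDiffAt ℝ ∞ (fun y : ℝ => (Real.exp (y - a * T z), T z)) z := by fun_prop
      have h2 : ContDiffAt ℝ ∞ (fun y : ℝ => Real.exp (-(1 - k) * (y - a * T z))) z := by fun_prop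
      exact ((hu.contDiffAt (hU.1.mem_nhds (hT z hz))).comp z h1).mul h2
    refine (hsm.congr_of_eventuallyEq ?_).contDiffWithinAt
    filter_upwards [hnear, hU.isOpen_zImage.mem_nhds hz] with y hy hyI
    exact hwc y _ _ (hT y hyI) hy
  · have hS : 0 < S := hU.2.2.1 _ hx
    have hzm : zVar a S t ∈ zImage a U := ⟨_, hx, rfl⟩
    have e : zVar a S t - a * t = Real.log S := by simp [zVar]
    have hx' : (Real.exp (zVar a S t - a * t), t) ∈ U := by rwa [e, Real.exp_log hS]
    simp only
    rw [hwc _ _ _ (hT _ hzm) hx', hw]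
    simp only
    rw [e, Real.exp_log hS, Real.rpow_def_of_pos hS]
    have : Real.exp (Real.log S * (1 - k)) * Real.exp (-(1 - k) * Real.log S) = 1 := by
      rw [← Real.exp_add]; simp; ring
    linear_combination -(u S t) * this

lemma isInvariantSolution_iff_exists_profile {σ ρ om : ℝ} (hU : IsAdmissible a U) :
    IsInvariantSolution σ ρ (powerLaw om k) (scalingGen a k) U u ↔
      ∃ v : ℝ → ℝ, ContDiffOn ℝ ∞ v (zImage a U) ∧
        SolvesReduced σ a (ρ * om) k (zImage a U) v ∧
        ∀ S t : ℝ, (S, t) ∈ U → u S t = S ^ (1 - k) * v (zVar a S t) := by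
  constructor
  · intro h
    obtain ⟨v, hv, huv⟩ := exists_profile hU h.1.1 h.2
    exact ⟨v, hv, (isInvariantSolution_iff_solvesReduced hU.isOpen_zImage hv hU.1 hU.2.2.1 rfl
      huv).1 h, huv⟩
  · rintro ⟨v, hv, hs, huv⟩
    exact (isInvariantSolution_iff_solvesReduced hU.isOpen_zImage hv hU.1 hU.2.2.1 rfl huv).2 hs

end Reduction

/-! ### First order equations for `v_z` as a function of `v` -/

/-- An injective smooth function with nonvanishing derivative has an open image and a smooth
inverse. -/
lemma contDiffOn_leftInverse {f g : ℝ → ℝ} {s : Set ℝ} (hs : IsOpen s) (hf : ContDiffOn ℝ ∞ f s)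
    (hd : ∀ x ∈ s, deriv f x ≠ 0) (hg : ∀ x ∈ s, g (f x) = x) :
    IsOpen (f '' s) ∧ ContDiffOn ℝ ∞ g (f '' s) := by
  have key : ∀ x ∈ s, f '' s ∈ nhds (f x) ∧ ContDiffAt ℝ ∞ g (f x) := by
    intro x hx
    have hfx : ContDiffAt ℝ ∞ f x := hf.contDiffAt (hs.mem_nhds hx)
    have hder : HasStrictDerivAt f (deriv f x) x := hfx.hasStrictDerivAt (by simp)
    have himg : f '' s ∈ nhds (f x) := by
      rw [← hder.map_nhds_eq (hd x hx)]
      exact Filter.image_mem_map (hs.mem_nhds hx)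
    have hder' := hder.hasStrictFDerivAt_equiv (hd x hx)
    have hl := hfx.to_localInverse (n := ∞) hder'.hasFDerivAt (by simp)
    refine ⟨himg, hl.congr_of_eventuallyEq ?_⟩
    have h1 := hder'.eventually_right_inverse
    have h2 := hder'.localInverse_continuousAt.preimage_mem_nhds
      (by rw [hder'.localInverse_apply_image]; exact hs.mem_nhds hx)
    filter_upwards [h1, h2] with y hy1 hy2
    have := hg _ hy2
    rw [hy1] at this
    exact this
  refine ⟨isOpen_iff_mem_nhds.2 ?_, ?_⟩
  · rintro _ ⟨x, hx, rfl⟩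
    exact (key x hx).1
  · rintro _ ⟨x, hx, rfl⟩
    exact (key x hx).2.contDiffWithinAt

lemma injOn_of_deriv_ne_zero {f : ℝ → ℝ} {s : Set ℝ} (hsc : s.OrdConnected)
    (hf : ContDiffOn ℝ ∞ f s) (hd : ∀ x ∈ s, deriv f x ≠ 0) : InjOn f s := by
  have key : ∀ x ∈ s, ∀ y ∈ s, x < y → f x ≠ f y := by
    intro x hx y hy hxy h
    obtain ⟨c, hc, hc0⟩ := exists_deriv_eq_zero hxy (hf.continuousOn.mono (hsc.out hx hy)) h
    exact hd c (hsc.out hx hy (Ioo_subset_Icc_self hc)) hc0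
  intro x hx y hy h
  rcases lt_trichotomy x y with h1 | h1 | h1
  · exact absurd h (key x hx y hy h1)
  · exact h1
  · exact absurd h.symm (key y hy x hx h1)

lemma div_sq_eq_zero_iff {m b : ℝ} : (1 - b * m ≠ 0 ∧ m / (1 - b * m) ^ 2 = 0) ↔ m = 0 := by
  constructor
  · rintro ⟨h1, h2⟩
    exact (div_eq_zero_iff.1 h2).resolve_right (pow_ne_zero 2 h1)
  · rintro rfl
    simp

lemma solvesReduced_iff_of_deriv_eq_zero {σ a b k : ℝ} (hσ : σ ≠ 0) {I : Set ℝ} {v : ℝ → ℝ}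
    (hI : IsOpen I) (h0 : ∀ z ∈ I, deriv v z = 0) :
    SolvesReduced σ a b k I v ↔ ∀ z ∈ I, k * (1 - k) * v z = 0 := by
  have hm : ∀ z ∈ I, secondOrderPart k v z = -(k * (1 - k) * v z) := by
    intro z hz
    have : deriv (deriv v) z = 0 := by
      refine (Filter.EventuallyEq.deriv_eq (f := fun _ => 0)
        (Filter.eventually_of_mem (hI.mem_nhds hz) h0)).trans (deriv_const z 0)
    rw [secondOrderPart, this, h0 z hz]
    ring
  refine forall₂_congr fun z hz => ?_
  rw [h0 z hz, mul_zero, zero_add, mul_eq_zero, or_iff_right (by positivity), div_sq_eq_zero_iff,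
    hm z hz, neg_eq_zero]

/-- The reduced equation is quadratic in `m`; solving it for `m = v_zz + ...` gives the two first
order equations. -/
lemma quadratic_iff_firstOrderRhs {σ a b : ℝ} (k : ℝ) (hσ : σ ≠ 0) (ha : a ≠ 0) (hb : b ≠ 0)
    {x : ℝ} (hx : x ≠ 0) (v x' : ℝ) {m : ℝ}
    (hm : m = x' * x + (1 - 2 * k) * x - k * (1 - k) * v) :
    (1 - b * m ≠ 0 ∧ a * x + σ ^ 2 / 2 * (m / (1 - b * m) ^ 2) = 0) ↔
      0 ≤ σ ^ 2 - 8 * a * b * x ∧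
        (x' = firstOrderRhs σ a b k (-1) v x ∨ x' = firstOrderRhs σ a b k 1 v x) := by
  have h1 : (1 - b * m ≠ 0 ∧ a * x + σ ^ 2 / 2 * (m / (1 - b * m) ^ 2) = 0) ↔
      a * x * (1 - b * m) ^ 2 + σ ^ 2 / 2 * m = 0 := by
    constructor
    · rintro ⟨hne, h⟩
      generalize 1 - b * m = D at *
      field_simp at h
      linear_combination h / 2
    · intro h
      have hne : 1 - b * m ≠ 0 := by
        intro h0
        rw [h0] at h
        have hm0 : m = 0 := by simpa [hσ] using h
        rw [hm0] at h0
        simp at h0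
      refine ⟨hne, ?_⟩
      generalize 1 - b * m = D at *
      field_simp
      linear_combination 2 * h
  have h2 : a * x * (1 - b * m) ^ 2 + σ ^ 2 / 2 * m = 0 ↔
      (4 * a * b ^ 2 * x * m + (σ ^ 2 - 4 * a * b * x)) ^ 2 = σ ^ 2 * (σ ^ 2 - 8 * a * b * x) := by
    have hne : 16 * a * b ^ 2 * x ≠ 0 := by positivity
    rw [← mul_right_inj' (a := 16 * a * b ^ 2 * x)
      (b := a * x * (1 - b * m) ^ 2 + σ ^ 2 / 2 * m) hne, mul_zero, ← sub_eq_zero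
      (a := (4 * a * b ^ 2 * x * m + (σ ^ 2 - 4 * a * b * x)) ^ 2)]
    refine Eq.congr ?_ rfl
    ring
  have h3 : ∀ s : ℝ, x' = firstOrderRhs σ a b k s v x ↔
      4 * a * b ^ 2 * x * m + (σ ^ 2 - 4 * a * b * x) = s * √(σ ^ 2 * (σ ^ 2 - 8 * a * b * x)) := by
    intro s
    have hne : 4 * a * b ^ 2 * x ^ 2 ≠ 0 := by positivity
    rw [← mul_right_inj' (a := 4 * a * b ^ 2 * x ^ 2) (b := x') hne, firstOrderRhs, hm,
      ← sub_eq_zero, ← sub_eq_zero (b := s * _)]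
    refine Eq.congr ?_ rfl
    field_simp
    ring
  rw [h1, h2, h3, h3]
  have hs2 : 0 < σ ^ 2 := by positivity
  constructor
  · intro h
    have hnn : 0 ≤ σ ^ 2 - 8 * a * b * x := by
      have := h ▸ sq_nonneg (4 * a * b ^ 2 * x * m + (σ ^ 2 - 4 * a * b * x))
      exact nonneg_of_mul_nonneg_right this hs2
    refine ⟨hnn, ?_⟩
    rw [← Real.sq_sqrt (mul_nonneg hs2.le hnn)] at h
    rcases sq_eq_sq_iff_eq_or_eq_neg.1 h with h | h
    · right; rw [h, one_mul]
    · left; rw [h, neg_one_mul]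
  · rintro ⟨hnn, h | h⟩ <;> rw [h, mul_pow, Real.sq_sqrt (mul_nonneg hs2.le hnn)] <;> ring

/-- A solution without critical points is monotone, so `v_z` is a smooth function `x` of `v`, and
`v_zz = x x_v`. -/
lemma exists_firstOrder {σ a b k : ℝ} (hσ : σ ≠ 0) (ha : a ≠ 0) (hb : b ≠ 0) {I : Set ℝ}
    {v : ℝ → ℝ} (hI : IsOpen I) (hIc : I.OrdConnected) (hv : ContDiffOn ℝ ∞ v I)
    (h0 : ∀ z ∈ I, deriv v z ≠ 0) :
    ∃ x : ℝ → ℝ, ContDiffOn ℝ ∞ x (v '' I) ∧ (∀ z ∈ I, deriv v z = x (v z)) ∧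
      (SolvesReduced σ a b k I v ↔
        ∀ w ∈ v '' I, 0 ≤ σ ^ 2 - 8 * a * b * x w ∧
          (deriv x w = firstOrderRhs σ a b k (-1) w (x w) ∨
           deriv x w = firstOrderRhs σ a b k 1 w (x w))) := by
  have hinj := injOn_of_deriv_ne_zero hIc hv h0
  have hg : ∀ z ∈ I, Function.invFunOn v I (v z) = z := fun z hz => hinj.leftInvOn_invFunOn hz
  obtain ⟨hopen, hgs⟩ := contDiffOn_leftInverse hI hv h0 hg
  have hxv : ∀ z ∈ I, deriv v z = (deriv v ∘ Function.invFunOn v I) (v z) := fun z hz => by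
    rw [Function.comp, hg z hz]
  have hxs : ContDiffOn ℝ ∞ (deriv v ∘ Function.invFunOn v I) (v '' I) := by
    refine (contDiffOn_deriv hI hv).comp hgs ?_
    rintro _ ⟨z, hz, rfl⟩
    rwa [hg z hz]
  refine ⟨_, hxs, hxv, ?_⟩
  generalize deriv v ∘ Function.invFunOn v I = x at *
  rw [SolvesReduced, forall_mem_image]
  refine forall₂_congr fun z hz => ?_
  have hch : deriv (deriv v) z = deriv x (v z) * deriv v z := by
    rw [Filter.EventuallyEq.deriv_eq (Filter.eventually_of_mem (hI.mem_nhds hz) hxv)]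
    exact ((hasDerivAt_of_contDiffOn hopen hxs ⟨z, hz, rfl⟩).comp z
      (hasDerivAt_of_contDiffOn hI hv hz)).deriv
  have hx0 := h0 z hz
  rw [hxv z hz] at hx0
  have := quadratic_iff_firstOrderRhs k hσ ha hb hx0 (v z) (deriv x (v z))
    (m := secondOrderPart k v z) (by rw [secondOrderPart, hch, hxv z hz])
  rwa [← hxv z hz] at this ⊢

/-- The only term of the right-hand side that contains `v` is `k (1 - k) v / x`. -/
lemma rhsIsAutonomous_iff {σ a b k : ℝ} (s : ℝ) (ha : a ≠ 0) (hb : b ≠ 0) :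
    RhsIsAutonomous σ a b k s ↔ k = 0 ∨ k = 1 := by
  constructor
  · intro h
    -- for `x = -(a b)` the radicand is positive whatever the signs of `a` and `b`
    have := h (-(a * b)) 0 1 (by simp [ha, hb]) (by nlinarith [sq_nonneg (a * b), sq_nonneg σ])
    simp only [firstOrderRhs] at this
    have h2 : k * (1 - k) * 1 / (-(a * b)) = 0 := by
      linear_combination -this
    rw [div_eq_zero_iff] at h2
    rcases h2 with h2 | h2
    · rw [mul_one] at h2
      rcases mul_eq_zero.1 h2 with h3 | h3
      · exact Or.inl h3
      · exact Or.inr (by linarith)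
    · simp [ha, hb] at h2
  · rintro (rfl | rfl) x v w _ _ <;> simp [firstOrderRhs]

/-! ### The case `k = 1`: the parameter `P` -/

/-- The reduced equation for `k = 1` at one point, in terms of `y = b v_z` and `y' = b v_zz`. -/
def ReducedAt (q y y' : ℝ) : Prop :=
  1 - (y' - y) ≠ 0 ∧ y * (1 - (y' - y)) ^ 2 + q * (y' - y) = 0

lemma solvesReduced_one_iff {σ a b : ℝ} (ha : a ≠ 0) (hb : b ≠ 0) (I : Set ℝ) (v : ℝ → ℝ) :
    SolvesReduced σ a b 1 I v ↔
      ∀ z ∈ I, ReducedAt (σ ^ 2 / (2 * a)) (b * deriv v z) (b * deriv (deriv v) z) := by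
  refine forall₂_congr fun z _ => ?_
  have h1 : b * secondOrderPart 1 v z = b * deriv (deriv v) z - b * deriv v z := by
    rw [secondOrderPart]; ring
  have h2 : secondOrderPart 1 v z = (b * deriv (deriv v) z - b * deriv v z) / b := by
    rw [← h1]; field_simp
  rw [ReducedAt, h1, h2]
  generalize b * deriv (deriv v) z - b * deriv v z = M
  refine and_congr_right fun hM => ?_
  generalize 1 - M = D at *
  have e : (2 * b * D ^ 2) * (a * deriv v z + σ ^ 2 / 2 * (M / b / D ^ 2))
      = 2 * a * (b * deriv v z * D ^ 2 + σ ^ 2 / (2 * a) * M) := by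
    field_simp
  constructor
  · intro h
    rw [h, mul_zero] at e
    exact (mul_eq_zero.1 e.symm).resolve_left (by positivity)
  · intro h
    rw [h, mul_zero] at e
    exact (mul_eq_zero.1 e).resolve_left (by positivity)

/-- With `y = q (1 - P²) / 4` the reduced equation becomes an equation linear in `P'`. -/
lemma reducedAt_of_ode {q P P' y y' : ℝ} (hP : P + 1 ≠ 0) (hy : y = q * (1 - P ^ 2) / 4)
    (hy' : y' = -(q * P * P' / 2))
    (ode : 2 * q * P * P' * (P + 1) = (P - 1) * (q * (P + 1) ^ 2 - 4)) : ReducedAt q y y' := by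
  have hM : y' - y = (P - 1) / (P + 1) := by
    rw [eq_div_iff hP, hy, hy']
    linear_combination -1 / 4 * ode
  have hD : 1 - (P - 1) / (P + 1) = 2 / (P + 1) := by field_simp; ring
  rw [ReducedAt, hM, hD, hy]
  refine ⟨by positivity, ?_⟩
  field_simp
  ring

/-- The parameter `P = (1 + M) / (1 - M)`, `M = b (v_zz - v_z)`, turns a solution of the reduced
equation with `k = 1` into a smooth solution of a first order equation. In contrast with
`p = |P|` it passes smoothly through zero. -/
lemma exists_param {q b : ℝ} {I : Set ℝ} {v : ℝ → ℝ} (hI : IsOpen I) (hv : ContDiffOn ℝ ∞ v I)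
    (h : ∀ z ∈ I, ReducedAt q (b * deriv v z) (b * deriv (deriv v) z)) :
    ∃ P : ℝ → ℝ, ContDiffOn ℝ ∞ P I ∧ ∀ z ∈ I, P z + 1 ≠ 0 ∧
      b * deriv v z = q * (1 - P z ^ 2) / 4 ∧
      2 * q * P z * deriv P z * (P z + 1) = (P z - 1) * (q * (P z + 1) ^ 2 - 4) := by
  obtain ⟨M, hM⟩ : ∃ M : ℝ → ℝ, M = fun z => b * deriv (deriv v) z - b * deriv v z := ⟨_, rfl⟩
  have hMz : ∀ z, b * deriv (deriv v) z - b * deriv v z = M z := fun z => by rw [hM]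
  have hv1 := contDiffOn_deriv hI hv
  have hv2 := contDiffOn_deriv hI hv1
  have hMs : ContDiffOn ℝ ∞ M I := by
    rw [hM]
    exact (contDiffOn_const.mul hv2).sub (contDiffOn_const.mul hv1)
  simp only [ReducedAt, hMz] at h
  have hPs : ContDiffOn ℝ ∞ (fun z => (1 + M z) / (1 - M z)) I :=
    (contDiffOn_const.add hMs).div (contDiffOn_const.sub hMs) fun z hz => (h z hz).1
  have hP1 : ∀ z ∈ I, (1 + M z) / (1 - M z) + 1 = 2 / (1 - M z) := fun z hz => by
    have := (h z hz).1
    field_simp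
    ring
  have hy : ∀ z ∈ I, b * deriv v z = q * (1 - ((1 + M z) / (1 - M z)) ^ 2) / 4 := fun z hz => by
    obtain ⟨h1, h2⟩ := h z hz
    field_simp
    linear_combination 4 * h2
  refine ⟨_, hPs, fun z hz => ⟨?_, hy z hz, ?_⟩⟩
  · rw [hP1 z hz]
    exact div_ne_zero two_ne_zero (h z hz).1
  · have hMP : M z * ((1 + M z) / (1 - M z) + 1) = (1 + M z) / (1 - M z) - 1 := by
      have := (h z hz).1
      field_simp
      ring
    generalize hP : (fun z => (1 + M z) / (1 - M z)) = P at *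
    have hPz : ∀ z, (1 + M z) / (1 - M z) = P z := fun z => by rw [← hP]
    simp only [hPz] at *
    have hPd := hasDerivAt_of_contDiffOn hI hPs hz
    have hd := (((hPd.pow 2).const_sub 1).const_mul q).div_const 4
    have hd2 := (hasDerivAt_of_contDiffOn hI hv1 hz).const_mul b
    have hu := hd2.unique (hd.congr_of_eventuallyEq
      (Filter.eventually_of_mem (hI.mem_nhds hz) hy))
    have h3 := hMz z
    rw [hy z hz, hu] at h3
    norm_num at h3
    linear_combination (-4 * (P z + 1)) * h3 - 4 * hMP

/-- A solution of a linear homogeneous equation vanishes identically or nowhere. -/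
lemma eq_zero_or_ne_zero_of_linear {w g : ℝ → ℝ} {I : Set ℝ} (hI : IsOpen I) (hIc : I.OrdConnected)
    (hg : ContinuousOn g I) (hw : ∀ z ∈ I, HasDerivAt w (g z * w z) z) :
    (∀ z ∈ I, w z = 0) ∨ ∀ z ∈ I, w z ≠ 0 := by
  by_contra! hcon
  obtain ⟨⟨z₁, hz₁, h₁⟩, z₀, hz₀, h₀⟩ := hcon
  have hG : ∀ z ∈ I, HasDerivAt (fun y => ∫ r in z₀..y, g r) (g z) z := fun z hz =>
    intervalIntegral.integral_hasDerivAt_right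
      ((hg.mono (hIc.uIcc_subset hz₀ hz)).intervalIntegrable)
      (hg.stronglyMeasurableAtFilter hI z hz) (hg.continuousAt (hI.mem_nhds hz))
  have := eq_of_hasDerivAt_zero (f := fun z => w z * Real.exp (-∫ r in z₀..z, g r)) hIc
    (fun z hz => ((hw z hz).mul (hG z hz).neg.exp).congr_deriv (by ring)) hz₁ hz₀
  simp [h₀, h₁, Real.exp_ne_zero] at this

lemma pos_or_neg_of_ne_zero {f : ℝ → ℝ} {I : Set ℝ} (hIc : I.OrdConnected)
    (hf : ContinuousOn f I) (h0 : ∀ z ∈ I, f z ≠ 0) :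
    (∀ z ∈ I, 0 < f z) ∨ ∀ z ∈ I, f z < 0 := by
  by_contra! hcon
  obtain ⟨⟨z₁, hz₁, h₁⟩, z₂, hz₂, h₂⟩ := hcon
  obtain ⟨z, hz, hz0⟩ := hIc.isPreconnected.intermediate_value hz₁ hz₂ hf ⟨h₁, h₂⟩
  exact h0 z hz hz0

/-! ### The implicit equations -/

/-- The left-hand side of the implicit equation on the first sheet. -/
def sheetFun (q P : ℝ) : ℝ :=
  if q = 1 then 1 / (1 - P) + 1 / 4 * Real.log ((P + 3) ^ 3 * (P - 1) ^ 5)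
  else if 0 < q then
    2 * q * Real.log (P - 1) + (q - √q - 2) * Real.log ((P + 1) * √q - 2)
      + (q + √q - 2) * Real.log ((P + 1) * √q + 2)
  else
    2 * √(-q) * Real.arctan ((P + 1) * √(-q) / 2) - 2 * q * Real.log (P - 1)
      + (2 - q) * Real.log (4 - q * (P + 1) ^ 2)

/-- The coefficient of `z` in the implicit equation. -/
def sheetSlope (q : ℝ) : ℝ :=
  if q = 1 then 1 else if 0 < q then 2 * (q - 1) else 2 * (1 - q)

/-- The values of `P` at which the implicit equation on the first sheet is defined. -/
def SheetDomain (q P : ℝ) : Prop :=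
  P ≠ 1 ∧ (0 < q → (q ≠ 4 → (P + 1) * √q - 2 ≠ 0) ∧ (P + 1) * √q + 2 ≠ 0)

lemma sheetSlope_ne_zero {q : ℝ} : sheetSlope q ≠ 0 := by
  unfold sheetSlope
  split_ifs with h1 h2
  · exact one_ne_zero
  · exact mul_ne_zero two_ne_zero (sub_ne_zero.2 h1)
  · exact mul_ne_zero two_ne_zero (sub_ne_zero.2 (Ne.symm h1))

lemma sheetMinus_iff {q : ℝ} (hq : q ≠ 0) (c p z : ℝ) :
    SheetMinus q c p z ↔ SheetDomain q p ∧ sheetFun q p = sheetSlope q * z + c := by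
  unfold SheetMinus SheetDomain sheetFun sheetSlope
  by_cases h1 : q = 1
  · subst h1
    simp only [if_true, Real.sqrt_one]
    constructor
    · rintro ⟨hp, h | h | h⟩
      · exact absurd rfl h.2.1
      · refine ⟨⟨hp, fun _ => ⟨fun _ h2 => hp (by linarith), fun h2 => h.2.1 (by linarith)⟩⟩, ?_⟩
        rw [one_mul]; exact h.2.2
      · norm_num at h
    · rintro ⟨⟨hp, h⟩, h2⟩
      refine ⟨hp, Or.inr (Or.inl ⟨trivial, fun h3 => (h one_pos).2 (by linarith), ?_⟩)⟩
      rw [one_mul] at h2; exact h2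
  · simp only [h1, if_false]
    by_cases h0 : 0 < q
    · simp only [h0, if_true, not_lt.2 h0.le]
      tauto
    · have h0' : q < 0 := lt_of_le_of_ne (not_lt.1 h0) hq
      simp only [h0, h0', if_false]
      tauto

/-- The second sheet is the first one at `P = -p`. -/
lemma sheetPlus_iff {q : ℝ} (hq : q ≠ 0) (c p z : ℝ) :
    SheetPlus q c p z ↔ SheetDomain q (-p) ∧ sheetFun q (-p) = sheetSlope q * z + c := by
  rw [← sheetMinus_iff hq]
  unfold SheetPlus SheetMinus
  have e1 : Real.log (-p - 1) = Real.log (p + 1) := by rw [← Real.log_neg_eq_log]; ring_nf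
  have e2 : Real.log ((-p + 1) * √q - 2) = Real.log ((p - 1) * √q + 2) := by
    rw [← Real.log_neg_eq_log]; ring_nf
  have e3 : Real.log ((-p + 1) * √q + 2) = Real.log ((p - 1) * √q - 2) := by
    rw [← Real.log_neg_eq_log]; ring_nf
  have e4 : Real.arctan ((-p + 1) * √(-q) / 2) = -Real.arctan ((p - 1) * √(-q) / 2) := by
    rw [← Real.arctan_neg]; ring_nf
  have e5 : (-p + 3) ^ 3 * (-p - 1) ^ 5 = (p - 3) ^ 3 * (p + 1) ^ 5 := by ring
  have e6 : (-p + 1) ^ 2 = (p - 1) ^ 2 := by ring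
  have n1 : -p ≠ 1 ↔ p ≠ -1 := by rw [Ne, Ne, neg_eq_iff_eq_neg]
  have n2 : (-p + 1) * √q - 2 ≠ 0 ↔ (p - 1) * √q + 2 ≠ 0 := by
    rw [Ne, Ne, ← neg_eq_zero]; ring_nf
  have n3 : (-p + 1) * √q + 2 ≠ 0 ↔ (p - 1) * √q - 2 ≠ 0 := by
    rw [Ne, Ne, ← neg_eq_zero]; ring_nf
  have n4 : -p + 3 ≠ 0 ↔ p - 3 ≠ 0 := by
    rw [Ne, Ne, ← neg_eq_zero]; ring_nf
  have s1 : 2 * q * Real.log (p + 1) + (q + √q - 2) * Real.log ((p - 1) * √q - 2)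
        + (q - √q - 2) * Real.log ((p - 1) * √q + 2) = 2 * q * Real.log (p + 1)
        + (q - √q - 2) * Real.log ((p - 1) * √q + 2)
        + (q + √q - 2) * Real.log ((p - 1) * √q - 2) := by ring
  have s2 : 1 / (p + 1) = 1 / (1 - -p) := by ring_nf
  have s3 : 2 * √(-q) * -Real.arctan ((p - 1) * √(-q) / 2) =
    -(2 * √(-q) * Real.arctan ((p - 1) * √(-q) / 2)) := by ring
  rw [e1, e2, e3, e4, e5, e6, n1, n2, n3, n4, s1, s2, s3, add_comm 1 p]
  exact and_congr_right fun _ => or_congr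
    ⟨fun ⟨a, b, c, d, e⟩ => ⟨a, b, d, c, e⟩, fun ⟨a, b, c, d, e⟩ => ⟨a, b, d, c, e⟩⟩ Iff.rfl

/-- Separation of variables: `sheetFun q / sheetSlope q` is a primitive of
`2 q P (P + 1) / ((P - 1) (q (P + 1)² - 4))`. -/
lemma hasDerivAt_sheetFun {q P : ℝ} (hq : q ≠ 0) (hq4 : q ≠ 4) (h : SheetDomain q P) :
    HasDerivAt (sheetFun q)
      (sheetSlope q * (2 * q * P * (P + 1) / ((P - 1) * (q * (P + 1) ^ 2 - 4)))) P := by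
  obtain ⟨hP, h⟩ := h
  have hP1 : P - 1 ≠ 0 := sub_ne_zero.2 hP
  have hid := hasDerivAt_id P
  unfold sheetFun sheetSlope
  by_cases h1 : q = 1
  · subst h1
    simp only [if_true]
    have h3 : P + 3 ≠ 0 := fun h3 => (h one_pos).2 (by rw [Real.sqrt_one]; linarith)
    have hP1' : 1 - P ≠ 0 := sub_ne_zero.2 (Ne.symm hP)
    have hd := ((hid.const_sub 1).fun_inv hP1').add (((((hid.add_const 3).pow 3).mul
      ((hid.sub_const 1).pow 5)).log
        (mul_ne_zero (pow_ne_zero 3 h3) (pow_ne_zero 5 hP1))).const_mul (1 / 4))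
    simp only [one_div] at hd ⊢
    refine hd.congr_deriv ?_
    have e : (1 : ℝ) * (P + 1) ^ 2 - 4 = (P - 1) * (P + 3) := by ring
    have e' : (1 - P) ^ 2 = (P - 1) ^ 2 := by ring
    rw [e]
    simp only [id, Pi.mul_apply, Pi.pow_apply]
    rw [e']
    norm_num
    field_simp
    ring
  · simp only [h1, if_false]
    by_cases h0 : 0 < q
    · simp only [h0, if_true]
      obtain ⟨hA, hB⟩ := h h0
      have hA := hA hq4
      obtain ⟨s, hs⟩ : ∃ s, s = √q := ⟨_, rfl⟩
      have hsq : q = s ^ 2 := by rw [hs, Real.sq_sqrt h0.le]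
      rw [← hs] at hA hB ⊢
      have hd := ((((hid.sub_const 1).log hP1).const_mul (2 * q)).add
        (((((hid.add_const 1).mul_const s).sub_const 2).log hA).const_mul (q - s - 2))).add
        (((((hid.add_const 1).mul_const s).add_const 2).log hB).const_mul (q + s - 2))
      refine hd.congr_deriv ?_
      have e : q * (P + 1) ^ 2 - 4 = ((P + 1) * s - 2) * ((P + 1) * s + 2) := by rw [hsq]; ring
      rw [e, hsq]
      simp only [id]
      generalize hA' : (P + 1) * s - 2 = A at *
      generalize hB' : (P + 1) * s + 2 = B at *
      field_simp
      rw [← hA', ← hB']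
      ring
    · have h0' : 0 < -q := by
        have := lt_of_le_of_ne (not_lt.1 h0) hq
        linarith
      simp only [h0, if_false]
      obtain ⟨s, hs⟩ : ∃ s, s = √(-q) := ⟨_, rfl⟩
      have hsq : q = -s ^ 2 := by rw [hs, Real.sq_sqrt h0'.le]; ring
      have hne : 4 - q * (P + 1) ^ 2 ≠ 0 := by
        have := mul_nonneg h0'.le (sq_nonneg (P + 1))
        exact ne_of_gt (by linarith)
      rw [← hs]
      have hd := ((((((hid.add_const 1).mul_const s).div_const 2).arctan.const_mul (2 * s))).sub
        (((hid.sub_const 1).log hP1).const_mul (2 * q))).add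
        ((((((hid.add_const 1).pow 2).const_mul q).const_sub 4).log hne).const_mul (2 - q))
      refine hd.congr_deriv ?_
      have e : q * (P + 1) ^ 2 - 4 = -(4 - q * (P + 1) ^ 2) := by ring
      have e2 : 1 + ((P + 1) * s / 2) ^ 2 = (4 - q * (P + 1) ^ 2) / 4 := by rw [hsq]; ring
      rw [e]
      simp only [id, Pi.pow_apply]
      rw [e2]
      generalize hX : 4 - q * (P + 1) ^ 2 = X at *
      norm_num
      field_simp
      rw [← hX, hsq]
      ring

/-! ### From the reduced equation to the implicit equations -/

section FirstOrder

variable {q b : ℝ} {I : Set ℝ} {v P : ℝ → ℝ}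

lemma one_sub_eq_sq {x p : ℝ} (hq : q ≠ 0) (h : b * x = q * (1 - p ^ 2) / 4) :
    1 - 4 * b / q * x = p ^ 2 := by
  field_simp
  linear_combination -4 * h

lemma sheetPlus_iff_sheetMinus_neg (hq : q ≠ 0) (c p z : ℝ) :
    SheetPlus q c p z ↔ SheetMinus q c (-p) z := by
  rw [sheetPlus_iff hq, sheetMinus_iff hq]

/-- For `q ≠ 4` the parameter `P` cannot vanish, so it stays on one sheet. -/
lemma solvesFirstOrder_of_param (hb : b ≠ 0) (hq : q ≠ 0) (hq4 : q ≠ 4) (hI : IsOpen I)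
    (hIc : I.OrdConnected) (hPs : ContDiffOn ℝ ∞ P I)
    (hP : ∀ z ∈ I, P z + 1 ≠ 0 ∧ b * deriv v z = q * (1 - P z ^ 2) / 4 ∧
      2 * q * P z * deriv P z * (P z + 1) = (P z - 1) * (q * (P z + 1) ^ 2 - 4)) :
    SolvesFirstOrder q b I v := by
  have hP0 : ∀ z ∈ I, P z ≠ 0 := by
    intro z hz h0
    have := (hP z hz).2.2
    rw [h0] at this
    exact hq4 (by linarith)
  have hder : ∀ z ∈ I, HasDerivAt P
      ((P z - 1) * (q * (P z + 1) ^ 2 - 4) / (2 * q * P z * (P z + 1))) z := fun z hz => by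
    refine (hasDerivAt_of_contDiffOn hI hPs hz).congr_deriv ?_
    have h0 := hP0 z hz
    have h1 := (hP z hz).1
    rw [eq_div_iff (by positivity)]
    linear_combination (hP z hz).2.2
  have hc := hPs.continuousOn
  have hden : ∀ z ∈ I, 2 * q * P z * (P z + 1) ≠ 0 := fun z hz => by
    have h0 := hP0 z hz
    have h1 := (hP z hz).1
    positivity
  -- a zero of a factor of the right-hand side forces that factor to vanish identically
  have h1 : (∀ z ∈ I, P z - 1 = 0) ∨ ∀ z ∈ I, P z - 1 ≠ 0 :=
    eq_zero_or_ne_zero_of_linear hI hIc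
      (g := fun z => (q * (P z + 1) ^ 2 - 4) / (2 * q * P z * (P z + 1)))
      (ContinuousOn.div (by fun_prop) (by fun_prop) hden)
      fun z hz => ((hder z hz).sub_const 1).congr_deriv (by ring)
  rcases h1 with h1 | h1
  · left
    intro z hz
    have h2 := (hP z hz).2.1
    rw [sub_eq_zero.1 (h1 z hz)] at h2
    simpa [hb] using h2
  have hA : 0 < q → (∀ z ∈ I, (P z + 1) * √q - 2 = 0) ∨ ∀ z ∈ I, (P z + 1) * √q - 2 ≠ 0 :=
    fun h0 => eq_zero_or_ne_zero_of_linear hI hIc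
      (g := fun z => (P z - 1) * √q * ((P z + 1) * √q + 2) / (2 * q * P z * (P z + 1)))
      (ContinuousOn.div (by fun_prop) (by fun_prop) hden)
      fun z hz => (((hder z hz).add_const 1).mul_const √q |>.sub_const 2).congr_deriv (by
        have e : q * (P z + 1) ^ 2 - 4 = ((P z + 1) * √q - 2) * ((P z + 1) * √q + 2) := by
          linear_combination (-(P z + 1) ^ 2) * Real.sq_sqrt h0.le
        rw [e]; ring)
  have hB : 0 < q → (∀ z ∈ I, (P z + 1) * √q + 2 = 0) ∨ ∀ z ∈ I, (P z + 1) * √q + 2 ≠ 0 :=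
    fun h0 => eq_zero_or_ne_zero_of_linear hI hIc
      (g := fun z => (P z - 1) * √q * ((P z + 1) * √q - 2) / (2 * q * P z * (P z + 1)))
      (ContinuousOn.div (by fun_prop) (by fun_prop) hden)
      fun z hz => (((hder z hz).add_const 1).mul_const √q |>.add_const 2).congr_deriv (by
        have e : q * (P z + 1) ^ 2 - 4 = ((P z + 1) * √q - 2) * ((P z + 1) * √q + 2) := by
          linear_combination (-(P z + 1) ^ 2) * Real.sq_sqrt h0.le
        rw [e]; ring)
  by_cases hA0 : 0 < q ∧ ∀ z ∈ I, (P z + 1) * √q - 2 = 0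
  · right; left
    refine ⟨hA0.1, fun z hz => ?_⟩
    rw [eq_div_iff hb]
    linear_combination (hP z hz).2.1 + (P z - 1) / 4 * (P z + 1) * Real.sq_sqrt hA0.1.le
      + ((1 - P z) * √q / 4 - 1 / 2) * hA0.2 z hz
  by_cases hB0 : 0 < q ∧ ∀ z ∈ I, (P z + 1) * √q + 2 = 0
  · right; right; left
    refine ⟨hB0.1, fun z hz => ?_⟩
    rw [eq_div_iff hb]
    linear_combination (hP z hz).2.1 + (P z - 1) / 4 * (P z + 1) * Real.sq_sqrt hB0.1.le
      + ((1 - P z) * √q / 4 + 1 / 2) * hB0.2 z hz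
  right; right; right
  have hdom : ∀ z ∈ I, SheetDomain q (P z) := fun z hz => by
    refine ⟨sub_ne_zero.1 (h1 z hz), fun h0 => ⟨fun _ => ?_, ?_⟩⟩
    · exact ((hA h0).resolve_left fun h => hA0 ⟨h0, h⟩) z hz
    · exact ((hB h0).resolve_left fun h => hB0 ⟨h0, h⟩) z hz
  have hsq : ∀ z ∈ I, 1 - 4 * b / q * deriv v z = P z ^ 2 := fun z hz =>
    one_sub_eq_sq hq (hP z hz).2.1
  have hpv : ∀ z ∈ I, pVar q b v z = |P z| := fun z hz => by
    rw [pVar, hsq z hz, Real.sqrt_sq_eq_abs]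
  refine ⟨fun z hz => by rw [hsq z hz]; positivity, ?_⟩
  have hconst : ∃ c, ∀ z ∈ I, sheetFun q (P z) = sheetSlope q * z + c := by
    rcases I.eq_empty_or_nonempty with rfl | ⟨z₀, hz₀⟩
    · exact ⟨0, fun z hz => hz.elim⟩
    refine ⟨sheetFun q (P z₀) - sheetSlope q * z₀, fun z hz => ?_⟩
    have := eq_of_hasDerivAt_zero (f := fun z => sheetFun q (P z) - sheetSlope q * z) hIc
      (fun z hz => by
        have hd := ((hasDerivAt_sheetFun hq hq4 (hdom z hz)).comp z (hder z hz)).sub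
          ((hasDerivAt_id z).const_mul (sheetSlope q))
        refine hd.congr_deriv ?_
        have h2 := hden z hz
        have h3 : (P z - 1) * (q * (P z + 1) ^ 2 - 4) ≠ 0 := by
          refine mul_ne_zero (h1 z hz) ?_
          rcases lt_or_gt_of_ne hq with h0 | h0
          · have := mul_nonneg (neg_nonneg.2 h0.le) (sq_nonneg (P z + 1))
            exact ne_of_lt (by linarith)
          · have e : q * (P z + 1) ^ 2 - 4 = ((P z + 1) * √q - 2) * ((P z + 1) * √q + 2) := by
              linear_combination (-(P z + 1) ^ 2) * Real.sq_sqrt h0.le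
            rw [e]
            exact mul_ne_zero (((hdom z hz).2 h0).1 hq4) ((hdom z hz).2 h0).2
        rw [mul_assoc, div_mul_div_cancel₀ h3, div_self h2, mul_one, sub_self]) hz hz₀
    linarith
  obtain ⟨c, hc⟩ := hconst
  refine ⟨c, ?_⟩
  rcases pos_or_neg_of_ne_zero hIc hPs.continuousOn hP0 with hpos | hneg
  · left
    intro z hz
    rw [hpv z hz, abs_of_pos (hpos z hz), sheetMinus_iff hq]
    exact ⟨hdom z hz, hc z hz⟩
  · right; left
    intro z hz
    rw [hpv z hz, abs_of_neg (hneg z hz), sheetPlus_iff hq, neg_neg]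
    exact ⟨hdom z hz, hc z hz⟩

/-- For `q = 4` the equation for `P` has the factor `P`. A solution cannot switch from `P = 0` to a
zero of the other factor: `F = 2 (P + 1) P' - (P - 1) (P + 2)` is continuous and takes only the
values `0` and `2`. -/
lemma eq_zero_or_ode_of_four (hI : IsOpen I) (hIc : I.OrdConnected) (hPs : ContDiffOn ℝ ∞ P I)
    (hP : ∀ z ∈ I,
      2 * 4 * P z * deriv P z * (P z + 1) = (P z - 1) * (4 * (P z + 1) ^ 2 - 4)) :
    (∀ z ∈ I, P z = 0) ∨ ∀ z ∈ I, 2 * (P z + 1) * deriv P z = (P z - 1) * (P z + 2) := by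
  obtain ⟨F, hF⟩ : ∃ F : ℝ → ℝ, F = fun z => 2 * (P z + 1) * deriv P z - (P z - 1) * (P z + 2) :=
    ⟨_, rfl⟩
  have hPc := hPs.continuousOn
  have hPc' := (contDiffOn_deriv hI hPs).continuousOn
  have hFc : ContinuousOn F I := by rw [hF]; fun_prop
  have hPF : ∀ z ∈ I, F z ≠ 0 → P z = 0 := by
    intro z hz h0
    have : P z * F z = 0 := by
      rw [hF]; linear_combination 1 / 4 * hP z hz
    exact (mul_eq_zero.1 this).resolve_right h0
  have hF2 : ∀ z ∈ I, F z ≠ 0 → P z = 0 ∧ F z = 2 := by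
    intro z hz h0
    have hev : P =ᶠ[nhds z] fun _ => 0 := by
      filter_upwards [(hFc.continuousAt (hI.mem_nhds hz)).eventually_ne h0, hI.mem_nhds hz]
        with y hy hyI using hPF y hyI hy
    have hd : deriv P z = 0 := hev.deriv_eq.trans (deriv_const z 0)
    have hz0 := hPF z hz h0
    refine ⟨hz0, ?_⟩
    rw [hF]
    simp only [hd, hz0]
    norm_num
  by_contra! hcon
  obtain ⟨⟨z₁, hz₁, h₁⟩, z₂, hz₂, h₂⟩ := hcon
  have e1 : F z₁ = 0 := by
    by_contra h
    exact h₁ (hPF z₁ hz₁ h)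
  have e2 : F z₂ = 2 := (hF2 z₂ hz₂ (by rw [hF]; exact sub_ne_zero.2 h₂)).2
  obtain ⟨z, hz, hz1⟩ := hIc.isPreconnected.intermediate_value hz₁ hz₂ hFc
    (show (1 : ℝ) ∈ Icc (F z₁) (F z₂) by rw [e1, e2]; norm_num)
  have := (hF2 z hz (by rw [hz1]; norm_num)).2
  linarith

/-- The integrals of the equation for `P` in the case `q = 4`. -/
lemma four_cases (hI : IsOpen I) (hIc : I.OrdConnected) (hPs : ContDiffOn ℝ ∞ P I)
    (hP : ∀ z ∈ I, P z + 1 ≠ 0 ∧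
      2 * 4 * P z * deriv P z * (P z + 1) = (P z - 1) * (4 * (P z + 1) ^ 2 - 4)) :
    (∀ z ∈ I, P z = 0) ∨ (∀ z ∈ I, P z = 1) ∨ (∀ z ∈ I, P z = -2) ∨
      ((∀ z ∈ I, 2 * (P z + 1) * deriv P z = (P z - 1) * (P z + 2)) ∧
        ∃ c : ℝ, c ≠ 0 ∧ ∀ z ∈ I, (P z - 1) ^ 2 * (P z + 2) = c * Real.exp (3 / 2 * z)) := by
  rcases eq_zero_or_ode_of_four hI hIc hPs fun z hz => (hP z hz).2 with h0 | hode
  · exact Or.inl h0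
  have hder : ∀ z ∈ I, HasDerivAt P ((P z - 1) * (P z + 2) / (2 * (P z + 1))) z := fun z hz => by
    refine (hasDerivAt_of_contDiffOn hI hPs hz).congr_deriv ?_
    rw [eq_div_iff (mul_ne_zero two_ne_zero (hP z hz).1), ← hode z hz]
    ring
  have hPc := hPs.continuousOn
  have hden : ∀ z ∈ I, 2 * (P z + 1) ≠ 0 := fun z hz => mul_ne_zero two_ne_zero (hP z hz).1
  have h1 : (∀ z ∈ I, P z - 1 = 0) ∨ ∀ z ∈ I, P z - 1 ≠ 0 :=
    eq_zero_or_ne_zero_of_linear hI hIc (g := fun z => (P z + 2) / (2 * (P z + 1)))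
      (ContinuousOn.div (by fun_prop) (by fun_prop) hden)
      fun z hz => ((hder z hz).sub_const 1).congr_deriv (by ring)
  have h2 : (∀ z ∈ I, P z + 2 = 0) ∨ ∀ z ∈ I, P z + 2 ≠ 0 :=
    eq_zero_or_ne_zero_of_linear hI hIc (g := fun z => (P z - 1) / (2 * (P z + 1)))
      (ContinuousOn.div (by fun_prop) (by fun_prop) hden)
      fun z hz => ((hder z hz).add_const 2).congr_deriv (by ring)
  rcases h1 with h1 | h1
  · exact Or.inr (Or.inl fun z hz => sub_eq_zero.1 (h1 z hz))
  rcases h2 with h2 | h2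
  · exact Or.inr (Or.inr (Or.inl fun z hz => eq_neg_of_add_eq_zero_left (h2 z hz)))
  refine Or.inr (Or.inr (Or.inr ⟨hode, ?_⟩))
  rcases I.eq_empty_or_nonempty with rfl | ⟨z₀, hz₀⟩
  · exact ⟨1, one_ne_zero, fun z hz => hz.elim⟩
  refine ⟨(P z₀ - 1) ^ 2 * (P z₀ + 2) * Real.exp (-(3 / 2 * z₀)), ?_, fun z hz => ?_⟩
  · have := h1 z₀ hz₀
    have := h2 z₀ hz₀
    positivity
  · have := eq_of_hasDerivAt_zero
      (f := fun z => (P z - 1) ^ 2 * (P z + 2) * Real.exp (-(3 / 2 * z))) hIc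
      (fun z hz => by
        have hd := ((((hder z hz).sub_const 1).pow 2).mul ((hder z hz).add_const 2)).mul
          ((hasDerivAt_id z).const_mul (3 / 2)).neg.exp
        refine hd.congr_deriv ?_
        have := (hP z hz).1
        simp only [Pi.mul_apply, Pi.pow_apply, Pi.neg_apply, id]
        norm_num
        field_simp
        ring) hz hz₀
    rw [← this, mul_assoc, ← Real.exp_add]
    simp

/-- For `q = 4` the implicit equation becomes polynomial in `P`. The square removes the absolute
value from `log |P + 2|`, and the right-hand side keeps `P` away from the singular values `1`
and `-2`. -/
lemma sheetMinus_four_iff (c p z : ℝ) :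
    SheetMinus 4 c p z ↔
      (p - 1) ^ 4 * (p + 2) ^ 2 = Real.exp (3 * z + (c - 4 * Real.log 2) / 2) := by
  have hs : √(4 : ℝ) = 2 := by
    rw [show (4 : ℝ) = 2 ^ 2 by norm_num]; exact Real.sqrt_sq (by norm_num)
  have hlog : p - 1 ≠ 0 → p + 2 ≠ 0 →
      Real.log ((p - 1) ^ 4 * (p + 2) ^ 2) = 4 * Real.log (p - 1) + 2 * Real.log (p + 2) := by
    intro h1 h2
    rw [Real.log_mul (by positivity) (by positivity), Real.log_pow, Real.log_pow]
    norm_num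
  have hlog2 : p + 2 ≠ 0 → Real.log ((p + 1) * 2 + 2) = Real.log 2 + Real.log (p + 2) := by
    intro h
    rw [← Real.log_mul two_ne_zero h]
    ring_nf
  rw [sheetMinus_iff (by norm_num), SheetDomain, sheetFun, sheetSlope, hs]
  norm_num
  constructor
  · rintro ⟨⟨h1, h2⟩, h⟩
    have h1' : p - 1 ≠ 0 := sub_ne_zero.2 h1
    have h2' : p + 2 ≠ 0 := fun h0 => h2 (by linarith)
    rw [hlog2 h2'] at h
    rw [← Real.exp_log (show 0 < (p - 1) ^ 4 * (p + 2) ^ 2 by positivity), hlog h1' h2']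
    congr 1
    linarith
  · intro h
    have h1' : p - 1 ≠ 0 := by
      intro h0
      rw [h0] at h
      have := Real.exp_pos (3 * z + (c - 4 * Real.log 2) / 2)
      norm_num at h
      exact this.ne h
    have h2' : p + 2 ≠ 0 := by
      intro h0
      rw [h0] at h
      have := Real.exp_pos (3 * z + (c - 4 * Real.log 2) / 2)
      norm_num at h
      exact this.ne h
    refine ⟨⟨sub_ne_zero.1 h1', fun h0 => h2' (by linarith)⟩, ?_⟩
    have h3 := congrArg Real.log h
    rw [hlog h1' h2', Real.log_exp] at h3
    rw [hlog2 h2']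
    linarith

lemma solvesFirstOrder_of_param_four (hb : b ≠ 0) (hI : IsOpen I)
    (hIc : I.OrdConnected) (hPs : ContDiffOn ℝ ∞ P I)
    (hP : ∀ z ∈ I, P z + 1 ≠ 0 ∧ b * deriv v z = 4 * (1 - P z ^ 2) / 4 ∧
      2 * 4 * P z * deriv P z * (P z + 1) = (P z - 1) * (4 * (P z + 1) ^ 2 - 4)) :
    SolvesFirstOrder 4 b I v := by
  have hs : √(4 : ℝ) = 2 := by
    rw [show (4 : ℝ) = 2 ^ 2 by norm_num]; exact Real.sqrt_sq (by norm_num)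
  have hc : ∀ {C p : ℝ}, (∀ z ∈ I, P z = p) → C = 1 - p ^ 2 → ∀ z ∈ I, deriv v z = C / b := by
    intro C p h h2 z hz
    rw [eq_div_iff hb, h2]
    have := (hP z hz).2.1
    rw [h z hz] at this
    linarith
  rcases four_cases hI hIc hPs fun z hz => ⟨(hP z hz).1, (hP z hz).2.2⟩ with
    h | h | h | ⟨-, c, hc0, h⟩
  · exact Or.inr (Or.inl ⟨by norm_num, hc h (by rw [hs]; norm_num)⟩)
  · refine Or.inl fun z hz => ?_
    rw [hc h rfl z hz]
    norm_num
  · exact Or.inr (Or.inr (Or.inl ⟨by norm_num, hc h (by rw [hs]; norm_num)⟩))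
  · right; right; right
    have hsq : ∀ z ∈ I, 1 - 4 * b / 4 * deriv v z = P z ^ 2 := fun z hz =>
      one_sub_eq_sq (by norm_num) (hP z hz).2.1
    refine ⟨fun z hz => by rw [hsq z hz]; positivity, 2 * Real.log (c ^ 2) + 4 * Real.log 2,
      Or.inr (Or.inr ⟨rfl, fun z hz => ?_⟩)⟩
    have hPz : SheetMinus 4 (2 * Real.log (c ^ 2) + 4 * Real.log 2) (P z) z := by
      rw [sheetMinus_four_iff]
      have e : 3 * z + (2 * Real.log (c ^ 2) + 4 * Real.log 2 - 4 * Real.log 2) / 2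
        = Real.log (c ^ 2) + (3 / 2 * z + 3 / 2 * z) := by ring
      rw [e, Real.exp_add, Real.exp_add, Real.exp_log (by positivity)]
      linear_combination ((P z - 1) ^ 2 * (P z + 2) + c * Real.exp (3 / 2 * z)) * h z hz
    rw [sheetPlus_iff_sheetMinus_neg (by norm_num), pVar, hsq z hz, Real.sqrt_sq_eq_abs]
    rcases abs_choice (P z) with h1 | h1
    · left; rwa [h1]
    · right; rwa [h1, neg_neg]

/-! ### From the implicit equations to the reduced equation -/

lemma reducedAt_of_deriv_const {C : ℝ} (hI : IsOpen I) (h : ∀ z ∈ I, deriv v z = C)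
    (hC : 1 + b * C ≠ 0 ∧ b * C * ((1 + b * C) ^ 2 - q) = 0) :
    ∀ z ∈ I, ReducedAt q (b * deriv v z) (b * deriv (deriv v) z) := by
  intro z hz
  have h2 : deriv (deriv v) z = 0 :=
    (Filter.EventuallyEq.deriv_eq (f := fun _ => C)
      (Filter.eventually_of_mem (hI.mem_nhds hz) h)).trans (deriv_const z C)
  rw [ReducedAt, h z hz, h2]
  refine ⟨fun h0 => hC.1 (by linarith), by linear_combination hC.2⟩

section Sheet

variable {ε : ℝ}

lemma hasDerivAt_pVar (hI : IsOpen I) (hv : ContDiffOn ℝ ∞ v I) {z : ℝ} (hz : z ∈ I)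
    (h0 : pVar q b v z ≠ 0) :
    ∃ p' : ℝ, HasDerivAt (pVar q b v) p' z ∧
      2 * pVar q b v z * p' = -(4 * b / q * deriv (deriv v) z) := by
  have hd := ((hasDerivAt_of_contDiffOn hI (contDiffOn_deriv hI hv) hz).const_mul
    (4 * b / q)).const_sub 1
  have hne : 1 - 4 * b / q * deriv v z ≠ 0 := fun h => h0 (by rw [pVar, h, Real.sqrt_zero])
  refine ⟨_, hd.sqrt hne, ?_⟩
  rw [← pVar]
  field_simp

lemma sq_pVar {z : ℝ} (hz : 0 ≤ 1 - 4 * b / q * deriv v z) :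
    pVar q b v z ^ 2 = 1 - 4 * b / q * deriv v z := Real.sq_sqrt hz

lemma reducedAt_of_pVar (hq : q ≠ 0) (hε : ε ^ 2 = 1) {z p' : ℝ}
    (hnn : 0 ≤ 1 - 4 * b / q * deriv v z)
    (hp' : 2 * pVar q b v z * p' = -(4 * b / q * deriv (deriv v) z))
    (h1 : ε * pVar q b v z + 1 ≠ 0)
    (ode : 2 * q * (ε * pVar q b v z) * (ε * p') * (ε * pVar q b v z + 1)
      = (ε * pVar q b v z - 1) * (q * (ε * pVar q b v z + 1) ^ 2 - 4)) :
    ReducedAt q (b * deriv v z) (b * deriv (deriv v) z) := by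
  refine reducedAt_of_ode h1 ?_ ?_ ode
  · have h2 := sq_pVar hnn
    field_simp at h2
    rw [mul_pow, hε]
    linear_combination 1 / 4 * h2
  · field_simp at hp'
    linear_combination 1 / 4 * hp' + q * pVar q b v z * p' / 2 * hε

/-- On one sheet with `q ≠ 4` the differential equation holds where `p ≠ 0`. -/
lemma ode_of_sheet (hq : q ≠ 0) (hq4 : q ≠ 4) (hI : IsOpen I)
    {c p' : ℝ} (hS : ∀ z ∈ I, SheetMinus q c (ε * pVar q b v z) z) {z : ℝ} (hz : z ∈ I)
    (hp : HasDerivAt (pVar q b v) p' z) :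
    ε * pVar q b v z + 1 ≠ 0 ∧ 2 * q * (ε * pVar q b v z) * (ε * p') * (ε * pVar q b v z + 1)
      = (ε * pVar q b v z - 1) * (q * (ε * pVar q b v z + 1) ^ 2 - 4) := by
  simp only [sheetMinus_iff hq] at hS
  have hd := (hasDerivAt_sheetFun hq hq4 (hS z hz).1).comp z (hp.const_mul ε)
  have hd2 : HasDerivAt (fun z => sheetSlope q * z + c) (sheetSlope q) z :=
    (((hasDerivAt_id z).const_mul (sheetSlope q)).add_const c).congr_deriv (mul_one _)
  have hu := hd.unique (hd2.congr_of_eventuallyEq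
    (Filter.eventually_of_mem (hI.mem_nhds hz) fun y hy => (hS y hy).2))
  generalize ε * pVar q b v z = X at *
  have hu2 : 2 * q * X * (X + 1) / ((X - 1) * (q * (X + 1) ^ 2 - 4)) * (ε * p') = 1 :=
    mul_left_cancel₀ (sheetSlope_ne_zero (q := q)) (by linear_combination hu)
  -- a vanishing denominator would make the quotient `0`, not `1`
  have hne : (X - 1) * (q * (X + 1) ^ 2 - 4) ≠ 0 := by
    intro h; rw [h] at hu2; simp at hu2
  rw [div_mul_eq_mul_div, div_eq_one_iff_eq hne] at hu2
  refine ⟨fun h => ?_, by rw [← hu2]; ring⟩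
  apply hne
  rw [← hu2, h]
  ring

/-- On one sheet with `q ≠ 4` the function `p` has no zeros: near a zero, `p² = 1 - (4 b / q) v_z`
would have a minimum, whereas the differential equation gives it the slope `(4 - q) / q`. -/
lemma pVar_ne_zero_of_sheet (hq : q ≠ 0) (hq4 : q ≠ 4) (hI : IsOpen I)
    (hv : ContDiffOn ℝ ∞ v I) (hε : ε ^ 2 = 1)
    (hnn : ∀ z ∈ I, 0 ≤ 1 - 4 * b / q * deriv v z) {c : ℝ}
    (hS : ∀ z ∈ I, SheetMinus q c (ε * pVar q b v z) z) {z : ℝ} (hz : z ∈ I) :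
    pVar q b v z ≠ 0 := by
  intro h0
  have hdv := contDiffOn_deriv hI hv
  obtain ⟨f, hf⟩ : ∃ f : ℝ → ℝ, f = fun y => 1 - 4 * b / q * deriv v y := ⟨_, rfl⟩
  have hfd : ∀ y ∈ I, HasDerivAt f (-(4 * b / q * deriv (deriv v) y)) y := fun y hy => by
    rw [hf]
    exact ((hasDerivAt_of_contDiffOn hI hdv hy).const_mul (4 * b / q)).const_sub 1
  have hfz : f z = 0 := by
    have := sq_pVar (hnn z hz)
    rw [h0] at this
    rw [hf]; simp only; linarith
  have hmin : IsLocalMin f z := by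
    filter_upwards [hI.mem_nhds hz] with y hy
    rw [hfz, hf]
    exact hnn y hy
  have hf' : -(4 * b / q * deriv (deriv v) z) = 0 := hmin.hasDerivAt_eq_zero (hfd z hz)
  have hpc : ContinuousAt (pVar q b v) z := by
    have : pVar q b v = fun y => √(f y) := by rw [hf]; rfl
    rw [this]
    exact (hfd z hz).continuousAt.sqrt
  have hvc : ContinuousAt (deriv (deriv v)) z :=
    (contDiffOn_deriv hI hdv).continuousOn.continuousAt (hI.mem_nhds hz)
  have hGc : ContinuousAt (fun y => q * -(4 * b / q * deriv (deriv v) y) * (ε * pVar q b v y + 1)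
      - (ε * pVar q b v y - 1) * (q * (ε * pVar q b v y + 1) ^ 2 - 4)) z := by
    fun_prop
  have hG0 := hGc.eventually_ne (y := 0) (by
    rw [hf', h0]
    intro h
    exact hq4 (by linarith))
  have hzero : ∀ᶠ y in nhds z, pVar q b v y = 0 := by
    filter_upwards [hG0, hI.mem_nhds hz] with y hy hyI
    by_contra hne
    obtain ⟨p', hp', hpp'⟩ := hasDerivAt_pVar hI hv hyI hne
    have := (ode_of_sheet hq hq4 hI hS hyI hp').2
    apply hy
    rw [← hpp']
    linear_combination this
      - 2 * q * pVar q b v y * p' * (ε * pVar q b v y + 1) * hε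
  have hp : HasDerivAt (pVar q b v) 0 z :=
    (hasDerivAt_const z (0 : ℝ)).congr_of_eventuallyEq hzero
  have := (ode_of_sheet hq hq4 hI hS hz hp).2
  rw [h0] at this
  exact hq4 (by linarith)

lemma reducedAt_of_sheet (hq : q ≠ 0) (hq4 : q ≠ 4) (hI : IsOpen I)
    (hv : ContDiffOn ℝ ∞ v I) (hε : ε ^ 2 = 1)
    (hnn : ∀ z ∈ I, 0 ≤ 1 - 4 * b / q * deriv v z) {c : ℝ}
    (hS : ∀ z ∈ I, SheetMinus q c (ε * pVar q b v z) z) :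
    ∀ z ∈ I, ReducedAt q (b * deriv v z) (b * deriv (deriv v) z) := by
  intro z hz
  obtain ⟨p', hp', hpp'⟩ :=
    hasDerivAt_pVar hI hv hz (pVar_ne_zero_of_sheet hq hq4 hI hv hε hnn hS hz)
  obtain ⟨h1, h2⟩ := ode_of_sheet hq hq4 hI hS hz hp'
  exact reducedAt_of_pVar hq hε (hnn z hz) hpp' h1 h2

/-- For `q = 4` it suffices that the points where one of the two sheet equations holds accumulate
at `z`. -/
lemma reducedAt_of_frequently_sheet_four (hI : IsOpen I) (hv : ContDiffOn ℝ ∞ v I)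
    (hε : ε ^ 2 = 1) {c z : ℝ} (hz : z ∈ I) (hnn : 0 ≤ 1 - 4 * b / 4 * deriv v z)
    (h0 : pVar 4 b v z ≠ 0)
    (hS : ∃ᶠ y in nhdsWithin z {z}ᶜ, SheetMinus 4 c (ε * pVar 4 b v y) y) :
    ReducedAt 4 (b * deriv v z) (b * deriv (deriv v) z) := by
  obtain ⟨p', hp', hpp'⟩ := hasDerivAt_pVar hI hv hz h0
  simp only [sheetMinus_four_iff] at hS
  have hP := hp'.const_mul ε
  obtain ⟨P, hPdef⟩ : ∃ P : ℝ → ℝ, P = fun y => ε * pVar 4 b v y := ⟨_, rfl⟩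
  have hPy : ∀ y, ε * pVar 4 b v y = P y := fun y => by rw [hPdef]
  simp only [hPy] at hS hP
  obtain ⟨e, he⟩ : ∃ e : ℝ, e = Real.exp (3 * z + (c - 4 * Real.log 2) / 2) := ⟨_, rfl⟩
  have he0 : 0 < e := he ▸ Real.exp_pos _
  have hE : HasDerivAt (fun y => Real.exp (3 * y + (c - 4 * Real.log 2) / 2)) (e * 3) z := by
    rw [he]
    exact ((((hasDerivAt_id z).const_mul 3).add_const _).exp).congr_deriv (by simp)
  have hφ := ((((hP.sub_const 1).pow 4).mul ((hP.add_const 2).pow 2)).sub hE)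
  -- at an accumulation point of its zeros a differentiable function vanishes with its derivative
  have hval : (P z - 1) ^ 4 * (P z + 2) ^ 2 = e := by
    by_contra hne
    have := hφ.continuousAt.eventually_ne (y := 0) (by
      simp only [Pi.sub_apply, Pi.mul_apply, Pi.pow_apply]
      rw [← he]
      exact sub_ne_zero.2 hne)
    obtain ⟨y, hy1, hy2⟩ := (hS.and_eventually (this.filter_mono nhdsWithin_le_nhds)).exists
    exact hy2 (sub_eq_zero.2 hy1)
  have hder : ((4 : ℕ) * (P z - 1) ^ 3 * (ε * p')) * (P z + 2) ^ 2
      + (P z - 1) ^ 4 * ((2 : ℕ) * (P z + 2) ^ 1 * (ε * p')) - e * 3 = 0 := by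
    by_contra hne
    have := hφ.eventually_ne hne (c := 0)
    obtain ⟨y, hy1, hy2⟩ := (hS.and_eventually this).exists
    exact hy2 (sub_eq_zero.2 hy1)
  have n1 : P z - 1 ≠ 0 := fun h => by rw [h] at hval; norm_num at hval; exact he0.ne hval
  have n2 : P z + 2 ≠ 0 := fun h => by rw [h] at hval; norm_num at hval; exact he0.ne hval
  rw [← hval] at hder
  push_cast at hder
  have hode : 2 * (P z + 1) * (ε * p') = (P z - 1) * (P z + 2) := by
    have h3 : 3 * (P z - 1) ^ 3 * (P z + 2) ≠ 0 := by positivity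
    exact mul_left_cancel₀ h3 (by linear_combination hder)
  have n3 : P z + 1 ≠ 0 := by
    intro h
    rw [h] at hode
    have : (P z - 1) * (P z + 2) = 0 := by rw [← hode]; ring
    exact mul_ne_zero n1 n2 this
  refine reducedAt_of_pVar (by norm_num) hε hnn hpp' (by rwa [hPy]) ?_
  rw [hPy]
  linear_combination 4 * P z * hode

lemma reducedAt_of_sheets_four (hI : IsOpen I) (hv : ContDiffOn ℝ ∞ v I)
    (hnn : ∀ z ∈ I, 0 ≤ 1 - 4 * b / 4 * deriv v z) {c : ℝ}
    (hS : ∀ z ∈ I, SheetMinus 4 c (pVar 4 b v z) z ∨ SheetPlus 4 c (pVar 4 b v z) z) :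
    ∀ z ∈ I, ReducedAt 4 (b * deriv v z) (b * deriv (deriv v) z) := by
  intro z hz
  by_cases h0 : pVar 4 b v z = 0
  · -- at a zero of `p` the function `1 - b v_z` is minimal, so `b v_z = 1` and `v_zz = 0`
    have h1 : 1 - 4 * b / 4 * deriv v z = 0 := by
      rw [← sq_pVar (hnn z hz), h0]; norm_num
    have hmin : IsLocalMin (fun y => 1 - 4 * b / 4 * deriv v y) z := by
      filter_upwards [hI.mem_nhds hz] with y hy
      rw [h1]
      exact hnn y hy
    have h2 := hmin.hasDerivAt_eq_zero
      (((hasDerivAt_of_contDiffOn hI (contDiffOn_deriv hI hv) hz).const_mul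
        (4 * b / 4)).const_sub 1)
    have e1 : b * deriv v z = 1 := by linarith
    have e2 : b * deriv (deriv v) z = 0 := by linarith
    rw [e1, e2]
    norm_num [ReducedAt]
  · have hev : ∀ᶠ y in nhdsWithin z {z}ᶜ,
        SheetMinus 4 c (1 * pVar 4 b v y) y ∨ SheetMinus 4 c (-1 * pVar 4 b v y) y := by
      filter_upwards [nhdsWithin_le_nhds (hI.mem_nhds hz)] with y hy
      rw [one_mul, neg_one_mul, ← sheetPlus_iff_sheetMinus_neg (by norm_num)]
      exact hS y hy
    rcases Filter.frequently_or_distrib.1 hev.frequently with h | h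
    · exact reducedAt_of_frequently_sheet_four hI hv (by norm_num) hz (hnn z hz) h0 h
    · exact reducedAt_of_frequently_sheet_four hI hv (by norm_num) hz (hnn z hz) h0 h

end Sheet

/-- For `k = 1` the reduced equation is equivalent to the disjunction of the first order
equations. -/
lemma reducedAt_iff_solvesFirstOrder (hb : b ≠ 0) (hq : q ≠ 0) (hI : IsOpen I)
    (hIc : I.OrdConnected) (hv : ContDiffOn ℝ ∞ v I) :
    (∀ z ∈ I, ReducedAt q (b * deriv v z) (b * deriv (deriv v) z)) ↔ SolvesFirstOrder q b I v := by
  constructor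
  · intro h
    obtain ⟨P, hPs, hP⟩ := exists_param hI hv h
    by_cases hq4 : q = 4
    · subst hq4
      exact solvesFirstOrder_of_param_four hb hI hIc hPs hP
    · exact solvesFirstOrder_of_param hb hq hq4 hI hIc hPs hP
  · rintro (h | ⟨hq0, h⟩ | ⟨hq0, h⟩ | ⟨hnn, c, h⟩)
    · exact reducedAt_of_deriv_const hI h (by norm_num)
    · refine reducedAt_of_deriv_const hI h ?_
      have e : b * ((-1 + √q) / b) = -1 + √q := by field_simp
      rw [e]
      refine ⟨by simpa using (Real.sqrt_pos.2 hq0).ne', ?_⟩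
      linear_combination (-1 + √q) * Real.sq_sqrt hq0.le
    · refine reducedAt_of_deriv_const hI h ?_
      have e : b * ((-1 - √q) / b) = -1 - √q := by field_simp
      rw [e]
      refine ⟨fun h0 => (Real.sqrt_pos.2 hq0).ne' (by linarith), ?_⟩
      linear_combination (-1 - √q) * Real.sq_sqrt hq0.le
    · by_cases hq4 : q = 4
      · subst hq4
        refine reducedAt_of_sheets_four hI hv hnn (c := c) ?_
        rcases h with h | h | ⟨-, h⟩
        · exact fun z hz => Or.inl (h z hz)
        · exact fun z hz => Or.inr (h z hz)
        · exact h
      · rcases h with h | h | ⟨h4, -⟩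
        · exact reducedAt_of_sheet (ε := 1) hq hq4 hI hv (by norm_num) hnn (c := c)
            (fun z hz => by rw [one_mul]; exact h z hz)
        · exact reducedAt_of_sheet (ε := -1) hq hq4 hI hv (by norm_num) hnn (c := c)
            (fun z hz => by
              rw [neg_one_mul, ← sheetPlus_iff_sheetMinus_neg hq]; exact h z hz)
        · exact absurd h4 hq4

end FirstOrder

/-! ### The case `q = 4`: the cubic equation -/

section Cubic

/-- The branches of the inverse of the cubic `P ↦ (P - 1)² (P + 2)`, whose critical points are
`±1`, live on open intervals without critical points. -/
structure IsBranch (R : Set ℝ) : Prop where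
  isOpen : IsOpen R
  ordConnected : R.OrdConnected
  one_notMem : (1 : ℝ) ∉ R
  neg_one_notMem : (-1 : ℝ) ∉ R

lemma isBranch_Iio : IsBranch (Iio (-2)) :=
  ⟨isOpen_Iio, ordConnected_Iio, by norm_num, by norm_num⟩

lemma isBranch_left : IsBranch (Ioo (-2) (-1)) :=
  ⟨isOpen_Ioo, ordConnected_Ioo, by norm_num, by norm_num⟩

lemma isBranch_middle : IsBranch (Ioo (-1) 1) :=
  ⟨isOpen_Ioo, ordConnected_Ioo, by norm_num, by norm_num⟩

lemma isBranch_Ioi : IsBranch (Ioi 1) :=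
  ⟨isOpen_Ioi, ordConnected_Ioi, by norm_num, by norm_num⟩

lemma hasDerivAt_cubic (P : ℝ) :
    HasDerivAt (fun P : ℝ => (P - 1) ^ 2 * (P + 2)) (3 * (P - 1) * (P + 1)) P := by
  refine ((((hasDerivAt_id P).sub_const 1).pow 2).mul ((hasDerivAt_id P).add_const 2)).congr_deriv ?_
  simp only [id, Pi.pow_apply]
  norm_num
  ring

lemma IsBranch.deriv_cubic_ne_zero {R : Set ℝ} (hR : IsBranch R) :
    ∀ P ∈ R, deriv (fun P : ℝ => (P - 1) ^ 2 * (P + 2)) P ≠ 0 := by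
  intro P hP
  rw [(hasDerivAt_cubic P).deriv]
  refine mul_ne_zero (mul_ne_zero three_ne_zero ?_) ?_
  · exact sub_ne_zero.2 fun h => hR.one_notMem (h ▸ hP)
  · exact fun h => hR.neg_one_notMem (eq_neg_of_add_eq_zero_left h ▸ hP)

lemma IsBranch.injOn {R : Set ℝ} (hR : IsBranch R) :
    InjOn (fun P : ℝ => (P - 1) ^ 2 * (P + 2)) R :=
  injOn_of_deriv_ne_zero hR.ordConnected (by fun_prop) hR.deriv_cubic_ne_zero

lemma IsBranch.contDiffOn {R : Set ℝ} (hR : IsBranch R) {I : Set ℝ} {P : ℝ → ℝ} {c : ℝ}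
    (hP : ∀ z ∈ I, P z ∈ R ∧ (P z - 1) ^ 2 * (P z + 2) = c * Real.exp (3 / 2 * z)) :
    ContDiffOn ℝ ∞ P I := by
  have hg : ∀ x ∈ R, Function.invFunOn (fun P : ℝ => (P - 1) ^ 2 * (P + 2)) R
      ((fun P : ℝ => (P - 1) ^ 2 * (P + 2)) x) = x := fun x hx => hR.injOn.leftInvOn_invFunOn hx
  have hs := (contDiffOn_leftInverse hR.isOpen (by fun_prop) hR.deriv_cubic_ne_zero hg).2
  have h := hs.comp (t := (fun P : ℝ => (P - 1) ^ 2 * (P + 2)) '' R) (s := I)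
    (f := fun z => c * Real.exp (3 / 2 * z)) (by fun_prop)
    fun z hz => ⟨P z, (hP z hz).1, (hP z hz).2⟩
  refine h.congr fun z hz => ?_
  rw [Function.comp, ← (hP z hz).2]
  exact (hg _ (hP z hz).1).symm

/-- The solution of the reduced equation (`k = 1`, `q = 4`) in terms of the parameter `P`. The
logarithm is `log |P + 2|`, as the branch `P < -2` requires. -/
def profile (b d P : ℝ) : ℝ := -(P ^ 2 + 2 * Real.log (P + 2)) / b + d

lemma hasDerivAt_profile {b d : ℝ} (hb : b ≠ 0) {P : ℝ → ℝ} {P' z : ℝ} (hP : HasDerivAt P P' z)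
    (h2 : P z + 2 ≠ 0) (hode : 2 * (P z + 1) * P' = (P z - 1) * (P z + 2)) :
    HasDerivAt (fun z => profile b d (P z)) ((1 - P z ^ 2) / b) z := by
  have hd := ((((hP.pow 2).add (((hP.add_const 2).log h2).const_mul 2)).neg).div_const b).add_const d
  refine hd.congr_deriv ?_
  norm_num
  field_simp
  linear_combination (-(P z + 1)) * hode

lemma profile_solves {b d c : ℝ} (hb : b ≠ 0) (hc : c ≠ 0) {R I : Set ℝ} (hR : IsBranch R)
    (hI : IsOpen I) {P : ℝ → ℝ}
    (hP : ∀ z ∈ I, P z ∈ R ∧ (P z - 1) ^ 2 * (P z + 2) = c * Real.exp (3 / 2 * z)) :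
    ContDiffOn ℝ ∞ (fun z => profile b d (P z)) I ∧
      ∀ z ∈ I, ReducedAt 4 (b * deriv (fun z => profile b d (P z)) z)
        (b * deriv (deriv fun z => profile b d (P z)) z) := by
  have hPs := hR.contDiffOn hP
  have h2 : ∀ z ∈ I, P z + 2 ≠ 0 := by
    intro z hz h
    have := (hP z hz).2
    rw [h, mul_zero] at this
    exact mul_ne_zero hc (Real.exp_pos _).ne' this.symm
  have h1 : ∀ z ∈ I, P z - 1 ≠ 0 := fun z hz =>
    sub_ne_zero.2 fun h => hR.one_notMem (h ▸ (hP z hz).1)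
  have h3 : ∀ z ∈ I, P z + 1 ≠ 0 := fun z hz h =>
    hR.neg_one_notMem (eq_neg_of_add_eq_zero_left h ▸ (hP z hz).1)
  have hode : ∀ z ∈ I, 2 * (P z + 1) * deriv P z = (P z - 1) * (P z + 2) := by
    intro z hz
    have hd1 := (hasDerivAt_cubic (P z)).comp z (hasDerivAt_of_contDiffOn hI hPs hz)
    have hd2 : HasDerivAt (fun z => c * Real.exp (3 / 2 * z))
        (3 / 2 * (c * Real.exp (3 / 2 * z))) z := by
      refine (((hasDerivAt_id z).const_mul (3 / 2)).exp.const_mul c).congr_deriv ?_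
      simp only [id]
      ring
    have hu := hd1.unique (hd2.congr_of_eventuallyEq
      (Filter.eventually_of_mem (hI.mem_nhds hz) fun y hy => (hP y hy).2))
    rw [← (hP z hz).2] at hu
    exact mul_left_cancel₀ (h1 z hz) (by linear_combination 2 / 3 * hu)
  have hd : ∀ z ∈ I, HasDerivAt (fun z => profile b d (P z)) ((1 - P z ^ 2) / b) z := fun z hz =>
    hasDerivAt_profile hb (hasDerivAt_of_contDiffOn hI hPs hz) (h2 z hz) (hode z hz)
  constructor
  · unfold profile
    exact ((((hPs.pow 2).add (contDiffOn_const.mul ((hPs.add contDiffOn_const).log h2))).neg).div_const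
      b).add contDiffOn_const
  · intro z hz
    have e2 : deriv (deriv fun z => profile b d (P z)) z = -(2 * P z * deriv P z) / b := by
      rw [Filter.EventuallyEq.deriv_eq (f := fun z => (1 - P z ^ 2) / b)
        (Filter.eventually_of_mem (hI.mem_nhds hz) fun y hy => (hd y hy).deriv)]
      refine ((((hasDerivAt_of_contDiffOn hI hPs hz).pow 2).const_sub 1).div_const b).deriv.trans ?_
      norm_num
    rw [(hd z hz).deriv, e2]
    refine reducedAt_of_ode (h3 z hz) (P' := deriv P z) ?_ ?_ ?_
    · field_simp
    · field_simp
      ring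
    · linear_combination 4 * P z * hode z hz

lemma eq_profile_of_ode {b : ℝ} (hb : b ≠ 0) {I : Set ℝ} (hI : IsOpen I) (hIc : I.OrdConnected)
    (hIn : I.Nonempty) {v P : ℝ → ℝ} (hv : ContDiffOn ℝ ∞ v I) (hPs : ContDiffOn ℝ ∞ P I)
    (h2 : ∀ z ∈ I, P z + 2 ≠ 0) (hvP : ∀ z ∈ I, b * deriv v z = 1 - P z ^ 2)
    (hode : ∀ z ∈ I, 2 * (P z + 1) * deriv P z = (P z - 1) * (P z + 2)) :
    ∃ d, ∀ z ∈ I, v z = profile b d (P z) := by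
  obtain ⟨z₀, hz₀⟩ := hIn
  refine ⟨v z₀ - profile b 0 (P z₀), fun z hz => ?_⟩
  have := eq_of_hasDerivAt_zero (f := fun z => v z - profile b 0 (P z)) hIc (fun z hz => by
    refine ((hasDerivAt_of_contDiffOn hI hv hz).sub (hasDerivAt_profile hb
      (hasDerivAt_of_contDiffOn hI hPs hz) (h2 z hz) (hode z hz))).congr_deriv ?_
    rw [← hvP z hz]
    field_simp
    ring) hz hz₀
  simp only [profile, add_zero] at this ⊢
  linarith

lemma eq_affine_of_deriv {I : Set ℝ} (hI : IsOpen I) (hIc : I.OrdConnected) (hIn : I.Nonempty)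
    {v : ℝ → ℝ} (hv : ContDiffOn ℝ ∞ v I) {C : ℝ} (h : ∀ z ∈ I, deriv v z = C) :
    ∃ d, ∀ z ∈ I, v z = C * z + d := by
  obtain ⟨z₀, hz₀⟩ := hIn
  refine ⟨v z₀ - C * z₀, fun z hz => ?_⟩
  have := eq_of_hasDerivAt_zero (f := fun z => v z - C * z) hIc (fun z hz => by
    refine ((hasDerivAt_of_contDiffOn hI hv hz).sub ((hasDerivAt_id z).const_mul C)).congr_deriv ?_
    rw [h z hz, mul_one, sub_self]) hz hz₀
  linarith

/-- The solutions of the reduced equation for `k = 1`, `q = 4`. -/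
lemma reduced_four_cases {b : ℝ} (hb : b ≠ 0) {I : Set ℝ} (hI : IsOpen I) (hIc : I.OrdConnected)
    (hIn : I.Nonempty) {v : ℝ → ℝ} (hv : ContDiffOn ℝ ∞ v I)
    (h : ∀ z ∈ I, ReducedAt 4 (b * deriv v z) (b * deriv (deriv v) z)) :
    (∃ d, ∀ z ∈ I, v z = d) ∨ (∃ d, ∀ z ∈ I, v z = -(3 / b) * z + d) ∨
    (∃ d, ∀ z ∈ I, v z = 1 / b * z + d) ∨
    ∃ (R : Set ℝ) (c d : ℝ) (P : ℝ → ℝ), (∀ z ∈ I, P z ∈ R ∧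
        (P z - 1) ^ 2 * (P z + 2) = c * Real.exp (3 / 2 * z) ∧ v z = profile b d (P z)) ∧
      ((c < 0 ∧ R = Iio (-2)) ∨
        0 < c ∧ (R = Ioo (-2) (-1) ∨ R = Ioo (-1) 1 ∨ R = Ioi 1)) := by
  obtain ⟨P, hPs, hP⟩ := exists_param hI hv h
  have hvP : ∀ z ∈ I, b * deriv v z = 1 - P z ^ 2 := fun z hz => by
    rw [(hP z hz).2.1]; ring
  have hconst : ∀ {p C : ℝ}, (∀ z ∈ I, P z = p) → C = (1 - p ^ 2) / b →
      ∃ d, ∀ z ∈ I, v z = C * z + d := fun hp hC =>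
    eq_affine_of_deriv hI hIc hIn hv fun z hz => by
      rw [hC, eq_div_iff hb, mul_comm, hvP z hz, hp z hz]
  rcases four_cases hI hIc hPs fun z hz => ⟨(hP z hz).1, (hP z hz).2.2⟩ with
    h0 | h1 | h2 | ⟨hode, c, hc0, hcub⟩
  · exact Or.inr (Or.inr (Or.inl (hconst h0 (by norm_num))))
  · left
    obtain ⟨d, hd⟩ := hconst (C := 0) h1 (by norm_num)
    exact ⟨d, fun z hz => by rw [hd z hz]; ring⟩
  · exact Or.inr (Or.inl (hconst h2 (by ring)))
  · right; right; right
    have hne : ∀ z ∈ I, (P z - 1) ^ 2 * (P z + 2) ≠ 0 := fun z hz => by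
      rw [hcub z hz]
      exact mul_ne_zero hc0 (Real.exp_pos _).ne'
    have n1 : ∀ z ∈ I, P z - 1 ≠ 0 := fun z hz h => hne z hz (by rw [h]; ring)
    have n2 : ∀ z ∈ I, P z + 2 ≠ 0 := fun z hz => right_ne_zero_of_mul (hne z hz)
    obtain ⟨d, hd⟩ := eq_profile_of_ode hb hI hIc hIn hv hPs n2 hvP hode
    have hPc := hPs.continuousOn
    rcases lt_or_gt_of_ne hc0 with hc | hc
    · refine ⟨Iio (-2), c, d, P, fun z hz => ⟨?_, hcub z hz, hd z hz⟩, Or.inl ⟨hc, rfl⟩⟩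
      have h3 : (P z - 1) ^ 2 * (P z + 2) < 0 := by
        rw [hcub z hz]; exact mul_neg_of_neg_of_pos hc (Real.exp_pos _)
      have := neg_of_mul_neg_right h3 (sq_nonneg _)
      rw [mem_Iio]; linarith
    · have hgt : ∀ z ∈ I, -2 < P z := fun z hz => by
        have h3 : 0 < (P z - 1) ^ 2 * (P z + 2) := by
          rw [hcub z hz]; exact mul_pos hc (Real.exp_pos _)
        have := pos_of_mul_pos_right h3 (sq_nonneg _)
        linarith
      rcases pos_or_neg_of_ne_zero hIc (f := fun z => P z + 1) (by fun_prop)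
        (fun z hz => (hP z hz).1) with hp | hp
      · rcases pos_or_neg_of_ne_zero hIc (f := fun z => P z - 1) (by fun_prop) n1 with hp' | hp'
        · refine ⟨Ioi 1, c, d, P, fun z hz => ⟨?_, hcub z hz, hd z hz⟩, Or.inr ⟨hc, by simp⟩⟩
          have := hp' z hz
          rw [mem_Ioi]; linarith
        · refine ⟨Ioo (-1) 1, c, d, P, fun z hz => ⟨?_, hcub z hz, hd z hz⟩, Or.inr ⟨hc, by simp⟩⟩
          have := hp z hz
          have := hp' z hz
          exact ⟨by linarith, by linarith⟩
      · refine ⟨Ioo (-2) (-1), c, d, P, fun z hz => ⟨?_, hcub z hz, hd z hz⟩, Or.inr ⟨hc, by simp⟩⟩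
        have := hp z hz
        exact ⟨hgt z hz, by linarith⟩

end Cubic

/-! ### Trigonometric roots of the cubic -/

/-- The root `P < -2` of `(P - 1)² (P + 2) = -2 x`, for `x > 0`. -/
def rootPos (x : ℝ) : ℝ :=
  -((1 + x + √(2 * x + x ^ 2)) ^ (-(1 / 3) : ℝ) + (1 + x + √(2 * x + x ^ 2)) ^ (1 / 3 : ℝ))

/-- The root in `(-2, -1)` of `(P - 1)² (P + 2) = x`, for `0 < x < 4`. -/
def rootOne (x : ℝ) : ℝ := -(2 * Real.cos (1 / 3 * Real.arccos (1 - x / 2)))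

/-- The root in `(-1, 1)` of `(P - 1)² (P + 2) = x`, for `0 < x < 4`. -/
def rootTwo (x : ℝ) : ℝ := -(2 * Real.cos (1 / 3 * Real.pi + 1 / 3 * Real.arccos (-1 + x / 2)))

/-- The root `P > 1` of `(P - 1)² (P + 2) = x`, for `x > 0`. -/
def rootThree (x : ℝ) : ℝ :=
  if x ≤ 4 then 2 * Real.cos (1 / 3 * Real.arccos (-1 + x / 2))
  else 2 * Real.cosh (1 / 3 * Real.arcosh (-1 + x / 2))

section Roots

variable {x : ℝ}

lemma rootPos_spec (hx : 0 < x) :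
    rootPos x ∈ Iio (-2) ∧ (rootPos x - 1) ^ 2 * (rootPos x + 2) = -(2 * x) := by
  obtain ⟨X, hX⟩ : ∃ X, X = 1 + x + √(2 * x + x ^ 2) := ⟨_, rfl⟩
  have hs : √(2 * x + x ^ 2) ^ 2 = 2 * x + x ^ 2 := Real.sq_sqrt (by positivity)
  have hs0 : 0 ≤ √(2 * x + x ^ 2) := Real.sqrt_nonneg _
  have hX1 : 1 < X := by rw [hX]; linarith
  have hX0 : 0 < X := by linarith
  obtain ⟨y, hy⟩ : ∃ y, y = X ^ (1 / 3 : ℝ) := ⟨_, rfl⟩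
  have hy1 : 1 < y := by rw [hy]; exact Real.one_lt_rpow hX1 (by norm_num)
  have hy3 : y ^ 3 = X := by
    rw [hy, ← Real.rpow_natCast, ← Real.rpow_mul hX0.le]; norm_num
  have hroot : rootPos x = -(y⁻¹ + y) := by
    rw [rootPos, ← hX, Real.rpow_neg hX0.le, ← hy]
  have hy0 : y ≠ 0 := by positivity
  -- `X + 1 / X = 2 + 2 x`
  have hq : X ^ 2 - (2 + 2 * x) * X + 1 = 0 := by
    rw [hX]; linear_combination hs
  rw [hroot]
  constructor
  · have h1 : y⁻¹ + y - 2 = (y - 1) ^ 2 / y := by field_simp; ring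
    have h2 : 0 < (y - 1) ^ 2 / y := by
      have : 0 < y - 1 := by linarith
      positivity
    rw [mem_Iio]; linarith
  · rw [← hy3] at hq
    field_simp
    linear_combination -hq

lemma cubic_two_mul_cos (α : ℝ) :
    (2 * Real.cos α - 1) ^ 2 * (2 * Real.cos α + 2) = 2 * Real.cos (3 * α) + 2 := by
  rw [Real.cos_three_mul]; ring

lemma cubic_neg_two_mul_cos (α : ℝ) :
    (-(2 * Real.cos α) - 1) ^ 2 * (-(2 * Real.cos α) + 2) = 2 - 2 * Real.cos (3 * α) := by
  rw [Real.cos_three_mul]; ring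

lemma two_sub_two_mul_cos (α : ℝ) :
    -(2 * Real.cos (2 * α)) + 2 = 4 * Real.sin α ^ 2 := by
  rw [Real.cos_two_mul, Real.cos_sq']; ring

lemma two_add_two_mul_cos (α : ℝ) :
    2 * Real.cos (2 * α) + 2 = 4 * Real.cos α ^ 2 := by
  rw [Real.cos_two_mul]; ring

lemma arccos_mem_Ioo {y : ℝ} (h1 : -1 < y) (h2 : y < 1) : Real.arccos y ∈ Ioo 0 Real.pi :=
  ⟨Real.arccos_pos.2 h2, lt_of_le_of_ne (Real.arccos_le_pi y) fun h => by
    rw [Real.arccos_eq_pi] at h; linarith⟩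

lemma rootOne_spec (hx : 0 < x) (hx4 : x < 4) :
    rootOne x ∈ Ioo (-2) (-1) ∧ (rootOne x - 1) ^ 2 * (rootOne x + 2) = x ∧
      rootOne x + 2 = 4 * Real.sin (1 / 6 * Real.arccos (1 - x / 2)) ^ 2 ∧
      0 < Real.sin (1 / 6 * Real.arccos (1 - x / 2)) := by
  have hθ := arccos_mem_Ioo (y := 1 - x / 2) (by linarith) (by linarith)
  have hcos : Real.cos (Real.arccos (1 - x / 2)) = 1 - x / 2 :=
    Real.cos_arccos (by linarith) (by linarith)
  rw [rootOne]
  generalize Real.arccos (1 - x / 2) = θ at *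
  obtain ⟨h0, hπ⟩ := hθ
  have c1 : Real.cos (1 / 3 * θ) < 1 := by
    have := Real.cos_lt_cos_of_nonneg_of_le_pi_div_two (x := 0) (y := 1 / 3 * θ) le_rfl
      (by linarith) (by linarith)
    rwa [Real.cos_zero] at this
  have c2 : 1 / 2 < Real.cos (1 / 3 * θ) := by
    rw [← Real.cos_pi_div_three]
    exact Real.cos_lt_cos_of_nonneg_of_le_pi_div_two (by linarith) (by linarith) (by linarith)
  refine ⟨⟨by linarith, by linarith⟩, ?_, ?_, ?_⟩
  · rw [cubic_neg_two_mul_cos, show 3 * (1 / 3 * θ) = θ by ring, hcos]; ring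
  · rw [← two_sub_two_mul_cos, show 2 * (1 / 6 * θ) = 1 / 3 * θ by ring]
  · exact Real.sin_pos_of_pos_of_lt_pi (by linarith) (by linarith)

lemma rootTwo_spec (hx : 0 < x) (hx4 : x < 4) :
    rootTwo x ∈ Ioo (-1) 1 ∧ (rootTwo x - 1) ^ 2 * (rootTwo x + 2) = x ∧
      rootTwo x + 2 = 4 * Real.sin (1 / 6 * Real.pi + 1 / 6 * Real.arccos (-1 + x / 2)) ^ 2 ∧
      0 < Real.sin (1 / 6 * Real.pi + 1 / 6 * Real.arccos (-1 + x / 2)) := by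
  have hθ := arccos_mem_Ioo (y := -1 + x / 2) (by linarith) (by linarith)
  have hcos : Real.cos (Real.arccos (-1 + x / 2)) = -1 + x / 2 :=
    Real.cos_arccos (by linarith) (by linarith)
  rw [rootTwo]
  generalize Real.arccos (-1 + x / 2) = θ at *
  obtain ⟨h0, hπ⟩ := hθ
  have c1 : Real.cos (1 / 3 * Real.pi + 1 / 3 * θ) < 1 / 2 := by
    rw [← Real.cos_pi_div_three]
    exact Real.cos_lt_cos_of_nonneg_of_le_pi (by positivity) (by linarith) (by linarith)
  have c2 : -(1 / 2) < Real.cos (1 / 3 * Real.pi + 1 / 3 * θ) := by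
    rw [← Real.cos_pi_div_three, ← Real.cos_pi_sub]
    exact Real.cos_lt_cos_of_nonneg_of_le_pi (by linarith) (by linarith) (by linarith)
  refine ⟨⟨by linarith, by linarith⟩, ?_, ?_, ?_⟩
  · rw [cubic_neg_two_mul_cos, show 3 * (1 / 3 * Real.pi + 1 / 3 * θ) = θ + Real.pi by ring,
      Real.cos_add_pi, hcos]
    ring
  · rw [← two_sub_two_mul_cos,
      show 2 * (1 / 6 * Real.pi + 1 / 6 * θ) = 1 / 3 * Real.pi + 1 / 3 * θ by ring]
  · exact Real.sin_pos_of_pos_of_lt_pi (by linarith) (by linarith)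

lemma rootThree_spec_of_le (hx : 0 < x) (hx4 : x ≤ 4) :
    rootThree x = 2 * Real.cos (1 / 3 * Real.arccos (-1 + x / 2)) ∧
      rootThree x ∈ Ioi 1 ∧ (rootThree x - 1) ^ 2 * (rootThree x + 2) = x ∧
      rootThree x + 2 = 4 * Real.cos (1 / 6 * Real.arccos (-1 + x / 2)) ^ 2 ∧
      0 < Real.cos (1 / 6 * Real.arccos (-1 + x / 2)) := by
  have h0 : 0 ≤ Real.arccos (-1 + x / 2) := Real.arccos_nonneg _
  have hπ : Real.arccos (-1 + x / 2) < Real.pi :=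
    lt_of_le_of_ne (Real.arccos_le_pi _) fun h => by
      rw [Real.arccos_eq_pi] at h; linarith
  have hcos : Real.cos (Real.arccos (-1 + x / 2)) = -1 + x / 2 :=
    Real.cos_arccos (by linarith) (by linarith)
  rw [rootThree, if_pos hx4]
  generalize Real.arccos (-1 + x / 2) = θ at *
  have c2 : 1 / 2 < Real.cos (1 / 3 * θ) := by
    rw [← Real.cos_pi_div_three]
    exact Real.cos_lt_cos_of_nonneg_of_le_pi_div_two (by linarith) (by linarith) (by linarith)
  refine ⟨rfl, ?_, ?_, ?_, ?_⟩
  · rw [mem_Ioi]; linarith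
  · rw [cubic_two_mul_cos, show 3 * (1 / 3 * θ) = θ by ring, hcos]; ring
  · rw [← two_add_two_mul_cos, show 2 * (1 / 6 * θ) = 1 / 3 * θ by ring]
  · exact Real.cos_pos_of_mem_Ioo ⟨by linarith, by linarith⟩

lemma rootThree_spec_of_gt (hx4 : 4 < x) :
    rootThree x = 2 * Real.cosh (1 / 3 * Real.arcosh (-1 + x / 2)) ∧
      rootThree x ∈ Ioi 1 ∧ (rootThree x - 1) ^ 2 * (rootThree x + 2) = x ∧
      rootThree x + 2 = 4 * Real.cosh (1 / 6 * Real.arcosh (-1 + x / 2)) ^ 2 ∧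
      0 < Real.cosh (1 / 6 * Real.arcosh (-1 + x / 2)) := by
  have hcosh : Real.cosh (Real.arcosh (-1 + x / 2)) = -1 + x / 2 :=
    Real.cosh_arcosh (by linarith)
  rw [rootThree, if_neg (not_le.2 hx4)]
  generalize Real.arcosh (-1 + x / 2) = θ at *
  refine ⟨rfl, ?_, ?_, ?_, Real.cosh_pos _⟩
  · have := Real.one_le_cosh (1 / 3 * θ)
    rw [mem_Ioi]; linarith
  · rw [show θ = 3 * (1 / 3 * θ) by ring, Real.cosh_three_mul] at hcosh
    linear_combination 2 * hcosh
  · have := Real.cosh_two_mul (1 / 6 * θ)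
    rw [Real.sinh_sq, show 2 * (1 / 6 * θ) = 1 / 3 * θ by ring] at this
    rw [this]; ring

lemma rootThree_spec (hx : 0 < x) :
    rootThree x ∈ Ioi 1 ∧ (rootThree x - 1) ^ 2 * (rootThree x + 2) = x := by
  rcases le_or_gt x 4 with h | h
  · obtain ⟨-, h1, h2, -⟩ := rootThree_spec_of_le hx h
    exact ⟨h1, h2⟩
  · obtain ⟨-, h1, h2, -⟩ := rootThree_spec_of_gt h
    exact ⟨h1, h2⟩

end Roots

/-! ### The list of solutions for `a = σ² / 8` -/

section Listed

variable {σ b c d S t : ℝ}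

/-- The additive constant by which the listed trigonometric forms differ from `profile`. -/
def trigShift (b x : ℝ) : ℝ := (2 + 2 * Real.log 4 - 2 / 3 * (Real.log x - Real.log 4)) / b

lemma eVar_eq (σ t : ℝ) (hS : 0 < S) : eVar σ S t = Real.exp (3 / 2 * zVar (σ ^ 2 / 8) S t) := by
  rw [eVar, Real.rpow_def_of_pos hS, ← Real.exp_add, zVar]
  ring_nf

lemma eVar_pos (σ t : ℝ) (hS : 0 < S) : 0 < eVar σ S t := by
  rw [eVar_eq σ t hS]; exact Real.exp_pos _

/-- Elimination of `z` from the trigonometric forms: the cubic equation for `P` expresses `z` through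
`log (P - 1)` and `log w`, where `P + 2 = 4 w²`. -/
lemma trig_form_eq_profile (hb : b ≠ 0) {P w x z : ℝ} (hx : 0 < x) (hw : 0 < w)
    (hP : (P - 1) ^ 2 * (P + 2) = x * Real.exp (3 / 2 * z)) (h2 : P + 2 = 4 * w ^ 2) (d : ℝ) :
    1 / b * z - 2 / b * (P ^ 2 / 2 - 1) - 4 / (3 * b) * Real.log (P - 1)
      - 16 / (3 * b) * Real.log w + d = profile b (d + trigShift b x) P := by
  have h1 : P - 1 ≠ 0 := by
    intro h
    rw [h] at hP
    have : 0 < x * Real.exp (3 / 2 * z) := by positivity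
    norm_num at hP
    exact hx.ne' hP
  have l2 : Real.log (P + 2) = Real.log 4 + 2 * Real.log w := by
    rw [h2, Real.log_mul (by norm_num) (by positivity), Real.log_pow]; norm_num
  have l := congrArg Real.log hP
  rw [Real.log_mul (by positivity) (by rw [h2]; positivity), Real.log_pow, l2,
    Real.log_mul hx.ne' (Real.exp_pos _).ne', Real.log_exp] at l
  push_cast at l
  rw [profile, trigShift, l2]
  field_simp
  linear_combination -2 * l

lemma zVar_eq (σ S t : ℝ) : Real.log S + σ ^ 2 / 8 * t = zVar (σ ^ 2 / 8) S t := rfl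

lemma solPos_eq (hb : b ≠ 0) (hc : 0 < c) (hS : 0 < S) :
    solPos σ b c d S t = profile b (d + 2 / b) (rootPos (c * eVar σ S t)) := by
  have hE := eVar_pos σ t hS
  have hs0 : 0 ≤ √(2 * (c * eVar σ S t) + (c * eVar σ S t) ^ 2) := Real.sqrt_nonneg _
  have hX : xVar σ c S t = 1 + c * eVar σ S t
      + √(2 * (c * eVar σ S t) + (c * eVar σ S t) ^ 2) := by
    rw [xVar]; ring_nf
  have hx := mul_pos hc hE
  have hX0 : 0 < xVar σ c S t := by rw [hX]; linarith
  rw [solPos, profile, rootPos, ← hX]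
  generalize xVar σ c S t = X at *
  obtain ⟨y, hy⟩ : ∃ y, y = X ^ (1 / 3 : ℝ) := ⟨_, rfl⟩
  have hy0 : 0 < y := by rw [hy]; positivity
  have e2 : X ^ (2 / 3 : ℝ) = y ^ 2 := by
    rw [hy, ← Real.rpow_natCast, ← Real.rpow_mul hX0.le]; norm_num
  rw [Real.rpow_neg hX0.le, Real.rpow_neg hX0.le, e2, ← hy,
    show -(y⁻¹ + y) + 2 = -(y⁻¹ + y - 2) by ring, Real.log_neg_eq_log]
  field_simp
  ring

lemma solOne_eq (hb : b ≠ 0) (hc : c ≠ 0) (hS : 0 < S) (h4 : |c| * eVar σ S t < 4) :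
    solOne σ b c d S t = profile b (d + trigShift b |c|) (rootOne (|c| * eVar σ S t)) := by
  have hc' := abs_pos.2 hc
  obtain ⟨-, h1, h2, h3⟩ := rootOne_spec (mul_pos hc' (eVar_pos σ t hS)) h4
  rw [← trig_form_eq_profile hb hc' h3 (z := zVar (σ ^ 2 / 8) S t)
    (by rw [h1, eVar_eq σ t hS]) h2, solOne, rootOne]
  simp only [zVar_eq, mul_div_right_comm]
  rw [← Real.log_neg_eq_log (_ - 1)]
  generalize Real.arccos (1 - |c| / 2 * eVar σ S t) = θ
  rw [show 2 / 3 * θ = 2 * (1 / 3 * θ) by ring, Real.cos_two_mul]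
  ring_nf

lemma solTwo_eq (hb : b ≠ 0) (hc : c ≠ 0) (hS : 0 < S) (h4 : |c| * eVar σ S t < 4) :
    solTwo σ b c d S t = profile b (d + trigShift b |c|) (rootTwo (|c| * eVar σ S t)) := by
  have hc' := abs_pos.2 hc
  obtain ⟨-, h1, h2, h3⟩ := rootTwo_spec (mul_pos hc' (eVar_pos σ t hS)) h4
  rw [← trig_form_eq_profile hb hc' h3 (z := zVar (σ ^ 2 / 8) S t)
    (by rw [h1, eVar_eq σ t hS]) h2, solTwo, rootTwo]
  simp only [zVar_eq, mul_div_right_comm]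
  rw [← Real.log_neg_eq_log (_ - 1)]
  generalize Real.arccos (-1 + |c| / 2 * eVar σ S t) = θ
  rw [show 2 / 3 * Real.pi + 2 / 3 * θ = 2 * (1 / 3 * Real.pi + 1 / 3 * θ) by ring,
    Real.cos_two_mul]
  ring_nf

lemma solThreeOne_eq (hb : b ≠ 0) (hc : c ≠ 0) (hS : 0 < S) (h4 : |c| * eVar σ S t ≤ 4) :
    solThreeOne σ b c d S t = profile b (d + trigShift b |c|) (rootThree (|c| * eVar σ S t)) := by
  have hc' := abs_pos.2 hc
  obtain ⟨h0, -, h1, h2, h3⟩ := rootThree_spec_of_le (mul_pos hc' (eVar_pos σ t hS)) h4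
  rw [← trig_form_eq_profile hb hc' h3 (z := zVar (σ ^ 2 / 8) S t)
    (by rw [h1, eVar_eq σ t hS]) h2, solThreeOne, h0]
  simp only [zVar_eq, mul_div_right_comm]
  generalize Real.arccos (-1 + |c| / 2 * eVar σ S t) = θ
  rw [show 2 / 3 * θ = 2 * (1 / 3 * θ) by ring, Real.cos_two_mul]
  ring_nf

lemma solThreeTwo_eq (hb : b ≠ 0) (hc : c ≠ 0) (hS : 0 < S) (h4 : 4 < |c| * eVar σ S t) :
    solThreeTwo σ b c d S t = profile b (d + trigShift b |c|) (rootThree (|c| * eVar σ S t)) := by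
  have hc' := abs_pos.2 hc
  obtain ⟨h0, -, h1, h2, h3⟩ := rootThree_spec_of_gt h4
  rw [← trig_form_eq_profile hb hc' h3 (z := zVar (σ ^ 2 / 8) S t)
    (by rw [h1, eVar_eq σ t hS]) h2, solThreeTwo, h0]
  simp only [zVar_eq, mul_div_right_comm]
  generalize Real.arcosh (-1 + |c| / 2 * eVar σ S t) = θ
  have := Real.cosh_two_mul (1 / 3 * θ)
  rw [Real.sinh_sq] at this
  rw [show 2 / 3 * θ = 2 * (1 / 3 * θ) by ring, this]
  ring_nf

/-- The list of solutions in terms of the parameter `P`. -/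
lemma isListed_iff (hb : b ≠ 0) {U : Set (ℝ × ℝ)} (hpos : ∀ x ∈ U, 0 < x.1) (u : ℝ → ℝ → ℝ) :
    IsListed σ b c d U u ↔
    (0 < c ∧ ∀ S t : ℝ, (S, t) ∈ U →
      u S t = profile b (d + 2 / b) (rootPos (c * eVar σ S t))) ∨
    (c < 0 ∧ ∀ S t : ℝ, (S, t) ∈ U → |c| * eVar σ S t < 4 ∧
      u S t = profile b (d + trigShift b |c|) (rootOne (|c| * eVar σ S t))) ∨
    (c < 0 ∧ ∀ S t : ℝ, (S, t) ∈ U → |c| * eVar σ S t < 4 ∧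
      u S t = profile b (d + trigShift b |c|) (rootTwo (|c| * eVar σ S t))) ∨
    (c < 0 ∧ ∀ S t : ℝ, (S, t) ∈ U →
      u S t = profile b (d + trigShift b |c|) (rootThree (|c| * eVar σ S t))) ∨
    (∀ S t : ℝ, (S, t) ∈ U → u S t = d) ∨
    (∀ S t : ℝ, (S, t) ∈ U → u S t = -(3 / b) * zVar (σ ^ 2 / 8) S t + d) ∨
    (∀ S t : ℝ, (S, t) ∈ U → u S t = 1 / b * zVar (σ ^ 2 / 8) S t + d) := by
  have hz : ∀ S t : ℝ, Real.log S + σ ^ 2 * t / 8 = zVar (σ ^ 2 / 8) S t := fun S t => by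
    rw [zVar]; ring
  simp only [IsListed, hz]
  refine or_congr ?_ (or_congr ?_ (or_congr ?_ (or_congr ?_ Iff.rfl)))
  · refine and_congr_right fun hc => forall₃_congr fun S t hx => ?_
    rw [solPos_eq hb hc (hpos _ hx)]
  · refine and_congr_right fun hc => forall₃_congr fun S t hx => and_congr_right fun h4 => ?_
    rw [solOne_eq hb hc.ne (hpos _ hx) h4]
  · refine and_congr_right fun hc => forall₃_congr fun S t hx => and_congr_right fun h4 => ?_
    rw [solTwo_eq hb hc.ne (hpos _ hx) h4]
  · refine and_congr_right fun hc => forall₃_congr fun S t hx => ?_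
    constructor
    · rintro ⟨h1, h2⟩
      rcases le_or_gt (|c| * eVar σ S t) 4 with h4 | h4
      · rw [h1 h4, solThreeOne_eq hb hc.ne (hpos _ hx) h4]
      · rw [h2 h4, solThreeTwo_eq hb hc.ne (hpos _ hx) h4]
    · intro h
      exact ⟨fun h4 => by rw [h, solThreeOne_eq hb hc.ne (hpos _ hx) h4],
        fun h4 => by rw [h, solThreeTwo_eq hb hc.ne (hpos _ hx) h4]⟩

lemma cubic_lt_four {P : ℝ} (h1 : P ≠ -1) (h2 : P < 2) : (P - 1) ^ 2 * (P + 2) < 4 := by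
  have : 0 < (P + 1) ^ 2 := by
    have : P + 1 ≠ 0 := fun h => h1 (eq_neg_of_add_eq_zero_left h)
    positivity
  nlinarith

/-- The complete set of invariant solutions for `k = 1`, `a = σ² / 8`. -/
lemma isInvariantSolution_iff_isListed {ρ om : ℝ} (hσ : σ ≠ 0) (hb : ρ * om ≠ 0)
    {U : Set (ℝ × ℝ)} {u : ℝ → ℝ → ℝ} (hU : IsAdmissible (σ ^ 2 / 8) U) :
    IsInvariantSolution σ ρ (powerLaw om 1) (scalingGen (σ ^ 2 / 8) 1) U u ↔
      ∃ c d : ℝ, IsListed σ (ρ * om) c d U u := by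
  have ha : σ ^ 2 / 8 ≠ 0 := by positivity
  have hq : σ ^ 2 / (2 * (σ ^ 2 / 8)) = 4 := by field_simp; norm_num
  have hpos := hU.2.2.1
  have hI := hU.isOpen_zImage
  have hzm : ∀ {S t}, (S, t) ∈ U → zVar (σ ^ 2 / 8) S t ∈ zImage (σ ^ 2 / 8) U :=
    fun h => ⟨_, h, rfl⟩
  rw [isInvariantSolution_iff_exists_profile hU]
  simp only [solvesReduced_one_iff ha hb, hq, sub_self, Real.rpow_zero, one_mul]
  simp only [isListed_iff hb hpos]
  generalize ρ * om = b at *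
  constructor
  · rintro ⟨v, hv, hred, huv⟩
    rcases reduced_four_cases hb hI hU.ordConnected_zImage hU.nonempty_zImage hv hred with
      ⟨d, h⟩ | ⟨d, h⟩ | ⟨d, h⟩ | ⟨R, c, d, P, hP, hR⟩
    · refine ⟨0, d, ?_⟩
      iterate 4 right
      left
      intro S t hx
      rw [huv S t hx, h _ (hzm hx)]
    · refine ⟨0, d, ?_⟩
      iterate 5 right
      left
      intro S t hx
      rw [huv S t hx, h _ (hzm hx)]
    · refine ⟨0, d, ?_⟩
      iterate 6 right
      intro S t hx
      rw [huv S t hx, h _ (hzm hx)]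
    · have hPe : ∀ S t, (S, t) ∈ U → (P (zVar (σ ^ 2 / 8) S t) - 1) ^ 2
          * (P (zVar (σ ^ 2 / 8) S t) + 2) = c * eVar σ S t := fun S t hx => by
        rw [(hP _ (hzm hx)).2.1, eVar_eq σ t (hpos _ hx)]
      -- on a branch the parameter is determined by the cubic equation
      have huniq : IsBranch R → ∀ S t r, (S, t) ∈ U → r ∈ R →
          (r - 1) ^ 2 * (r + 2) = c * eVar σ S t → P (zVar (σ ^ 2 / 8) S t) = r :=
        fun hB S t r hx hr h => hB.injOn (hP _ (hzm hx)).1 hr ((hPe S t hx).trans h.symm)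
      have hval : ∀ S t, (S, t) ∈ U → u S t = profile b d (P (zVar (σ ^ 2 / 8) S t)) :=
        fun S t hx => by rw [huv S t hx, (hP _ (hzm hx)).2.2]
      rcases hR with ⟨hc, rfl⟩ | ⟨hc, hR⟩
      · have hc2 : 0 < -c / 2 := by linarith
        refine ⟨-c / 2, d - 2 / b, Or.inl ⟨hc2, fun S t hx => ?_⟩⟩
        obtain ⟨h1, h2⟩ := rootPos_spec (mul_pos hc2 (eVar_pos σ t (hpos _ hx)))
        rw [hval S t hx, huniq isBranch_Iio S t _ hx h1 (h2.trans (by ring)), sub_add_cancel]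
      · have habs : |-c| = c := by rw [abs_neg, abs_of_pos hc]
        have hE : ∀ S t, (S, t) ∈ U → 0 < c * eVar σ S t := fun S t hx =>
          mul_pos hc (eVar_pos σ t (hpos _ hx))
        refine ⟨-c, d - trigShift b c, Or.inr ?_⟩
        simp only [habs, sub_add_cancel, neg_neg_iff_pos, hc, true_and]
        rcases hR with rfl | rfl | rfl
        · left
          intro S t hx
          have hm := (hP _ (hzm hx)).1
          have h4 : c * eVar σ S t < 4 := by
            rw [← hPe S t hx]
            exact cubic_lt_four hm.2.ne (by linarith [hm.2])
          obtain ⟨h1, h2, -⟩ := rootOne_spec (hE S t hx) h4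
          exact ⟨h4, by rw [hval S t hx, huniq isBranch_left S t _ hx h1 h2]⟩
        · right; left
          intro S t hx
          have hm := (hP _ (hzm hx)).1
          have h4 : c * eVar σ S t < 4 := by
            rw [← hPe S t hx]
            exact cubic_lt_four hm.1.ne' (by linarith [hm.2])
          obtain ⟨h1, h2, -⟩ := rootTwo_spec (hE S t hx) h4
          exact ⟨h4, by rw [hval S t hx, huniq isBranch_middle S t _ hx h1 h2]⟩
        · right; right; left
          intro S t hx
          obtain ⟨h1, h2⟩ := rootThree_spec (hE S t hx)
          rw [hval S t hx, huniq isBranch_Ioi S t _ hx h1 h2]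
  · rintro ⟨c, d, h⟩
    have back : ∀ {R : Set ℝ} {c₀ d₀ : ℝ} {P : ℝ → ℝ}, IsBranch R → c₀ ≠ 0 →
        (∀ S t, (S, t) ∈ U → P (eVar σ S t) ∈ R ∧
          (P (eVar σ S t) - 1) ^ 2 * (P (eVar σ S t) + 2) = c₀ * eVar σ S t) →
        (∀ S t, (S, t) ∈ U → u S t = profile b d₀ (P (eVar σ S t))) →
        ∃ v : ℝ → ℝ, ContDiffOn ℝ ∞ v (zImage (σ ^ 2 / 8) U) ∧
          (∀ z ∈ zImage (σ ^ 2 / 8) U, ReducedAt 4 (b * deriv v z) (b * deriv (deriv v) z)) ∧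
          ∀ S t : ℝ, (S, t) ∈ U → u S t = v (zVar (σ ^ 2 / 8) S t) := by
      intro R c₀ d₀ P hR hc₀ hP hu
      have hsol := profile_solves (d := d₀) hb hc₀ hR hI (P := fun z => P (Real.exp (3 / 2 * z)))
        (fun z hz => by
          obtain ⟨⟨S, t⟩, hx, rfl⟩ := hz
          have := hP S t hx
          rwa [eVar_eq σ t (hpos _ hx)] at this)
      refine ⟨_, hsol.1, hsol.2, fun S t hx => ?_⟩
      rw [hu S t hx, eVar_eq σ t (hpos _ hx)]
    have backaff : ∀ {C : ℝ}, (1 + b * C ≠ 0 ∧ b * C * ((1 + b * C) ^ 2 - 4) = 0) →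
        (∀ S t, (S, t) ∈ U → u S t = C * zVar (σ ^ 2 / 8) S t + d) →
        ∃ v : ℝ → ℝ, ContDiffOn ℝ ∞ v (zImage (σ ^ 2 / 8) U) ∧
          (∀ z ∈ zImage (σ ^ 2 / 8) U, ReducedAt 4 (b * deriv v z) (b * deriv (deriv v) z)) ∧
          ∀ S t : ℝ, (S, t) ∈ U → u S t = v (zVar (σ ^ 2 / 8) S t) := by
      intro C hC hu
      refine ⟨fun z => C * z + d, by fun_prop, reducedAt_of_deriv_const hI (C := C)
        (fun z _ => ?_) hC, hu⟩
      exact (((hasDerivAt_id z).const_mul C).add_const d).deriv.trans (mul_one C)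
    rcases h with ⟨hc, h⟩ | ⟨hc, h⟩ | ⟨hc, h⟩ | ⟨hc, h⟩ | h | h | h
    · refine back (P := fun E => rootPos (c * E)) (c₀ := -(2 * c)) isBranch_Iio
        (neg_ne_zero.2 (mul_ne_zero two_ne_zero hc.ne')) (fun S t hx => ?_) h
      obtain ⟨h1, h2⟩ := rootPos_spec (mul_pos hc (eVar_pos σ t (hpos _ hx)))
      exact ⟨h1, h2.trans (by ring)⟩
    · refine back (P := fun E => rootOne (|c| * E)) (c₀ := |c|) isBranch_left
        (abs_pos.2 hc.ne).ne' (fun S t hx => ?_) fun S t hx => (h S t hx).2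
      obtain ⟨h1, h2, -⟩ := rootOne_spec (mul_pos (abs_pos.2 hc.ne) (eVar_pos σ t (hpos _ hx)))
        (h S t hx).1
      exact ⟨h1, h2⟩
    · refine back (P := fun E => rootTwo (|c| * E)) (c₀ := |c|) isBranch_middle
        (abs_pos.2 hc.ne).ne' (fun S t hx => ?_) fun S t hx => (h S t hx).2
      obtain ⟨h1, h2, -⟩ := rootTwo_spec (mul_pos (abs_pos.2 hc.ne) (eVar_pos σ t (hpos _ hx)))
        (h S t hx).1
      exact ⟨h1, h2⟩
    · exact back (P := fun E => rootThree (|c| * E)) (c₀ := |c|) isBranch_Ioi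
        (abs_pos.2 hc.ne).ne'
        (fun S t hx => rootThree_spec (mul_pos (abs_pos.2 hc.ne) (eVar_pos σ t (hpos _ hx)))) h
    · exact backaff (C := 0) (by norm_num) fun S t hx => by rw [h S t hx]; ring
    · refine backaff (C := -(3 / b)) ?_ h
      have e : b * -(3 / b) = -3 := by field_simp
      rw [e]; norm_num
    · refine backaff (C := 1 / b) ?_ h
      have e : b * (1 / b) = 1 := by field_simp
      rw [e]; norm_num

end Listed

/-! ### The action of the symmetry group -/

section Group

/-- A primitive of `exp (β ε)` that vanishes at zero. -/
lemma exists_primitive_exp (β : ℝ) :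
    ∃ K : ℝ → ℝ, K 0 = 0 ∧ K 1 ≠ 0 ∧ ∀ ε, HasDerivAt K (Real.exp (β * ε)) ε := by
  by_cases hβ : β = 0
  · refine ⟨id, rfl, one_ne_zero, fun ε => ?_⟩
    simpa [hβ] using hasDerivAt_id ε
  · refine ⟨fun ε => (Real.exp (β * ε) - 1) / β, by simp, ?_, fun ε => ?_⟩
    · simp [hβ, sub_eq_zero]
    · refine ((((hasDerivAt_id ε).const_mul β).exp.sub_const 1).div_const β).congr_deriv ?_
      simp only [id]
      field_simp

/-- The symmetry group of the equation with `λ(S) = ω S`. -/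
lemma mem_symmetryGroup_iff {σ ρ om : ℝ} (hσ : σ ≠ 0) (hρ : ρ ≠ 0) (hom : om ≠ 0)
    (g : ℝ × ℝ × ℝ → ℝ × ℝ × ℝ) :
    g ∈ symmetryGroup σ ρ (powerLaw om 1) ↔ ∃ μ κ d e : ℝ, 0 < μ ∧ ∀ x : ℝ × ℝ × ℝ, 0 < x.1 →
      g x = (x.1 * μ, x.2.1 + κ, x.2.2 + d + e * x.1) := by
  rw [symmetryGroup, mem_ofPred_eq]
  simp only [isPointSymmetry_powerLaw_iff hσ hρ hom isOpen_univ ordConnected_univ univ_nonempty]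
  constructor
  · rintro ⟨V, ⟨β, κ, e, d, hV⟩, hflow⟩
    obtain ⟨K, hK0, -, hK⟩ := exists_primitive_exp β
    refine ⟨Real.exp β, κ, d, e * K 1, Real.exp_pos β, fun x hx => ?_⟩
    obtain ⟨γ, h0, h1, hγ⟩ := hflow x hx
    have hd : ∀ ε, HasDerivAt γ (β * (γ ε).1, κ, e * (γ ε).1 + d) ε := fun ε => by
      obtain ⟨hpos, hd⟩ := hγ ε
      obtain ⟨e1, e2, e3⟩ := hV (γ ε).1 (γ ε).2.1 (γ ε).2.2 hpos (mem_univ _)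
      rw [e1, e2, e3] at hd
      simpa using hd
    have d1 : ∀ ε, HasDerivAt (fun ε => (γ ε).1) (β * (γ ε).1) ε := fun ε =>
      (ContinuousLinearMap.fst ℝ ℝ (ℝ × ℝ)).hasFDerivAt.comp_hasDerivAt ε (hd ε)
    have d23 : ∀ ε, HasDerivAt (fun ε => (γ ε).2) (κ, e * (γ ε).1 + d) ε := fun ε =>
      (ContinuousLinearMap.snd ℝ ℝ (ℝ × ℝ)).hasFDerivAt.comp_hasDerivAt ε (hd ε)
    have d2 : ∀ ε, HasDerivAt (fun ε => (γ ε).2.1) κ ε := fun ε =>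
      (ContinuousLinearMap.fst ℝ ℝ ℝ).hasFDerivAt.comp_hasDerivAt ε (d23 ε)
    have d3 : ∀ ε, HasDerivAt (fun ε => (γ ε).2.2) (e * (γ ε).1 + d) ε := fun ε =>
      (ContinuousLinearMap.snd ℝ ℝ ℝ).hasFDerivAt.comp_hasDerivAt ε (d23 ε)
    have s1 : ∀ ε, (γ ε).1 = x.1 * Real.exp (β * ε) := fun ε => by
      have := eq_of_hasDerivAt_zero (f := fun ε => (γ ε).1 * Real.exp (-(β * ε))) ordConnected_univ
        (fun r _ => ((d1 r).mul ((hasDerivAt_id r).const_mul β).neg.exp).congr_deriv (by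
          simp only [id, Pi.neg_apply]; ring)) (mem_univ ε) (mem_univ 0)
      simp only [h0, mul_zero, neg_zero, Real.exp_zero, mul_one] at this
      rw [← this, mul_assoc, ← Real.exp_add]
      simp
    have s2 : (γ 1).2.1 = x.2.1 + κ := by
      have := eq_of_hasDerivAt_zero (f := fun ε => (γ ε).2.1 - κ * ε) ordConnected_univ
        (fun r _ => ((d2 r).sub ((hasDerivAt_id r).const_mul κ)).congr_deriv (by ring))
        (mem_univ 1) (mem_univ 0)
      simp only [h0] at this
      linarith
    have s3 : (γ 1).2.2 = x.2.2 + d + e * K 1 * x.1 := by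
      have := eq_of_hasDerivAt_zero (f := fun ε => (γ ε).2.2 - (d * ε + e * x.1 * K ε))
        ordConnected_univ
        (fun r _ => ((d3 r).sub (((hasDerivAt_id r).const_mul d).add
          ((hK r).const_mul (e * x.1)))).congr_deriv (by rw [s1 r]; ring))
        (mem_univ 1) (mem_univ 0)
      simp only [h0, hK0] at this
      linarith
    rw [← h1]
    refine Prod.ext ?_ (Prod.ext s2 s3)
    rw [s1 1, mul_one]
  · rintro ⟨μ, κ, d, e, hμ, hg⟩
    obtain ⟨K, hK0, hK1, hK⟩ := exists_primitive_exp (Real.log μ)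
    refine ⟨⟨fun S _ _ => Real.log μ * S, fun _ _ _ => κ, fun S _ _ => e / K 1 * S + d⟩,
      ⟨Real.log μ, κ, e / K 1, d, fun S t u _ _ => ⟨rfl, rfl, by ring⟩⟩, fun x hx =>
      ⟨fun ε => (x.1 * Real.exp (Real.log μ * ε), x.2.1 + κ * ε,
        x.2.2 + (d * ε + e / K 1 * x.1 * K ε)), ?_, ?_, fun ε => ⟨by positivity, ?_⟩⟩⟩
    · simp [hK0]
    · rw [hg x hx]
      refine Prod.ext ?_ (Prod.ext ?_ ?_)
      · simp [Real.exp_log hμ]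
      · simp
      · simp only
        field_simp
        ring
    · refine HasDerivAt.prodMk ?_ (HasDerivAt.prodMk ?_ ?_)
      · refine (((hasDerivAt_id ε).const_mul (Real.log μ)).exp.const_mul x.1).congr_deriv ?_
        simp only [id]; ring
      · exact (((hasDerivAt_id ε).const_mul κ).const_add x.2.1).congr_deriv (mul_one κ)
      · refine ((((hasDerivAt_id ε).const_mul d).add
          ((hK ε).const_mul (e / K 1 * x.1))).const_add x.2.2).congr_deriv ?_
        simp only; ring

lemma scalingGen_one_iff {σ ρ a : ℝ} {lam : ℝ → ℝ} {U : Set (ℝ × ℝ)} {u : ℝ → ℝ → ℝ} :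
    IsInvariantSolution σ ρ lam (scalingGen a 1) U u ↔
      IsInvariantSolution σ ρ lam (shiftedGen a 0) U u := by
  simp [IsInvariantSolution, scalingGen, shiftedGen]

/-- Adding a multiple of `S` to an invariant solution. -/
lemma IsInvariantSolution.add_linear {σ ρ a e : ℝ} {lam : ℝ → ℝ} {U : Set (ℝ × ℝ)} (hU : IsOpen U)
    {u : ℝ → ℝ → ℝ} (h : IsInvariantSolution σ ρ lam (shiftedGen a e) U u) (α : ℝ) :
    IsInvariantSolution σ ρ lam (shiftedGen a (e - a * α)) U (fun S t => u S t + α * S) := by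
  have hS : ∀ S t, (S, t) ∈ U → uS (fun S t => u S t + α * S) S t = uS u S t + α := by
    intro S t hx
    have hd : DifferentiableAt ℝ (fun s => u s t) S :=
      ((h.1.1.contDiffAt (hU.mem_nhds hx)).differentiableAt (by simp)).comp
        (f := fun s : ℝ => (s, t)) S (by fun_prop)
    exact (hd.hasDerivAt.add ((hasDerivAt_id S).const_mul α)).deriv.trans (by rw [mul_one]; rfl)
  have hT : ∀ S t, uT (fun S t => u S t + α * S) S t = uT u S t := fun S t => by
    simp [uT]
  have hSS : ∀ S t, (S, t) ∈ U → uSS (fun S t => u S t + α * S) S t = uSS u S t := by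
    intro S t hx
    refine (Filter.EventuallyEq.deriv_eq (f := fun s => uS u s t + α)
      ((eventually_slice_S hU hx).mono fun s hs => hS s t hs)).trans ?_
    rw [deriv_add_const]
    rfl
  refine ⟨⟨h.1.1.add (g := fun x : ℝ × ℝ => α * x.1) (by fun_prop), fun S t hx => ?_⟩,
    fun S t hx => ?_⟩
  · rw [hSS S t hx, hT]
    exact h.1.2 S t hx
  · have := h.2 S t hx
    simp only [shiftedGen] at this ⊢
    rw [hS S t hx, hT]
    linear_combination this

lemma eVar_mul_add (σ κ t : ℝ) {S μ : ℝ} (hS : 0 < S) (hμ : 0 < μ) :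
    eVar σ (S * μ) (t + κ) = eVar σ μ κ * eVar σ S t := by
  rw [eVar, eVar, eVar, Real.mul_rpow hS.le hμ.le, mul_add, Real.exp_add]
  ring

lemma zVar_mul_add (a κ t : ℝ) {S μ : ℝ} (hS : 0 < S) (hμ : 0 < μ) :
    zVar a (S * μ) (t + κ) = zVar a S t + zVar a μ κ := by
  rw [zVar, zVar, zVar, Real.log_mul hS.ne' hμ.ne']
  ring

/-- Scalings of `S` and translations of `t` and `u` preserve the list and rescale the
parameter `c`. -/
lemma IsListed.transform {σ b c d μ κ : ℝ} (hb : b ≠ 0) (hμ : 0 < μ) {U U' : Set (ℝ × ℝ)}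
    (hpos : ∀ x ∈ U, 0 < x.1) {u : ℝ → ℝ → ℝ} (hu : IsListed σ b c d U u) :
    ∃ d' : ℝ, ∀ (D : ℝ) (u' : ℝ → ℝ → ℝ),
      (∀ S t, (S, t) ∈ U' → 0 < S ∧ (S * μ, t + κ) ∈ U ∧ u' S t = u (S * μ) (t + κ) + D) →
      IsListed σ b (c * eVar σ μ κ) (d' + D) U' u' := by
  have hm := eVar_pos σ κ hμ
  have hE : ∀ {S t x : ℝ}, 0 < S →
      x * eVar σ (S * μ) (t + κ) = x * eVar σ μ κ * eVar σ S t := fun hS => by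
    rw [eVar_mul_add σ κ _ hS hμ]; ring
  have habs : |c * eVar σ μ κ| = |c| * eVar σ μ κ := by rw [abs_mul, abs_of_pos hm]
  have hprof : ∀ d D P, profile b d P + D = profile b (d + D) P := fun d D P => by
    rw [profile, profile]; ring
  rw [isListed_iff hb hpos] at hu
  rcases hu with ⟨hc, h⟩ | ⟨hc, h⟩ | ⟨hc, h⟩ | ⟨hc, h⟩ | h | h | h
  · refine ⟨d, fun D u' hu' => ?_⟩
    rw [isListed_iff hb fun x hx => (hu' x.1 x.2 hx).1]
    refine Or.inl ⟨mul_pos hc hm, fun S t hx => ?_⟩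
    obtain ⟨hS, hxU, e⟩ := hu' S t hx
    rw [e, h _ _ hxU, hE hS, hprof, add_right_comm]
  · refine ⟨d + trigShift b |c| - trigShift b |c * eVar σ μ κ|, fun D u' hu' => ?_⟩
    rw [isListed_iff hb fun x hx => (hu' x.1 x.2 hx).1]
    refine Or.inr (Or.inl ⟨mul_neg_of_neg_of_pos hc hm, fun S t hx => ?_⟩)
    obtain ⟨hS, hxU, e⟩ := hu' S t hx
    obtain ⟨h4, hv⟩ := h _ _ hxU
    rw [hE hS, ← habs] at h4 hv
    exact ⟨h4, by rw [e, hv, hprof]; congr 1; ring⟩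
  · refine ⟨d + trigShift b |c| - trigShift b |c * eVar σ μ κ|, fun D u' hu' => ?_⟩
    rw [isListed_iff hb fun x hx => (hu' x.1 x.2 hx).1]
    refine Or.inr (Or.inr (Or.inl ⟨mul_neg_of_neg_of_pos hc hm, fun S t hx => ?_⟩))
    obtain ⟨hS, hxU, e⟩ := hu' S t hx
    obtain ⟨h4, hv⟩ := h _ _ hxU
    rw [hE hS, ← habs] at h4 hv
    exact ⟨h4, by rw [e, hv, hprof]; congr 1; ring⟩
  · refine ⟨d + trigShift b |c| - trigShift b |c * eVar σ μ κ|, fun D u' hu' => ?_⟩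
    rw [isListed_iff hb fun x hx => (hu' x.1 x.2 hx).1]
    refine Or.inr (Or.inr (Or.inr (Or.inl ⟨mul_neg_of_neg_of_pos hc hm, fun S t hx => ?_⟩)))
    obtain ⟨hS, hxU, e⟩ := hu' S t hx
    have hv := h _ _ hxU
    rw [hE hS, ← habs] at hv
    rw [e, hv, hprof]; congr 1; ring
  · refine ⟨d, fun D u' hu' => ?_⟩
    iterate 4 right
    left
    intro S t hx
    obtain ⟨hS, hxU, e⟩ := hu' S t hx
    rw [e, h _ _ hxU]
  · refine ⟨d - 3 / b * zVar (σ ^ 2 / 8) μ κ, fun D u' hu' => ?_⟩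
    rw [isListed_iff hb fun x hx => (hu' x.1 x.2 hx).1]
    iterate 5 right
    left
    intro S t hx
    obtain ⟨hS, hxU, e⟩ := hu' S t hx
    rw [e, h _ _ hxU, zVar_mul_add _ κ t hS hμ]
    ring
  · refine ⟨d + 1 / b * zVar (σ ^ 2 / 8) μ κ, fun D u' hu' => ?_⟩
    rw [isListed_iff hb fun x hx => (hu' x.1 x.2 hx).1]
    iterate 6 right
    intro S t hx
    obtain ⟨hS, hxU, e⟩ := hu' S t hx
    rw [e, h _ _ hxU, zVar_mul_add _ κ t hS hμ]
    ring

/-- The parameter `c` can be scaled to `1`, `0` or `-1`. -/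
lemma exists_scale (σ c : ℝ) : ∃ μ : ℝ, 0 < μ ∧ c * eVar σ μ 0 ∈ ({-1, 0, 1} : Set ℝ) := by
  by_cases hc : c = 0
  · exact ⟨1, one_pos, by simp [hc]⟩
  · have hc' : 0 < |c| := abs_pos.2 hc
    refine ⟨|c| ^ (-(2 / 3) : ℝ), by positivity, ?_⟩
    have e : eVar σ (|c| ^ (-(2 / 3) : ℝ)) 0 = |c|⁻¹ := by
      rw [eVar, ← Real.rpow_mul hc'.le, mul_zero, Real.exp_zero, mul_one]
      norm_num
      exact Real.rpow_neg_one _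
    rw [e]
    rcases lt_or_gt_of_ne hc with h | h
    · left
      rw [abs_of_neg h]
      field_simp
    · right; right
      rw [abs_of_pos h]
      exact mul_inv_cancel₀ hc

/-- Adding a multiple of `S` reduces the shifted generators to `scalingGen`, a scaling of `S`
normalizes `c`, and a translation of `u` normalizes `d`. -/
lemma shifted_iff_symmetryGroup {σ ρ om : ℝ} (hσ : σ ≠ 0) (hρ : ρ ≠ 0) (hom : om ≠ 0)
    {U : Set (ℝ × ℝ)} {u : ℝ → ℝ → ℝ} (hU : IsAdmissible (σ ^ 2 / 8) U) :
    (∃ e : ℝ, IsInvariantSolution σ ρ (powerLaw om 1) (shiftedGen (σ ^ 2 / 8) e) U u) ↔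
      ∃ g ∈ symmetryGroup σ ρ (powerLaw om 1), ∃ c ∈ ({-1, 0, 1} : Set ℝ),
        ∃ (W : Set (ℝ × ℝ)) (w : ℝ → ℝ → ℝ),
          (∀ x ∈ W, 0 < x.1) ∧ IsListed σ (ρ * om) c 0 W w ∧
          g '' graphOver w W = graphOver u U := by
  have ha : σ ^ 2 / 8 ≠ 0 := by positivity
  have hb : ρ * om ≠ 0 := mul_ne_zero hρ hom
  have hpos := hU.2.2.1
  constructor
  · rintro ⟨e, h⟩
    have h1 := h.add_linear hU.1 (e / (σ ^ 2 / 8))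
    rw [mul_div_cancel₀ _ ha, sub_self, ← scalingGen_one_iff,
      isInvariantSolution_iff_isListed hσ hb hU] at h1
    obtain ⟨c, d, hL⟩ := h1
    obtain ⟨μ, hμ, hμc⟩ := exists_scale σ c
    obtain ⟨d', hd'⟩ := hL.transform (U' := {x | 0 < x.1 ∧ (x.1 * μ, x.2) ∈ U}) (κ := 0) hb hμ hpos
    refine ⟨fun x => (x.1 * μ, x.2.1 + 0, x.2.2 + d' + -(e / (σ ^ 2 / 8)) * μ * x.1),
      (mem_symmetryGroup_iff hσ hρ hom _).2 ⟨μ, 0, d', _, hμ, fun _ _ => rfl⟩, _, hμc,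
      {x | 0 < x.1 ∧ (x.1 * μ, x.2) ∈ U},
      fun S t => u (S * μ) t + e / (σ ^ 2 / 8) * (S * μ) + -d', fun x hx => hx.1, ?_, ?_⟩
    · have := hd' (-d') (fun S t => u (S * μ) t + e / (σ ^ 2 / 8) * (S * μ) + -d')
        fun S t hx => ⟨hx.1, by rw [add_zero]; exact hx.2, by rw [add_zero]⟩
      rwa [add_neg_cancel] at this
    · ext ⟨S, t, y⟩
      constructor
      · rintro ⟨⟨S₀, t₀, y₀⟩, ⟨hx, hy⟩, heq⟩
        simp only [Prod.mk.injEq] at heq hy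
        obtain ⟨rfl, rfl, rfl⟩ := heq
        refine ⟨by simpa using hx.2, ?_⟩
        simp only [add_zero]
        rw [hy]
        ring
      · rintro ⟨hx, hy⟩
        have hS : 0 < S := hpos _ hx
        have hy : y = u S t := hy
        have eS : S / μ * μ = S := by field_simp
        refine ⟨(S / μ, t, u (S / μ * μ) t + e / (σ ^ 2 / 8) * (S / μ * μ) + -d'),
          ⟨⟨by positivity, by simpa [eS] using hx⟩, rfl⟩, ?_⟩
        refine Prod.ext eS (Prod.ext (add_zero t) ?_)
        simp only [eS]
        rw [hy, mul_assoc, mul_comm μ, eS]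
        ring
  · rintro ⟨g, hg, c, -, W, w, hW, hL, himg⟩
    obtain ⟨μ, κ, d, e, hμ, hg⟩ := (mem_symmetryGroup_iff hσ hρ hom g).1 hg
    have hmem : ∀ S t, (S, t) ∈ U → 0 < S ∧ (S * μ⁻¹, t + -κ) ∈ W ∧
        u S t + -(e * μ⁻¹) * S = w (S * μ⁻¹) (t + -κ) + d := by
      intro S t hx
      have hm : (S, t, u S t) ∈ graphOver u U := ⟨hx, rfl⟩
      rw [← himg] at hm
      obtain ⟨⟨S₀, t₀, y₀⟩, ⟨hx₀, hy₀⟩, heq⟩ := hm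
      rw [hg _ (hW _ hx₀)] at heq
      simp only [Prod.mk.injEq] at heq hy₀ hx₀
      obtain ⟨e1, e2, e3⟩ := heq
      have e1' : S * μ⁻¹ = S₀ := by rw [← e1]; field_simp
      have e2' : t + -κ = t₀ := by rw [← e2]; ring
      rw [e1', e2', ← e3, hy₀]
      exact ⟨hpos _ hx, hx₀, by rw [← e1']; ring⟩
    obtain ⟨d', hd'⟩ := hL.transform (U' := U) (κ := -κ) hb (inv_pos.2 hμ) hW
    have h1 := (isInvariantSolution_iff_isListed hσ hb hU).2 ⟨_, _, hd' d _ hmem⟩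
    rw [scalingGen_one_iff] at h1
    have h2 := h1.add_linear hU.1 (e * μ⁻¹)
    refine ⟨0 - σ ^ 2 / 8 * (e * μ⁻¹), ?_⟩
    convert h2 using 3
    ring

end Group

end IlliquidHedge

end

theorem theorem4p3 (σ ρ : ℝ) (hσ : 0 < σ) (hρ : 0 < ρ) :
    -- 1. Invariant solutions exist only for power laws.
    (∀ (lam : ℝ → ℝ) (J : Set ℝ), DifferentiableOn ℝ lam (Ioi 0) →
      IsOpen J → J.OrdConnected → J.Nonempty →
      ((∃ (V : VField) (U : Set (ℝ × ℝ)) (u : ℝ → ℝ → ℝ),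
          IsPointSymmetry σ ρ lam J V ∧ V.MovesS J ∧
          IsOpen U ∧ U.Nonempty ∧ U ⊆ Ioi 0 ×ˢ J ∧ IsInvariantSolution σ ρ lam V U u) →
        ∃ om k : ℝ, ∀ S : ℝ, 0 < S → lam S = powerLaw om k S) ∧
      ((∃ om k : ℝ, ∀ S : ℝ, 0 < S → lam S = powerLaw om k S) →
        ∃ (V : VField) (U : Set (ℝ × ℝ)) (u : ℝ → ℝ → ℝ),
          IsReducingSymmetry σ ρ lam J V ∧
          IsOpen U ∧ U.Nonempty ∧ U ⊆ Ioi 0 ×ˢ J ∧ IsInvariantSolution σ ρ lam V U u)) ∧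
    -- 2. For power laws the invariant solutions are given by first order equations.
    (∀ om k : ℝ, om ≠ 0 →
      -- the symmetries used for the reduction
      (∀ (J : Set ℝ) (V : VField), IsOpen J → J.OrdConnected → J.Nonempty →
        (IsReducingSymmetry σ ρ (powerLaw om k) J V ↔
          ∃ κ a : ℝ, κ ≠ 0 ∧ a ≠ 0 ∧ ∀ S t u : ℝ, 0 < S → t ∈ J →
            V.ξ S t u = κ * (scalingGen a k).ξ S t u ∧
            V.τ S t u = κ * (scalingGen a k).τ S t u ∧
            V.φ S t u = κ * (scalingGen a k).φ S t u)) ∧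
      ∀ a : ℝ, a ≠ 0 →
        -- invariant solutions are `u = S ^ (1 - k) v (log S + a t)`
        (∀ (U : Set (ℝ × ℝ)) (u : ℝ → ℝ → ℝ), IsAdmissible a U →
          (IsInvariantSolution σ ρ (powerLaw om k) (scalingGen a k) U u ↔
            ∃ v : ℝ → ℝ, ContDiffOn ℝ ∞ v (zImage a U) ∧
              SolvesReduced σ a (ρ * om) k (zImage a U) v ∧
              ∀ S t : ℝ, (S, t) ∈ U → u S t = S ^ (1 - k) * v (zVar a S t))) ∧
        -- the reduced equation is equivalent to the first order equations for `x (v) = v_z`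
        (∀ (I : Set ℝ) (v : ℝ → ℝ), IsOpen I → I.OrdConnected → I.Nonempty →
          ContDiffOn ℝ ∞ v I →
          ((∀ z ∈ I, deriv v z = 0) →
            (SolvesReduced σ a (ρ * om) k I v ↔ ∀ z ∈ I, k * (1 - k) * v z = 0)) ∧
          ((∀ z ∈ I, deriv v z ≠ 0) →
            ∃ x : ℝ → ℝ, ContDiffOn ℝ ∞ x (v '' I) ∧ (∀ z ∈ I, deriv v z = x (v z)) ∧
              (SolvesReduced σ a (ρ * om) k I v ↔
                ∀ w ∈ v '' I, 0 ≤ σ ^ 2 - 8 * a * (ρ * om) * x w ∧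
                  (deriv x w = firstOrderRhs σ a (ρ * om) k (-1) w (x w) ∨
                   deriv x w = firstOrderRhs σ a (ρ * om) k 1 w (x w))))) ∧
        -- autonomy
        (RhsIsAutonomous σ a (ρ * om) k (-1) ↔ k = 0 ∨ k = 1) ∧
        (RhsIsAutonomous σ a (ρ * om) k 1 ↔ k = 0 ∨ k = 1)) ∧
    -- 3. The case `k = 1`.
    (∀ om : ℝ, om ≠ 0 →
      (∀ a : ℝ, a ≠ 0 →
        (σ ^ 2 / (2 * a) = 4 ↔ a = σ ^ 2 / 8) ∧
        ∀ (U : Set (ℝ × ℝ)) (u : ℝ → ℝ → ℝ), IsAdmissible a U →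
          (IsInvariantSolution σ ρ (powerLaw om 1) (scalingGen a 1) U u ↔
            ∃ v : ℝ → ℝ, ContDiffOn ℝ ∞ v (zImage a U) ∧
              SolvesFirstOrder (σ ^ 2 / (2 * a)) (ρ * om) (zImage a U) v ∧
              ∀ S t : ℝ, (S, t) ∈ U → u S t = v (zVar a S t))) ∧
      -- the complete set of invariant solutions for `a = σ² / 8`
      (∀ (U : Set (ℝ × ℝ)) (u : ℝ → ℝ → ℝ), IsAdmissible (σ ^ 2 / 8) U →
        (IsInvariantSolution σ ρ (powerLaw om 1) (scalingGen (σ ^ 2 / 8) 1) U u ↔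
          ∃ c d : ℝ, IsListed σ (ρ * om) c d U u)) ∧
      -- uniqueness up to the symmetry group
      (∀ (U : Set (ℝ × ℝ)) (u : ℝ → ℝ → ℝ), IsAdmissible (σ ^ 2 / 8) U →
        ((∃ e : ℝ, IsInvariantSolution σ ρ (powerLaw om 1) (shiftedGen (σ ^ 2 / 8) e) U u) ↔
          ∃ g ∈ symmetryGroup σ ρ (powerLaw om 1), ∃ c ∈ ({-1, 0, 1} : Set ℝ),
            ∃ (W : Set (ℝ × ℝ)) (w : ℝ → ℝ → ℝ),
              (∀ x ∈ W, 0 < x.1) ∧ IsListed σ (ρ * om) c 0 W w ∧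
              g '' graphOver w W = graphOver u U)))  := by
  have hσ' := hσ.ne'
  have hρ' := hρ.ne'
  refine ⟨fun lam J hlam hJ _ hJn => ⟨?_, ?_⟩, fun om k hom => ⟨?_, fun a ha => ?_⟩,
    fun om hom => ⟨fun a ha => ⟨?_, fun U u hU => ?_⟩, fun U u hU =>
      isInvariantSolution_iff_isListed hσ' (mul_ne_zero hρ' hom) hU, fun U u hU =>
      shifted_iff_symmetryGroup hσ' hρ' hom hU⟩⟩
  · rintro ⟨V, -, -, hV, hm, -⟩
    exact hV.exists_powerLaw hσ' hρ' hlam hJ hm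
  · rintro ⟨om, k, h⟩
    exact exists_reducing_invariantSolution σ ρ om k h hJ hJn
  · exact fun J V hJ hJc hJn => isReducingSymmetry_powerLaw_iff hσ' hρ' hom hJ hJc hJn V
  · have hb := mul_ne_zero hρ' hom
    exact ⟨fun U u hU => isInvariantSolution_iff_exists_profile hU,
      fun I v hI hIc _ hv => ⟨solvesReduced_iff_of_deriv_eq_zero hσ' hI,
        exists_firstOrder hσ' ha hb hI hIc hv⟩,
      rhsIsAutonomous_iff (-1) ha hb, rhsIsAutonomous_iff 1 ha hb⟩
  · constructor <;> intro h
    · field_simp at h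
      linarith
    · rw [h]; field_simp; norm_num
  · have hb := mul_ne_zero hρ' hom
    rw [isInvariantSolution_iff_exists_profile hU]
    refine exists_congr fun v => and_congr_right fun hv => and_congr ?_ ?_
    · rw [solvesReduced_one_iff ha hb]
      exact reducedAt_iff_solvesFirstOrder hb (by positivity) hU.isOpen_zImage
        hU.ordConnected_zImage hv
    · simp
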